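/- **Theorem (unitarity of the coupled SUSY Segal–Bargmann transforms).** Let $n\ge 1$ be an integer and let $L^2(\mathbb R)$ be the Hilbert space of complex-valued square-integrable functions. *Real side.* Let $a$, $b$ be the unbounded operators on $L^2(\mathbb R)$ $$a=\tfrac1{\sqrt2}\Big(\tfrac1{x^{n-1}}\tfrac{d}{dx}+x^n\Big),\qquad b=\tfrac1{\sqrt2}\Big(\tfrac{d}{dx}\tfrac1{x^{n-1}}+x^n\Big)$$ with domains $\{f\in L^2: x^nf\in L^2,\ x^{1-n}f'\in L^2\}$ and $\{f\in L^2: x^nf\in L^2,\ (x^{1-n}f)'\in L^2\}$, where derivatives are weak derivatives on $\mathbb R$ (so $f$, respectively $x^{1-n}f$, is locally absolutely continuous on $\mathbb R$), and let $a^*$, $b^*$ be their adjoints. Put $$\psi_0=\tfrac{n^{1/2-1/(4n)}}{\sqrt{\Gamma(1/2n)}}e^{-x^{2n}/2n},\qquad \tilde\psi_0=\tfrac{n^{1/(4n)}}{\sqrt{\Gamma(1-1/2n)}}x^{n-1}e^{-x^{2n}/2n},$$ and let $\psi_{2l},\psi_{2l+1},\tilde\psi_{2l},\tilde\psi_{2l+1}$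 be the normalizations of $(a^*b^*)^l\psi_0$, $(a^*b^*)^la^*\tilde\psi_0$, $(b^*a^*)^l\tilde\psi_0$, $(b^*a^*)^lb^*\psi_0$. *Holomorphic side.* Put $$e_{2k}=\sqrt{\tfrac{\Gamma(1/2n)}{(2n)^{2k}\Gamma(k+1/2n)k!}}\,z^{2nk},\qquad e_{2k+1}=\sqrt{\tfrac{\Gamma(1/2n)}{(2n)^{2k+2-1/n}\Gamma(k+2-1/2n)k!}}\,z^{2nk+2n-1},$$ $$\tilde e_{2k}=\sqrt{\tfrac{\Gamma(1/2n)}{(2n)^{2k+1-1/n}\Gamma(k+1-1/2n)k!}}\,z^{2nk+n-1},\qquad \tilde e_{2k+1}=\sqrt{\tfrac{\Gamma(1/2n)}{(2n)^{2k+1}\Gamma(k+1+1/2n)k!}}\,z^{2nk+n},$$ $\mathfrak F_1=\{\sum_l c_le_l:\sum|c_l|^2<\infty\}$, $\mathfrak F_2=\{\sum_l c_l\tilde e_l:\sum|c_l|^2<\infty\}$, with the inner products $\langle f,g\rangle_i=\int_{\mathbb C}f\bar g\,\rho_i\,dA$, where $dA$ is Lebesgue measure and $$\rho_i(z)=\tfrac{2}{(2n)^{1/2n}\pi\Gamma(1/2n)}\,|z|^{2n-1}K_{\nu_i}\!\big(|z|^{2n}/n\big),\qquad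 \nu_1=1-\tfrac1{2n},\ \nu_2=\tfrac1{2n},$$ $K_\nu$ being the modified Bessel function of the second kind. Put $\mathfrak a=\frac1{z^{n-1}}\frac{d}{dz}$, $\mathfrak b=\frac{d}{dz}\frac1{z^{n-1}}$. *Kernels.* Let $\alpha=n^{\frac12-\frac1{4n}}\sqrt{\Gamma(1/2n)}$, $\beta=2^{-\frac12+\frac1{2n}}n^{-\frac12+\frac3{4n}}\sqrt{\Gamma(1/2n)}$, $w=\frac{(zx)^{2n}}{2n^2}$ and $$A_1(z,x)=e^{-\frac{z^{2n}}{2n}}e^{-\frac{x^{2n}}{2n}}\Big[\tfrac{\alpha}{\Gamma(1/2n)}\,{}_0F_1(;\tfrac1{2n};w)+\tfrac{\beta}{\sqrt2\,n\,\Gamma(2-1/2n)}(zx)^{2n-1}{}_0F_1(;2-\tfrac1{2n};w)\Big],$$ $$A_2(z,x)=e^{-\frac{z^{2n}}{2n}}e^{-\frac{x^{2n}}{2n}}\Big[\tfrac{\beta}{\Gamma(1-1/2n)}(zx)^{n-1}{}_0F_1(;1-\tfrac1{2n};w)+\tfrac{\sqrt2\,\alpha}{\Gamma(1/2n)}(zx)^{n}{}_0F_1(;1+\tfrac1{2n};w)\Big].$$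 Then: 1. $A_1(z,\cdot),A_2(z,\cdot)\in L^2(\mathbb R)$ for every $z\in\mathbb C$, and $\mathcal B_if(z)=\int_{\mathbb R}A_i(z,x)f(x)\,dx$ defines linear bijections $\mathcal B_1:L^2(\mathbb R)\to\mathfrak F_1$, $\mathcal B_2:L^2(\mathbb R)\to\mathfrak F_2$ that are unitary: $\langle\mathcal B_if,\mathcal B_ig\rangle_i=\langle f,g\rangle$ (in particular norms are preserved), the integrals over $\mathbb C$ being absolutely convergent. 2. They intertwine the operators, including domains: for all $f,g\in L^2(\mathbb R)$, $f\in\operatorname{dom}a$ and $af=g$ iff $\mathfrak a\,\mathcal B_1f=\mathcal B_2g$; $f\in\operatorname{dom}b$ and $bf=g$ iff $\mathfrak b\,\mathcal B_2f=\mathcal B_1g$; $f\in\operatorname{dom}a^*$ and $a^*f=g$ iff $z^n\mathcal B_2f=\mathcal B_1g$; $f\in\operatorname{dom}b^*$ and $b^*f=g$ iff $z^n\mathcal B_1f=\mathcal B_2g$. (The identities with $\mathfrak a$, $\mathfrak b$ are between functions on $\mathbb C\setminus\{0\}$.) 3. $(\psi_l)_{l\ge0}$ and $(\tilde\psi_l)_{l\ge0}$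 are orthonormal bases of $L^2(\mathbb R)$, and $\mathcal B_1\psi_l=e_l$, $\mathcal B_2\tilde\psi_l=\tilde e_l$ for all $l$. 4. $(\mathcal B_1,\mathcal B_2)$ is the only pair of bounded linear maps $T_1:L^2(\mathbb R)\to\mathfrak F_1$, $T_2:L^2(\mathbb R)\to\mathfrak F_2$ with $\mathfrak aT_1f=T_2af$, $\mathfrak bT_2f=T_1bf$, $z^nT_2f=T_1a^*f$, $z^nT_1f=T_2b^*f$ for all $f$ in the domains of $a$, $b$, $a^*$, $b^*$ respectively, and $T_1\psi_0=e_0$, $T_2\tilde\psi_0=\tilde e_0$. -/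

import Mathlib

open MeasureTheory Filter Topology

namespace CoupledSUSY

noncomputable section

/-- The Hilbert space `L²(ℝ, dx)` of complex-valued functions (both sectors). -/
abbrev L2 : Type := Lp ℂ 2 (volume : Measure ℝ)

theorem locInt (u : L2) (m : ℕ) :
    LocallyIntegrable (fun t : ℝ => (t : ℂ) ^ m * u t) volume := by
  have h := (Lp.memLp u).locallyIntegrable (by norm_num)
  have hc : Continuous (fun t : ℝ => (t : ℂ) ^ m) := by fun_prop
  exact locallyIntegrableOn_univ.1
    ((h.locallyIntegrableOn Set.univ).continuousOn_mul hc.continuousOn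
      (isOpen_univ.isLocallyClosed))

theorem intInt (u : L2) (m : ℕ) (a b : ℝ) :
    IntervalIntegrable (fun t : ℝ => (t : ℂ) ^ m * u t) volume a b :=
  intervalIntegrable_iff.mpr <|
    ((locInt u m).integrableOn_isCompact isCompact_uIcc).mono_set Set.uIoc_subset_uIcc

/-- The graph of `a = (1/√2) (x^{1-n} d/dx + x^n)` on
`{f ∈ L² | x^n f ∈ L², x^{1-n} f' ∈ L²}`. Here `f'` is the weak derivative on `ℝ`: the condition
`u = x^{1-n} f'` says that `f` has a locally absolutely continuous representative with
`f' = x^{n-1} u`. -/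
def graphA (n : ℕ) : Submodule ℂ (L2 × L2) where
  carrier := {p | MemLp (fun x : ℝ => (x : ℂ) ^ n * p.1 x) 2 volume ∧
    ∃ (u : L2) (c : ℂ),
      (∀ᵐ x : ℝ, p.1 x = c + ∫ t in (0 : ℝ)..x, (t : ℂ) ^ (n - 1) * u t) ∧
      (∀ᵐ x : ℝ, p.2 x = ((Real.sqrt 2)⁻¹ : ℝ) * (u x + (x : ℂ) ^ n * p.1 x))}
  add_mem' := by
    rintro ⟨f, g⟩ ⟨f', g'⟩ ⟨h1, u, c, h2, h3⟩ ⟨h1', u', c', h2', h3'⟩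
    refine ⟨?_, u + u', c + c', ?_, ?_⟩
    · refine (h1.add h1').ae_eq ?_
      filter_upwards [Lp.coeFn_add f f'] with x hx
      simp only [Prod.mk_add_mk, hx, Pi.add_apply]; ring
    · filter_upwards [Lp.coeFn_add f f', h2, h2'] with x hx hx2 hx2'
      simp only [Prod.mk_add_mk, hx, Pi.add_apply] at *
      rw [hx2, hx2']
      have : (∫ t in (0 : ℝ)..x, (t : ℂ) ^ (n - 1) * (u + u' : L2) t) =
          (∫ t in (0 : ℝ)..x, (t : ℂ) ^ (n - 1) * u t) +
            ∫ t in (0 : ℝ)..x, (t : ℂ) ^ (n - 1) * u' t := by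
        rw [← intervalIntegral.integral_add (intInt _ _ _ _) (intInt _ _ _ _)]
        refine intervalIntegral.integral_congr_ae ?_
        filter_upwards [Lp.coeFn_add u u'] with t ht _
        rw [ht, Pi.add_apply]; ring
      rw [this]; ring
    · filter_upwards [Lp.coeFn_add f f', Lp.coeFn_add g g', Lp.coeFn_add u u', h3, h3']
        with x e1 e2 e3 hx hx'
      simp only [Prod.mk_add_mk, e1, e2, e3, Pi.add_apply] at *
      rw [hx, hx']; ring
  zero_mem' := by
    have hz := Lp.coeFn_zero ℂ 2 (volume : Measure ℝ)
    refine ⟨?_, 0, 0, ?_, ?_⟩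
    · refine (MemLp.zero (ε := ℂ)).ae_eq ?_
      filter_upwards [hz] with x hx
      simp [hx]
    · filter_upwards [hz] with x hx
      have : (∫ t in (0 : ℝ)..x, (t : ℂ) ^ (n - 1) * (0 : L2) t) = ∫ t in (0 : ℝ)..x, (0 : ℂ) := by
        refine intervalIntegral.integral_congr_ae ?_
        filter_upwards [hz] with t ht _
        simp [ht]
      simp [hx, this]
    · filter_upwards [hz] with x hx
      simp [hx]
  smul_mem' := by
    rintro k ⟨f, g⟩ ⟨h1, u, c, h2, h3⟩
    refine ⟨?_, k • u, k * c, ?_, ?_⟩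
    · refine (h1.const_mul k).ae_eq ?_
      filter_upwards [Lp.coeFn_smul k f] with x hx
      simp only [Prod.smul_mk, hx, Pi.smul_apply, smul_eq_mul]; ring
    · filter_upwards [Lp.coeFn_smul k f, h2] with x hx hx2
      simp only [Prod.smul_mk, hx, Pi.smul_apply, smul_eq_mul] at *
      rw [hx2]
      have : (∫ t in (0 : ℝ)..x, (t : ℂ) ^ (n - 1) * (k • u : L2) t) =
          k * ∫ t in (0 : ℝ)..x, (t : ℂ) ^ (n - 1) * u t := by
        rw [← intervalIntegral.integral_const_mul]
        refine intervalIntegral.integral_congr_ae ?_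
        filter_upwards [Lp.coeFn_smul k u] with t ht _
        rw [ht, Pi.smul_apply, smul_eq_mul]; ring
      rw [this]; ring
    · filter_upwards [Lp.coeFn_smul k f, Lp.coeFn_smul k g, Lp.coeFn_smul k u, h3]
        with x e1 e2 e3 hx
      simp only [Prod.smul_mk, e1, e2, e3, Pi.smul_apply, smul_eq_mul] at *
      rw [hx]; ring

/-- The graph of `b = (1/√2) (d/dx x^{1-n} + x^n)` on
`{f ∈ L² | x^n f ∈ L², (x^{1-n} f)' ∈ L²}`: the condition `v = (x^{1-n} f)'` says that `x^{1-n} f`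
has a locally absolutely continuous representative on `ℝ` with derivative `v`. -/
def graphB (n : ℕ) : Submodule ℂ (L2 × L2) where
  carrier := {p | MemLp (fun x : ℝ => (x : ℂ) ^ n * p.1 x) 2 volume ∧
    ∃ (v : L2) (c : ℂ),
      (∀ᵐ x : ℝ, p.1 x = (x : ℂ) ^ (n - 1) * (c + ∫ t in (0 : ℝ)..x, v t)) ∧
      (∀ᵐ x : ℝ, p.2 x = ((Real.sqrt 2)⁻¹ : ℝ) * (v x + (x : ℂ) ^ n * p.1 x))}
  add_mem' := by
    rintro ⟨f, g⟩ ⟨f', g'⟩ ⟨h1, u, c, h2, h3⟩ ⟨h1', u', c', h2', h3'⟩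
    refine ⟨?_, u + u', c + c', ?_, ?_⟩
    · refine (h1.add h1').ae_eq ?_
      filter_upwards [Lp.coeFn_add f f'] with x hx
      simp only [Prod.mk_add_mk, hx, Pi.add_apply]; ring
    · filter_upwards [Lp.coeFn_add f f', h2, h2'] with x hx hx2 hx2'
      simp only [Prod.mk_add_mk, hx, Pi.add_apply] at *
      rw [hx2, hx2']
      have : (∫ t in (0 : ℝ)..x, (u + u' : L2) t) =
          (∫ t in (0 : ℝ)..x, u t) + ∫ t in (0 : ℝ)..x, u' t := by
        rw [← intervalIntegral.integral_add (by simpa using intInt u 0 0 x)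
          (by simpa using intInt u' 0 0 x)]
        refine intervalIntegral.integral_congr_ae ?_
        filter_upwards [Lp.coeFn_add u u'] with t ht _
        rw [ht, Pi.add_apply]
      rw [this]; ring
    · filter_upwards [Lp.coeFn_add f f', Lp.coeFn_add g g', Lp.coeFn_add u u', h3, h3']
        with x e1 e2 e3 hx hx'
      simp only [Prod.mk_add_mk, e1, e2, e3, Pi.add_apply] at *
      rw [hx, hx']; ring
  zero_mem' := by
    have hz := Lp.coeFn_zero ℂ 2 (volume : Measure ℝ)
    refine ⟨?_, 0, 0, ?_, ?_⟩
    · refine (MemLp.zero (ε := ℂ)).ae_eq ?_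
      filter_upwards [hz] with x hx
      simp [hx]
    · filter_upwards [hz] with x hx
      have : (∫ t in (0 : ℝ)..x, (0 : L2) t) = ∫ t in (0 : ℝ)..x, (0 : ℂ) := by
        refine intervalIntegral.integral_congr_ae ?_
        filter_upwards [hz] with t ht _
        simp [ht]
      simp [hx, this]
    · filter_upwards [hz] with x hx
      simp [hx]
  smul_mem' := by
    rintro k ⟨f, g⟩ ⟨h1, u, c, h2, h3⟩
    refine ⟨?_, k • u, k * c, ?_, ?_⟩
    · refine (h1.const_mul k).ae_eq ?_
      filter_upwards [Lp.coeFn_smul k f] with x hx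
      simp only [Prod.smul_mk, hx, Pi.smul_apply, smul_eq_mul]; ring
    · filter_upwards [Lp.coeFn_smul k f, h2] with x hx hx2
      simp only [Prod.smul_mk, hx, Pi.smul_apply, smul_eq_mul] at *
      rw [hx2]
      have : (∫ t in (0 : ℝ)..x, (k • u : L2) t) = k * ∫ t in (0 : ℝ)..x, u t := by
        rw [← intervalIntegral.integral_const_mul]
        refine intervalIntegral.integral_congr_ae ?_
        filter_upwards [Lp.coeFn_smul k u] with t ht _
        rw [ht, Pi.smul_apply, smul_eq_mul]
      rw [this]; ring
    · filter_upwards [Lp.coeFn_smul k f, Lp.coeFn_smul k g, Lp.coeFn_smul k u, h3]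
        with x e1 e2 e3 hx
      simp only [Prod.smul_mk, e1, e2, e3, Pi.smul_apply, smul_eq_mul] at *
      rw [hx]; ring

theorem ae_zero_of_primitive {w : ℝ → ℂ} (hw : LocallyIntegrable w volume) (c : ℂ)
    (h : ∀ᵐ x : ℝ, c + ∫ t in (0 : ℝ)..x, w t = 0) : ∀ᵐ x : ℝ, w x = 0 := by
  have hint : ∀ a b : ℝ, IntervalIntegrable w volume a b := fun a b =>
    intervalIntegrable_iff.mpr <|
      (hw.integrableOn_isCompact isCompact_uIcc).mono_set Set.uIoc_subset_uIcc
  have hcont : Continuous fun x : ℝ => c + ∫ t in (0 : ℝ)..x, w t :=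
    continuous_const.add (intervalIntegral.continuous_primitive hint 0)
  have h0 : (fun x : ℝ => c + ∫ t in (0 : ℝ)..x, w t) = fun _ => 0 :=
    (hcont.ae_eq_iff_eq volume continuous_const).1 h
  have h1 : (fun x : ℝ => ∫ t in (0 : ℝ)..x, w t) = fun _ => -c := by
    funext x
    have := congrFun h0 x
    exact (neg_eq_of_add_eq_zero_right this).symm
  filter_upwards [_root_.LocallyIntegrable.ae_hasDerivAt_integral hw] with x hx
  have := hx 0
  rw [h1] at this
  exact this.unique (hasDerivAt_const x (-c))

theorem ae_ne_zero : ∀ᵐ x : ℝ, x ≠ 0 := by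
  simp [ae_iff]

theorem graphA_functional (n : ℕ) (p : L2 × L2) (hp : p ∈ graphA n) (h0 : p.1 = 0) :
    p.2 = 0 := by
  obtain ⟨f, g⟩ := p
  obtain ⟨-, u, c, h2, h3⟩ := hp
  simp only at h0 h2 h3
  subst h0
  have hz := Lp.coeFn_zero ℂ 2 (volume : Measure ℝ)
  have hw := ae_zero_of_primitive (locInt u (n - 1)) c (by
    filter_upwards [h2, hz] with x hx hx0
    rw [← hx, hx0]; rfl)
  refine Lp.ext ?_
  filter_upwards [h3, hz, hw, ae_ne_zero] with x e1 e2 e3 e4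
  have : u x = 0 := by
    rcases mul_eq_zero.1 e3 with h | h
    · exact absurd h (pow_ne_zero _ (by exact_mod_cast e4))
    · exact h
  rw [e1, e2, this]; simp

theorem graphB_functional (n : ℕ) (p : L2 × L2) (hp : p ∈ graphB n) (h0 : p.1 = 0) :
    p.2 = 0 := by
  obtain ⟨f, g⟩ := p
  obtain ⟨-, u, c, h2, h3⟩ := hp
  simp only at h0 h2 h3
  subst h0
  have hz := Lp.coeFn_zero ℂ 2 (volume : Measure ℝ)
  have hw := ae_zero_of_primitive (w := fun t => u t) (by simpa using locInt u 0) c (by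
    filter_upwards [h2, hz, ae_ne_zero] with x hx hx0 hne
    rw [hx0] at hx
    rcases mul_eq_zero.1 hx.symm with h | h
    · exact absurd h (pow_ne_zero _ (by exact_mod_cast hne))
    · exact h)
  refine Lp.ext ?_
  filter_upwards [h3, hz, hw] with x e1 e2 e3
  rw [e1, e2, e3]; simp

/-- The unbounded operator `a` on `L²(ℝ)`. -/
def opA (n : ℕ) : L2 →ₗ.[ℂ] L2 := (graphA n).toLinearPMap

/-- The unbounded operator `b` on `L²(ℝ)`. -/
def opB (n : ℕ) : L2 →ₗ.[ℂ] L2 := (graphB n).toLinearPMap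

theorem opA_graph (n : ℕ) : (opA n).graph = graphA n :=
  Submodule.toLinearPMap_graph_eq _ fun x h h' => graphA_functional n x h h'

theorem opB_graph (n : ℕ) : (opB n).graph = graphB n :=
  Submodule.toLinearPMap_graph_eq _ fun x h h' => graphB_functional n x h h'

/-- The Hilbert space adjoint `a*`. -/
def opAstar (n : ℕ) : L2 →ₗ.[ℂ] L2 := (opA n).adjoint

/-- The Hilbert space adjoint `b*`. -/
def opBstar (n : ℕ) : L2 →ₗ.[ℂ] L2 := (opB n).adjoint

open Classical in
/-- `T f` for `f` in the domain of `T`, and `0` otherwise. -/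
def app (T : L2 →ₗ.[ℂ] L2) (f : L2) : L2 := if h : f ∈ T.domain then T ⟨f, h⟩ else 0

/-- `f / ‖f‖`. -/
def normalize (f : L2) : L2 := ((‖f‖⁻¹ : ℝ) : ℂ) • f

theorem memLp_pow_mul_exp (n : ℕ) (hn : 1 ≤ n) (m : ℕ) (c : ℝ) :
    MemLp (fun x : ℝ => ((c * x ^ m * Real.exp (-(x ^ (2 * n) / (2 * n))) : ℝ) : ℂ)) 2 volume := by
  have hn0 : (0 : ℝ) < n := by exact_mod_cast hn
  have hcont : Continuous fun x : ℝ => c * x ^ m * Real.exp (-(x ^ (2 * n) / (2 * n))) := by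
    fun_prop
  suffices MemLp (fun x : ℝ => c * x ^ m * Real.exp (-(x ^ (2 * n) / (2 * n)))) 2 volume from
    this.ofReal
  rw [memLp_two_iff_integrable_sq hcont.aestronglyMeasurable]
  have h := integrableOn_rpow_mul_exp_neg_mul_rpow (p := 2 * n) (s := 2 * m) (b := (n : ℝ)⁻¹)
    (by have : (0 : ℝ) ≤ m := Nat.cast_nonneg m
        linarith) (by positivity) (by positivity)
  have h2 : IntegrableOn (fun x : ℝ => x ^ (2 * m) * Real.exp (-(n : ℝ)⁻¹ * x ^ (2 * n)))
      (Set.Ioi 0) := by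
    refine h.congr_fun (fun x _ => ?_) measurableSet_Ioi
    simp only
    have e1 : x ^ ((2 : ℝ) * m) = x ^ (2 * m) := by
      rw [← Real.rpow_natCast]; push_cast; rfl
    have e2 : x ^ ((2 : ℝ) * n) = x ^ (2 * n) := by
      rw [← Real.rpow_natCast]; push_cast; rfl
    rw [e1, e2]
  have even : ∀ x : ℝ, (-x) ^ (2 * m) * Real.exp (-(n : ℝ)⁻¹ * (-x) ^ (2 * n)) =
      x ^ (2 * m) * Real.exp (-(n : ℝ)⁻¹ * x ^ (2 * n)) := fun x => by
    rw [(even_two_mul m).neg_pow, (even_two_mul n).neg_pow]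
  have h3 : IntegrableOn (fun x : ℝ => x ^ (2 * m) * Real.exp (-(n : ℝ)⁻¹ * x ^ (2 * n)))
      (Set.Iic 0) := by
    rw [← Measure.map_neg_eq_self (volume : Measure ℝ)]
    have me : MeasurableEmbedding fun x : ℝ => -x := (Homeomorph.neg ℝ).measurableEmbedding
    rw [me.integrableOn_map_iff]
    simp_rw [Function.comp_def, even, Set.neg_preimage, Set.neg_Iic, neg_zero]
    exact Iff.mpr integrableOn_Ici_iff_integrableOn_Ioi h2
  have h4 := (integrableOn_univ.1 (Set.Iic_union_Ioi (a := (0 : ℝ)) ▸ h3.union h2)).const_mul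
    (c ^ 2)
  refine h4.congr (Eventually.of_forall fun x => ?_)
  simp only
  rw [mul_pow, mul_pow, ← Real.exp_nat_mul]
  have : -(n : ℝ)⁻¹ * x ^ (2 * n) = ((2 : ℕ) : ℝ) * -(x ^ (2 * n) / (2 * n)) := by
    push_cast; field_simp
  rw [this, pow_mul x 2 m, pow_right_comm]
  ring

open Classical in
/-- The class in `L²(ℝ)` of a square-integrable real function. -/
def toL2 (f : ℝ → ℝ) : L2 :=
  if h : MemLp (fun x => (f x : ℂ)) 2 volume then h.toLp else 0

/-- `ψ₀ = n^{1/2 - 1/(4n)} Γ(1/(2n))^{-1/2} e^{-x^{2n}/(2n)}`. -/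
def psiZero (n : ℕ) : ℝ → ℝ := fun x =>
  (n : ℝ) ^ ((1 : ℝ) / 2 - 1 / (4 * n)) / Real.sqrt (Real.Gamma (1 / (2 * n))) *
    Real.exp (-(x ^ (2 * n) / (2 * n)))

/-- `ψ̃₀ = n^{1/(4n)} Γ(1 - 1/(2n))^{-1/2} x^{n-1} e^{-x^{2n}/(2n)}`. -/
def psiTildeZero (n : ℕ) : ℝ → ℝ := fun x =>
  (n : ℝ) ^ ((1 : ℝ) / (4 * n)) / Real.sqrt (Real.Gamma (1 - 1 / (2 * n))) *
    x ^ (n - 1) * Real.exp (-(x ^ (2 * n) / (2 * n)))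

theorem memLp_psiZero (n : ℕ) (hn : 1 ≤ n) :
    MemLp (fun x => (psiZero n x : ℂ)) 2 volume := by
  have := memLp_pow_mul_exp n hn 0
    ((n : ℝ) ^ ((1 : ℝ) / 2 - 1 / (4 * n)) / Real.sqrt (Real.Gamma (1 / (2 * n))))
  simpa only [psiZero, pow_zero, mul_one] using this

theorem memLp_psiTildeZero (n : ℕ) (hn : 1 ≤ n) :
    MemLp (fun x => (psiTildeZero n x : ℂ)) 2 volume :=
  memLp_pow_mul_exp n hn (n - 1) _

/-- `ψ_{2l} = (a*b*)^l ψ₀ / ‖·‖` and `ψ_{2l+1} = (a*b*)^l a* ψ̃₀ / ‖·‖`. -/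
def psi (n l : ℕ) : L2 :=
  normalize ((fun f => app (opAstar n) (app (opBstar n) f))^[l / 2]
    (if Even l then toL2 (psiZero n) else app (opAstar n) (toL2 (psiTildeZero n))))

/-- `ψ̃_{2l} = (b*a*)^l ψ̃₀ / ‖·‖` and `ψ̃_{2l+1} = (b*a*)^l b* ψ₀ / ‖·‖`. -/
def psiTilde (n l : ℕ) : L2 :=
  normalize ((fun f => app (opBstar n) (app (opAstar n) f))^[l / 2]
    (if Even l then toL2 (psiTildeZero n) else app (opBstar n) (toL2 (psiZero n))))

/-- The modified Bessel function of the first kind `I_ν(x)`, `x > 0`. -/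
def besselI (ν x : ℝ) : ℝ :=
  (x / 2) ^ ν * ∑' l : ℕ, 1 / (Real.Gamma (l + ν + 1) * l.factorial) * (x / 2) ^ (2 * l)

/-- The modified Bessel function of the second kind `K_ν(x)`, `x > 0`, for non-integer `ν`. -/
def besselK (ν x : ℝ) : ℝ :=
  Real.pi / (2 * Real.sin (ν * Real.pi)) * (besselI (-ν) x - besselI ν x)

/-- The weight with Bessel index `ν`:
`2 / ((2n)^{1/(2n)} π Γ(1/(2n))) (z z̄)^{n-1/2} K_ν((z z̄)^n / n)`. -/
def weight (n : ℕ) (ν : ℝ) (z : ℂ) : ℝ :=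
  2 / ((2 * n : ℝ) ^ ((1 : ℝ) / (2 * n)) * Real.pi * Real.Gamma (1 / (2 * n))) *
    Complex.normSq z ^ ((n : ℝ) - 1 / 2) * besselK ν (Complex.normSq z ^ n / n)

def rho1 (n : ℕ) (z : ℂ) : ℝ := weight n (1 - 1 / (2 * n)) z

def rho2 (n : ℕ) (z : ℂ) : ℝ := weight n (1 / (2 * n)) z

/-- The functions `e_l`. -/
def e (n l : ℕ) (z : ℂ) : ℂ :=
  let k := l / 2
  if Even l then
    (Real.sqrt (Real.Gamma (1 / (2 * n)) /
      ((2 * n : ℝ) ^ (2 * k) * Real.Gamma (k + 1 / (2 * n)) * k.factorial)) : ℂ) * z ^ (2 * n * k)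
  else
    (Real.sqrt (Real.Gamma (1 / (2 * n)) /
      ((2 * n : ℝ) ^ (2 * k + 2 - 1 / n : ℝ) * Real.Gamma (k + 2 - 1 / (2 * n)) *
        k.factorial)) : ℂ) * z ^ (2 * n * k + 2 * n - 1)

/-- The functions `ẽ_l`. -/
def eTilde (n l : ℕ) (z : ℂ) : ℂ :=
  let k := l / 2
  if Even l then
    (Real.sqrt (Real.Gamma (1 / (2 * n)) /
      ((2 * n : ℝ) ^ (2 * k + 1 - 1 / n : ℝ) * Real.Gamma (k + 1 - 1 / (2 * n)) *
        k.factorial)) : ℂ) * z ^ (2 * n * k + n - 1)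
  else
    (Real.sqrt (Real.Gamma (1 / (2 * n)) /
      ((2 * n : ℝ) ^ (2 * k + 1) * Real.Gamma (k + 1 + 1 / (2 * n)) * k.factorial)) : ℂ) *
        z ^ (2 * n * k + n)

/-- The functions `∑ c_l φ_l` with square-summable coefficients `c`. -/
def seriesSpace (φ : ℕ → ℂ → ℂ) : Submodule ℂ (ℂ → ℂ) where
  carrier := {F | ∃ c : lp (fun _ : ℕ => ℂ) 2, ∀ z, HasSum (fun l => c l * φ l z) (F z)}
  add_mem' := by
    rintro F G ⟨c, hc⟩ ⟨d, hd⟩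
    refine ⟨c + d, fun z => ?_⟩
    simpa [add_mul] using (hc z).add (hd z)
  zero_mem' := ⟨0, fun z => by simp⟩
  smul_mem' := by
    rintro k F ⟨c, hc⟩
    refine ⟨k • c, fun z => ?_⟩
    simpa [mul_assoc] using (hc z).mul_left k

/-- The space `𝔉₁`. -/
def F1 (n : ℕ) : Submodule ℂ (ℂ → ℂ) := seriesSpace (e n)

/-- The space `𝔉₂`. -/
def F2 (n : ℕ) : Submodule ℂ (ℂ → ℂ) := seriesSpace (eTilde n)

/-- The integrand of the weighted inner product `∫ F Ḡ ρ dA`. -/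
def innerIntegrand (ρ : ℂ → ℝ) (F G : ℂ → ℂ) (z : ℂ) : ℂ :=
  F z * (starRingEnd ℂ) (G z) * (ρ z : ℂ)

/-- `‖F‖² = ∫ |F|² ρ dA`, as a real number. -/
def normSqOn (ρ : ℂ → ℝ) (F : ℂ → ℂ) : ℝ := ∫ z, ‖F z‖ ^ 2 * ρ z

/-- `G = z^{1-n} dF/dz`. -/
def IsHolA (n : ℕ) (F G : ℂ → ℂ) : Prop :=
  ∀ z, z ≠ 0 → DifferentiableAt ℂ F z ∧ G z = 1 / z ^ (n - 1) * deriv F z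

/-- `G = d/dz (z^{1-n} F)`. -/
def IsHolB (n : ℕ) (F G : ℂ → ℂ) : Prop :=
  ∀ z, z ≠ 0 → DifferentiableAt ℂ F z ∧ G z = deriv (fun w => 1 / w ^ (n - 1) * F w) z

/-- `G = z^n F`. -/
def IsMulPow (n : ℕ) (F G : ℂ → ℂ) : Prop := ∀ z, G z = z ^ n * F z

/-- The hypergeometric function `₀F₁(; b; w) = ∑ w^k / ((b)_k k!)`. -/
def zeroFOne (b : ℝ) (w : ℂ) : ℂ :=
  ∑' k : ℕ, w ^ k / ((ascPochhammer ℂ k).eval (b : ℂ) * k.factorial)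

def alpha (n : ℕ) : ℝ :=
  (n : ℝ) ^ ((1 : ℝ) / 2 - 1 / (4 * n)) * Real.sqrt (Real.Gamma (1 / (2 * n)))

def beta (n : ℕ) : ℝ :=
  (2 : ℝ) ^ (-(1 : ℝ) / 2 + 1 / (2 * n)) * (n : ℝ) ^ (-(1 : ℝ) / 2 + 3 / (4 * n)) *
    Real.sqrt (Real.Gamma (1 / (2 * n)))

/-- The factor of the first kernel without the generalized Gaussians. -/
def kerB1 (n : ℕ) (z : ℂ) (x : ℝ) : ℂ :=
  (alpha n / Real.Gamma (1 / (2 * n)) : ℝ) *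
      zeroFOne (1 / (2 * n)) ((z * x) ^ (2 * n) / (2 * n ^ 2)) +
    (beta n / (Real.sqrt 2 * n * Real.Gamma (2 - 1 / (2 * n))) : ℝ) * (z * x) ^ (2 * n - 1) *
      zeroFOne (2 - 1 / (2 * n)) ((z * x) ^ (2 * n) / (2 * n ^ 2))

/-- The factor of the second kernel without the generalized Gaussians. -/
def kerB2 (n : ℕ) (z : ℂ) (x : ℝ) : ℂ :=
  (beta n / Real.Gamma (1 - 1 / (2 * n)) : ℝ) * (z * x) ^ (n - 1) *
      zeroFOne (1 - 1 / (2 * n)) ((z * x) ^ (2 * n) / (2 * n ^ 2)) +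
    (Real.sqrt 2 * alpha n / Real.Gamma (1 / (2 * n)) : ℝ) * (z * x) ^ n *
      zeroFOne (1 + 1 / (2 * n)) ((z * x) ^ (2 * n) / (2 * n ^ 2))

/-- The kernel `A₁(z, x) = e^{-z^{2n}/2n} B₁(z, x) e^{-x^{2n}/2n}`. -/
def kerA1 (n : ℕ) (z : ℂ) (x : ℝ) : ℂ :=
  Complex.exp (-(z ^ (2 * n) / (2 * n))) * kerB1 n z x *
    Complex.exp (-((x : ℂ) ^ (2 * n) / (2 * n)))

/-- The kernel `A₂(z, x) = e^{-z^{2n}/2n} B₂(z, x) e^{-x^{2n}/2n}`. -/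
def kerA2 (n : ℕ) (z : ℂ) (x : ℝ) : ℂ :=
  Complex.exp (-(z ^ (2 * n) / (2 * n))) * kerB2 n z x *
    Complex.exp (-((x : ℂ) ^ (2 * n) / (2 * n)))

/-- The coupled SUSY Segal-Bargmann transform `𝓑₁`. -/
def SB1 (n : ℕ) (f : L2) (z : ℂ) : ℂ := ∫ x : ℝ, kerA1 n z x * f x

/-- The coupled SUSY Segal-Bargmann transform `𝓑₂`. -/
def SB2 (n : ℕ) (f : L2) (z : ℂ) : ℂ := ∫ x : ℝ, kerA2 n z x * f x

/-- The four commutative diagrams `𝔞 T₁ = T₂ a`, `𝔟 T₂ = T₁ b`, `z^n T₂ = T₁ a*`,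
`z^n T₁ = T₂ b*` on the domains of `a`, `b`, `a*`, `b*`. -/
def DiagramsCommute (n : ℕ) (T₁ : L2 →ₗ[ℂ] F1 n) (T₂ : L2 →ₗ[ℂ] F2 n) : Prop :=
  (∀ f g, (f, g) ∈ (opA n).graph → IsHolA n (T₁ f) (T₂ g)) ∧
  (∀ f g, (f, g) ∈ (opB n).graph → IsHolB n (T₂ f) (T₁ g)) ∧
  (∀ f g, (f, g) ∈ (opAstar n).graph → IsMulPow n (T₂ f) (T₁ g)) ∧
  (∀ f g, (f, g) ∈ (opBstar n).graph → IsMulPow n (T₁ f) (T₂ g))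

end

end CoupledSUSY

/-!
The two halves of the theorem are one statement about a *sector* `(r, s)`, a pair of natural numbers
with `r + s + 1 = n`: `(0, n - 1)` is the first half, `(n - 1, 0)` the second, and exchanging `r`
and `s` exchanges them. The lowering operator `(x ^ (-s) (d/dx) x ^ (-r) + x ^ n) / √2` maps the
sector `(r, s)` to the sector `(s, r)`; it is `a` for `(0, n - 1)` and `b` for `(n - 1, 0)`.

The reason for the unitarity is that the operators on `L²(ℝ)` and those on power series are the same
weighted shifts. Write `rung n r s l` for the matrix elements.

*Real side.* The levels are `x ^ r * lad n r s l * exp (-x ^ (2 * n) / (2 * n))`, with polynomials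
`lad` given by a three term recurrence; lowering and raising take each level to a multiple of a
neighbouring level of the other sector, by `lad_recurrence` and `derivative_lad`. Integration by
parts makes the levels orthonormal (`orthonormal_level`). They are complete
(`eq_zero_of_inner_level`): a function orthogonal to all of them has vanishing moments in the
variable `x ^ (2 * n)`, separately for its even and its odd part, and with exponential moments this
is a determinate moment problem. The maximal domain of the lowering operator consists of the
functions for which the weighted shift makes sense (`isLower_iff`). Indeed the squared matrix
elements of lowering and raising differ by a constant only, so that both shifts apply to the same
functions, and the graph of the pair is closed. The adjoint of a weighted shift is the transposed
shift (`mem_adjoint_graph_iff`), and therefore the `ψ_l`, `ψ̃_l` are the levels.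

*Holomorphic side.* Multiplication by `z ^ n` and `z ^ (-s) (d/dz) z ^ (-r)` act on the monomials
`hol n r s l` with the same matrix elements (`hasSum_raise`, `hasSum_lower`). The monomials are
orthonormal for the Bessel weight: different degrees are orthogonal by rotation invariance, and the
radial moments (`moment_weight`) follow from the representation of `K_ν(x)` as
`(x / 2) ^ (-ν) / 2 * ∫ t ^ (ν - 1) * exp (-t - (x / 2) ^ 2 / t) dt` over `t > 0`. As `K_ν` is
defined by the difference of `I_{-ν}` and `I_ν`, this integral has to be identified with it
(`besselK_eq_besselInt`): both sides yield solutions of one first order system with the same values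
at its singular point `0`, where uniqueness holds.

*The kernel* connects the two sides. By the recurrence for the series `∑ y ^ l / (Γ(l + a + 1) l!)`
the lowering operator in `x` maps the kernel of one sector to `z ^ n` times the kernel of the other
(`exists_kerLp_mem_ladderGraph`). Hence the coefficients of the kernel in the levels satisfy the
recurrence of the `hol n r s l`, and it remains to compute the ground state coefficient, by termwise
integration. So the kernel is `∑ hol n r s l z * level n r s l x` (`inner_level_kerLp`), the
transform is the identity on coefficients (`hasSum_segalBargmann`), and unitarity and the
intertwining relations can be read off.

*Uniqueness.* The relations for the two raising operators determine an intertwining pair on all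
levels from its values on the two ground states (`eq_hol_succ`), and boundedness determines it
everywhere (`eq_transform`).
-/

namespace CoupledSUSY

noncomputable section

/-! ### The ladder polynomials -/

/-- The exponent of `z` in the `l`-th holomorphic basis function of the `(r, s)` sector. Here and
below a sector is a pair `(r, s)` with `r + s + 1 = n`; raising and lowering lead from `(r, s)` to
`(s, r)`, which is the reason for the exchanged arguments in the recursions. -/
def expo (n : ℕ) : ℕ → ℕ → ℕ → ℕ
  | r, _, 0 => r
  | r, s, l + 1 => expo n s r l + n

/-- The square of the matrix element between the `l`-th level of the `(s, r)` sector and the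
`(l + 1)`-st level of the `(r, s)` sector. -/
def rungSq (n r s l : ℕ) : ℝ := expo n s r l + n - r

/-- The matrix element between the `l`-th level of the `(s, r)` sector and the `(l + 1)`-st level
of the `(r, s)` sector. -/
def rung (n r s l : ℕ) : ℝ := Real.sqrt (rungSq n r s l)

/-- The normalization constant of the ground state `x ^ r * exp (-x ^ (2 * n) / (2 * n))`. -/
def groundNorm (n r : ℕ) : ℝ :=
  (n : ℝ) ^ ((1 : ℝ) / 2 - (2 * r + 1) / (4 * n)) / Real.sqrt (Real.Gamma ((2 * r + 1) / (2 * n)))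

open Polynomial in
/-- The polynomial `p` for which `x ^ r * p x * exp (-x ^ (2 * n) / (2 * n))` is the `l`-th level
of the `(r, s)` sector. The recursion expresses that `√2 x ^ n` is the sum of the raising and the
lowering operator; the factor `x ^ n * x ^ s = x ^ r * x ^ (2 * s + 1)` accounts for the exponent
of `X`. -/
def lad (n : ℕ) : ℕ → ℕ → ℕ → ℝ[X]
  | r, _, 0 => C (groundNorm n r)
  | r, s, 1 => C (rung n r s 0)⁻¹ * (C (Real.sqrt 2) * X ^ (2 * s + 1) * lad n s r 0)
  | r, s, l + 2 => C (rung n r s (l + 1))⁻¹ *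
      (C (Real.sqrt 2) * X ^ (2 * s + 1) * lad n s r (l + 1) - C (rung n s r l) * lad n r s l)

open Polynomial in
/-- The polynomial belonging to the image of the `l`-th level of the `(r, s)` sector under the
lowering operator; this image lies in the `(s, r)` sector. -/
def lowered (n r s : ℕ) : ℕ → ℝ[X]
  | 0 => 0
  | l + 1 => C (rung n r s l) * lad n s r l

theorem le_expo (n r s l : ℕ) (h : r + s + 1 = n) : r ≤ expo n r s l := by
  cases l with
  | zero => simp [expo]
  | succ l => simp only [expo]; omega

theorem rungSq_zero (n r s : ℕ) (h : r + s + 1 = n) : rungSq n r s 0 = 2 * s + 1 := by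
  simp only [rungSq, expo, ← h]; push_cast; ring

theorem rungSq_succ (n r s l : ℕ) (h : r + s + 1 = n) :
    rungSq n r s (l + 1) = rungSq n s r l + (2 * s + 1) := by
  simp only [rungSq, expo, ← h]; push_cast; ring

theorem rungSq_pos (n r s l : ℕ) (h : r + s + 1 = n) : 0 < rungSq n r s l := by
  have h1 : (s : ℝ) ≤ expo n s r l := by exact_mod_cast le_expo n s r l (by omega)
  have h2 : (n : ℝ) = r + s + 1 := by exact_mod_cast h.symm
  have h3 : (0 : ℝ) ≤ s := Nat.cast_nonneg s
  rw [rungSq]; linarith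

theorem rung_pos (n r s l : ℕ) (h : r + s + 1 = n) : 0 < rung n r s l :=
  Real.sqrt_pos.2 (rungSq_pos n r s l h)

theorem rung_sq (n r s l : ℕ) (h : r + s + 1 = n) : rung n r s l ^ 2 = rungSq n r s l :=
  Real.sq_sqrt (rungSq_pos n r s l h).le

theorem rung_zero_sq (n r s : ℕ) (h : r + s + 1 = n) : rung n r s 0 ^ 2 = 2 * s + 1 := by
  rw [rung_sq _ _ _ _ h, rungSq_zero _ _ _ h]

theorem rung_succ_sq (n r s l : ℕ) (h : r + s + 1 = n) :
    rung n r s (l + 1) ^ 2 = rung n s r l ^ 2 + (2 * s + 1) := by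
  rw [rung_sq _ _ _ _ h, rung_sq _ _ _ _ (by omega), rungSq_succ _ _ _ _ h]

theorem lowered_zero (n r s : ℕ) : lowered n r s 0 = 0 := rfl

open Polynomial in
theorem lowered_succ (n r s l : ℕ) :
    lowered n r s (l + 1) = C (rung n r s l) * lad n s r l := rfl

open Polynomial in
/-- Multiplication by `√2 x ^ n` is the sum of the raising and the lowering operator. -/
theorem lad_recurrence (n r s l : ℕ) (h : r + s + 1 = n) :
    C (Real.sqrt 2) * X ^ (2 * s + 1) * lad n s r l =
      C (rung n r s l) * lad n r s (l + 1) + lowered n s r l := by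
  have hc : C (rung n r s l) * C (rung n r s l)⁻¹ = (1 : ℝ[X]) := by
    rw [← C_mul, mul_inv_cancel₀ (rung_pos n r s l h).ne', C_1]
  cases l with
  | zero =>
    have : lad n r s (0 + 1) =
      C (rung n r s 0)⁻¹ * (C (Real.sqrt 2) * X ^ (2 * s + 1) * lad n s r 0) := rfl
    rw [this, lowered_zero, ← mul_assoc, hc]; ring
  | succ l =>
    have : lad n r s (l + 1 + 1) = C (rung n r s (l + 1))⁻¹ *
      (C (Real.sqrt 2) * X ^ (2 * s + 1) * lad n s r (l + 1) -
        C (rung n s r l) * lad n r s l) := rfl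
    rw [this, lowered_succ, ← mul_assoc, hc]; ring

open Polynomial in
/-- The lowering operator acts on `x ^ r * p x * exp (-x ^ (2 * n) / (2 * n))` by differentiating
the polynomial `p`. The induction compares the derivative of the recurrence with the recurrence one
level below. -/
theorem derivative_lad (n r s l : ℕ) (h : r + s + 1 = n) :
    derivative (lad n r s l) = C (Real.sqrt 2) * X ^ (2 * s) * lowered n r s l := by
  induction l using Nat.strong_induction_on generalizing r s with
  | _ l ih =>
  rcases l with _ | l
  · simp [lad, lowered]
  have hne : (C (rung n r s l) : ℝ[X]) ≠ 0 := C_ne_zero.2 (rung_pos n r s l h).ne'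
  have hrec := congrArg derivative (lad_recurrence n r s l h)
  have ihl := ih l (by omega) s r (by omega)
  have hcast : ((2 * s + 1 : ℕ) : ℝ) = 2 * s + 1 := by push_cast; ring
  apply mul_left_cancel₀ hne
  simp only [derivative_add, derivative_mul, derivative_C, zero_mul, zero_add,
    derivative_X_pow, ihl, Nat.add_sub_cancel, hcast] at hrec
  rw [lowered_succ]
  rcases l with _ | k
  · have hsq := congrArg C (rung_zero_sq n r s h)
    rw [C_pow] at hsq
    simp only [lowered_zero, mul_zero, add_zero, derivative_zero] at hrec
    rw [← hrec]
    linear_combination (-C (Real.sqrt 2) * X ^ (2 * s) * lad n s r 0) * hsq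
  · have ihk := ih k (by omega) r s h
    have hrec2 := lad_recurrence n s r k (by omega)
    have hsq := congrArg C (rung_succ_sq n r s k h)
    rw [C_add, C_pow, C_pow] at hsq
    simp only [lowered_succ, derivative_mul, derivative_C, zero_mul, zero_add, ihk] at hrec
    linear_combination (-1 : ℝ[X]) * hrec
      + (-C (Real.sqrt 2) * X ^ (2 * s) * lad n s r (k + 1)) * hsq
      + C (Real.sqrt 2) * X ^ (2 * s) * C (rung n s r k) * hrec2

/-! ### Functions dominated by the generalized Gaussian -/

theorem integrable_even_pow_mul_exp (n : ℕ) (hn : 1 ≤ n) (m : ℕ) {b : ℝ} (hb : 0 < b) :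
    Integrable (fun x : ℝ => x ^ (2 * m) * Real.exp (-b * x ^ (2 * n))) := by
  have hn0 : (0 : ℝ) < n := by exact_mod_cast hn
  have h := integrableOn_rpow_mul_exp_neg_mul_rpow (p := 2 * n) (s := 2 * m) (b := b)
    (by have : (0 : ℝ) ≤ m := Nat.cast_nonneg m
        linarith) (by positivity) hb
  have h2 : IntegrableOn (fun x : ℝ => x ^ (2 * m) * Real.exp (-b * x ^ (2 * n)))
      (Set.Ioi 0) := by
    refine h.congr_fun (fun x _ => ?_) measurableSet_Ioi
    simp only
    have e1 : x ^ ((2 : ℝ) * m) = x ^ (2 * m) := by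
      rw [← Real.rpow_natCast]; push_cast; rfl
    have e2 : x ^ ((2 : ℝ) * n) = x ^ (2 * n) := by
      rw [← Real.rpow_natCast]; push_cast; rfl
    rw [e1, e2]
  have even : ∀ x : ℝ, (-x) ^ (2 * m) * Real.exp (-b * (-x) ^ (2 * n)) =
      x ^ (2 * m) * Real.exp (-b * x ^ (2 * n)) := fun x => by
    rw [(even_two_mul m).neg_pow, (even_two_mul n).neg_pow]
  have h3 : IntegrableOn (fun x : ℝ => x ^ (2 * m) * Real.exp (-b * x ^ (2 * n)))
      (Set.Iic 0) := by
    rw [← Measure.map_neg_eq_self (volume : Measure ℝ)]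
    have me : MeasurableEmbedding fun x : ℝ => -x := (Homeomorph.neg ℝ).measurableEmbedding
    rw [me.integrableOn_map_iff]
    simp_rw [Function.comp_def, even, Set.neg_preimage, Set.neg_Iic, neg_zero]
    exact Iff.mpr integrableOn_Ici_iff_integrableOn_Ioi h2
  exact integrableOn_univ.1 (Set.Iic_union_Ioi (a := (0 : ℝ)) ▸ h3.union h2)

theorem abs_pow_le_one_add (x : ℝ) (m : ℕ) {k : ℕ} (hmk : m ≤ k) : |x| ^ m ≤ 1 + |x| ^ k := by
  rcases le_total |x| 1 with h | h
  · have := pow_le_one₀ (n := m) (abs_nonneg x) h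
    have h2 : 0 ≤ |x| ^ k := by positivity
    linarith
  · have := pow_le_pow_right₀ h hmk
    linarith

theorem integrable_abs_pow_mul_exp (n : ℕ) (hn : 1 ≤ n) (m : ℕ) {b : ℝ} (hb : 0 < b) :
    Integrable (fun x : ℝ => |x| ^ m * Real.exp (-b * x ^ (2 * n))) := by
  have h0 := integrable_even_pow_mul_exp n hn 0 hb
  have h1 := integrable_even_pow_mul_exp n hn m hb
  refine (h0.add h1).mono' (by fun_prop) (Eventually.of_forall fun x => ?_)
  rw [Real.norm_of_nonneg (by positivity)]
  simp only [Pi.add_apply, mul_zero, pow_zero]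
  rw [← add_mul]
  refine mul_le_mul_of_nonneg_right ?_ (Real.exp_nonneg _)
  have := abs_pow_le_one_add x m (k := 2 * m) (by omega)
  rwa [(even_two_mul m).pow_abs] at this

/-- The generalized Gaussian `exp (-x ^ (2 * n) / (2 * n))`. -/
def wexp (n : ℕ) (x : ℝ) : ℝ := Real.exp (-(x ^ (2 * n) / (2 * n)))

theorem continuous_wexp (n : ℕ) : Continuous (wexp n) := by unfold wexp; fun_prop

theorem wexp_pos (n : ℕ) (x : ℝ) : 0 < wexp n x := Real.exp_pos _

theorem hasDerivAt_wexp (n : ℕ) (hn : 1 ≤ n) (x : ℝ) :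
    HasDerivAt (wexp n) (-x ^ (2 * n - 1) * wexp n x) x := by
  have hn0 : (n : ℝ) ≠ 0 := by exact_mod_cast (show n ≠ 0 by omega)
  have h := (((hasDerivAt_pow (2 * n) x).div_const (2 * (n : ℝ))).neg).exp
  refine h.congr_deriv ?_
  have : Real.exp ((-fun x : ℝ => x ^ (2 * n) / (2 * (n : ℝ))) x) = wexp n x := rfl
  rw [this]
  push_cast
  field_simp

/-- Continuous functions bounded by a multiple of `exp (x ^ (2 * n) / (4 * n))`, the inverse square
root of the generalized Gaussian. Their product with `x ^ m * exp (-x ^ (2 * n) / (2 * n))` is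
square integrable for every `m`. -/
def Tame (n : ℕ) (p : ℝ → ℂ) : Prop :=
  Continuous p ∧ ∃ C : ℝ, ∀ x, ‖p x‖ ≤ C * Real.exp (x ^ (2 * n) / (4 * n))

theorem Tame.add {n : ℕ} {p q : ℝ → ℂ} (hp : Tame n p) (hq : Tame n q) :
    Tame n (fun x => p x + q x) := by
  obtain ⟨hp, C, hC⟩ := hp
  obtain ⟨hq, D, hD⟩ := hq
  refine ⟨hp.add hq, C + D, fun x => (norm_add_le _ _).trans ?_⟩
  rw [add_mul]; exact add_le_add (hC x) (hD x)

theorem Tame.const_mul {n : ℕ} {p : ℝ → ℂ} (hp : Tame n p) (c : ℂ) :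
    Tame n (fun x => c * p x) := by
  obtain ⟨hp, C, hC⟩ := hp
  refine ⟨continuous_const.mul hp, ‖c‖ * C, fun x => ?_⟩
  rw [norm_mul, mul_assoc]
  exact mul_le_mul_of_nonneg_left (hC x) (norm_nonneg _)

theorem tame_pow (n : ℕ) (hn : 1 ≤ n) (m : ℕ) : Tame n (fun x => (x : ℂ) ^ m) := by
  have hn0 : (0 : ℝ) < n := by exact_mod_cast hn
  refine ⟨by fun_prop, 1 + (4 * n : ℝ) ^ m * m.factorial, fun x => ?_⟩
  have hy : 0 ≤ x ^ (2 * n) / (4 * n) := by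
    have : 0 ≤ x ^ (2 * n) := (even_two_mul n).pow_nonneg x
    positivity
  have h1 := abs_pow_le_one_add x m (k := 2 * n * m) (by nlinarith)
  have h2 := Real.pow_div_factorial_le_exp _ hy m
  have h3 : |x| ^ (2 * n * m) = (4 * n : ℝ) ^ m * (x ^ (2 * n) / (4 * n)) ^ m := by
    rw [← mul_pow, mul_div_cancel₀ _ (by positivity), pow_mul, (even_two_mul n).pow_abs]
  rw [norm_pow, Complex.norm_real, Real.norm_eq_abs]
  have h4 : (x ^ (2 * n) / (4 * n)) ^ m ≤ m.factorial * Real.exp (x ^ (2 * n) / (4 * n)) := by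
    rwa [div_le_iff₀' (by positivity)] at h2
  have h5 : 1 ≤ Real.exp (x ^ (2 * n) / (4 * n)) := Real.one_le_exp hy
  rw [h3] at h1
  have h6 := mul_le_mul_of_nonneg_left h4 (by positivity : (0 : ℝ) ≤ (4 * n : ℝ) ^ m)
  calc |x| ^ m ≤ _ := h1
    _ ≤ Real.exp (x ^ (2 * n) / (4 * n)) +
        (4 * n : ℝ) ^ m * (m.factorial * Real.exp (x ^ (2 * n) / (4 * n))) := add_le_add h5 h6
    _ = _ := by ring

open Polynomial in
theorem tame_polynomial (n : ℕ) (hn : 1 ≤ n) (p : ℝ[X]) :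
    Tame n (fun x => ((p.eval x : ℝ) : ℂ)) := by
  induction p using Polynomial.induction_on' with
  | add p q hp hq => simpa using hp.add hq
  | monomial k a => simpa using (tame_pow n hn k).const_mul (a : ℂ)

theorem Tame.memLp {n : ℕ} (hn : 1 ≤ n) {p : ℝ → ℂ} (hp : Tame n p) (m : ℕ) :
    MemLp (fun x : ℝ => (x : ℂ) ^ m * p x * (wexp n x : ℂ)) 2 volume := by
  have hn0 : (0 : ℝ) < n := by exact_mod_cast hn
  obtain ⟨hp, C, hC⟩ := hp
  have hw := continuous_wexp n
  have hcont : Continuous (fun x : ℝ => (x : ℂ) ^ m * p x * (wexp n x : ℂ)) := by fun_prop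
  rw [memLp_two_iff_integrable_sq_norm hcont.aestronglyMeasurable]
  have h := (integrable_abs_pow_mul_exp n hn (2 * m) (b := (2 * n : ℝ)⁻¹) (by positivity)).const_mul
    (C ^ 2)
  refine h.mono' (by fun_prop) (Eventually.of_forall fun x => ?_)
  have hwx : ‖(wexp n x : ℂ)‖ = wexp n x := by
    rw [Complex.norm_real, Real.norm_of_nonneg (wexp_pos n x).le]
  rw [Real.norm_of_nonneg (by positivity), norm_mul, norm_mul, norm_pow, Complex.norm_real,
    Real.norm_eq_abs, hwx]
  have h1 : (‖p x‖ * wexp n x) ≤ C * Real.exp (-(2 * n : ℝ)⁻¹ * x ^ (2 * n) / 2) := by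
    calc _ ≤ C * Real.exp (x ^ (2 * n) / (4 * n)) * wexp n x :=
          mul_le_mul_of_nonneg_right (hC x) (wexp_pos n x).le
      _ = _ := by
          rw [wexp, mul_assoc, ← Real.exp_add]
          congr 2
          field_simp
          ring
  have h2 := pow_le_pow_left₀ (by have := wexp_pos n x; positivity) h1 2
  calc (|x| ^ m * ‖p x‖ * wexp n x) ^ 2 = |x| ^ (2 * m) * (‖p x‖ * wexp n x) ^ 2 := by ring
    _ ≤ |x| ^ (2 * m) * (C * Real.exp (-(2 * n : ℝ)⁻¹ * x ^ (2 * n) / 2)) ^ 2 :=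
        mul_le_mul_of_nonneg_left h2 (by positivity)
    _ = C ^ 2 * (|x| ^ (2 * m) * Real.exp (-(2 * n : ℝ)⁻¹ * x ^ (2 * n))) := by
        rw [mul_pow, ← Real.exp_nat_mul]
        push_cast
        rw [mul_div_cancel₀ _ (two_ne_zero)]
        ring

/-! ### Weak derivatives -/

/-- The triples `(f, u, X)` in `L²(ℝ)` with `X = x ^ n f` and `u = x ^ (-s) (x ^ (-r) f)'`, the
derivative being a weak derivative on `ℝ`: it is expressed by `x ^ (-r) f` being a primitive of
`x ^ s u`. -/
def primGraph (n r s : ℕ) : Submodule ℂ (L2 × L2 × L2) where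
  carrier := {p | (∀ᵐ x : ℝ, (x : ℂ) ^ n * p.1 x = p.2.2 x) ∧
    ∃ c : ℂ, ∀ᵐ x : ℝ, p.1 x = (x : ℂ) ^ r * (c + ∫ t in (0 : ℝ)..x, (t : ℂ) ^ s * p.2.1 t)}
  add_mem' := by
    rintro ⟨f, u, X⟩ ⟨f', u', X'⟩ ⟨h1, c, h2⟩ ⟨h1', c', h2'⟩
    refine ⟨?_, c + c', ?_⟩
    · filter_upwards [Lp.coeFn_add f f', Lp.coeFn_add X X', h1, h1'] with x e1 e2 h h'
      simp only [Prod.mk_add_mk, e1, e2, Pi.add_apply] at *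
      rw [← h, ← h']; ring
    · filter_upwards [Lp.coeFn_add f f', h2, h2'] with x hx hx2 hx2'
      simp only [Prod.mk_add_mk, hx, Pi.add_apply] at *
      rw [hx2, hx2']
      have : (∫ t in (0 : ℝ)..x, (t : ℂ) ^ s * (u + u' : L2) t) =
          (∫ t in (0 : ℝ)..x, (t : ℂ) ^ s * u t) + ∫ t in (0 : ℝ)..x, (t : ℂ) ^ s * u' t := by
        rw [← intervalIntegral.integral_add (intInt _ _ _ _) (intInt _ _ _ _)]
        refine intervalIntegral.integral_congr_ae ?_
        filter_upwards [Lp.coeFn_add u u'] with t ht _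
        rw [ht, Pi.add_apply]; ring
      rw [this]; ring
  zero_mem' := by
    have hz := Lp.coeFn_zero ℂ 2 (volume : Measure ℝ)
    refine ⟨?_, 0, ?_⟩
    · filter_upwards [hz] with x hx
      simp only [Prod.fst_zero, Prod.snd_zero, hx]; simp
    · filter_upwards [hz] with x hx
      have : (∫ t in (0 : ℝ)..x, (t : ℂ) ^ s * (0 : L2) t) = ∫ t in (0 : ℝ)..x, (0 : ℂ) := by
        refine intervalIntegral.integral_congr_ae ?_
        filter_upwards [hz] with t ht _
        rw [ht]; simp
      simp only [Prod.fst_zero, Prod.snd_zero, hx, this]; simp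
  smul_mem' := by
    rintro k ⟨f, u, X⟩ ⟨h1, c, h2⟩
    refine ⟨?_, k * c, ?_⟩
    · filter_upwards [Lp.coeFn_smul k f, Lp.coeFn_smul k X, h1] with x e1 e2 h
      simp only [Prod.smul_mk, e1, e2, Pi.smul_apply, smul_eq_mul] at *
      rw [← h]; ring
    · filter_upwards [Lp.coeFn_smul k f, h2] with x hx hx2
      simp only [Prod.smul_mk, hx, Pi.smul_apply, smul_eq_mul] at *
      rw [hx2]
      have : (∫ t in (0 : ℝ)..x, (t : ℂ) ^ s * (k • u : L2) t) =
          k * ∫ t in (0 : ℝ)..x, (t : ℂ) ^ s * u t := by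
        rw [← intervalIntegral.integral_const_mul]
        refine intervalIntegral.integral_congr_ae ?_
        filter_upwards [Lp.coeFn_smul k u] with t ht _
        rw [ht, Pi.smul_apply, smul_eq_mul]; ring
      rw [this]; ring

theorem memLp_indicator_pow (s : ℕ) (x : ℝ) :
    MemLp ((Set.uIoc 0 x).indicator fun t : ℝ => (t : ℂ) ^ s) 2 volume := by
  have hc : Continuous fun t : ℝ => (t : ℂ) ^ s := by fun_prop
  rw [memLp_indicator_iff_restrict measurableSet_uIoc, memLp_two_iff_integrable_sq_norm
    hc.aestronglyMeasurable]
  have h2 : Continuous fun t : ℝ => ‖(t : ℂ) ^ s‖ ^ 2 := by fun_prop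
  exact (h2.continuousOn.integrableOn_compact isCompact_uIcc).mono_set Set.uIoc_subset_uIcc

/-- The primitive of `t ^ s * u t` at a point is a continuous linear functional of `u`, namely an
inner product with a truncated monomial. -/
theorem primitive_eq_inner (s : ℕ) (x : ℝ) (u : L2) :
    ∫ t in (0 : ℝ)..x, (t : ℂ) ^ s * u t =
      (if 0 ≤ x then (1 : ℝ) else -1) • inner ℂ ((memLp_indicator_pow s x).toLp) u := by
  rw [intervalIntegral.intervalIntegral_eq_integral_uIoc, L2.inner_def,
    ← integral_indicator measurableSet_uIoc]
  congr 1
  refine integral_congr_ae ?_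
  filter_upwards [(memLp_indicator_pow s x).coeFn_toLp] with t ht
  rw [ht]
  by_cases h : t ∈ Set.uIoc 0 x
  · simp [h, mul_comm]
  · simp [h]

theorem tendsto_primitive {ι : Type*} {F : Filter ι} {u : ι → L2} {u₀ : L2}
    (h : Tendsto u F (𝓝 u₀)) (s : ℕ) (x : ℝ) :
    Tendsto (fun i => ∫ t in (0 : ℝ)..x, (t : ℂ) ^ s * u i t) F
      (𝓝 (∫ t in (0 : ℝ)..x, (t : ℂ) ^ s * u₀ t)) := by
  simp_rw [primitive_eq_inner]
  exact (tendsto_const_nhds.inner h).const_smul _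

theorem exists_subseq_ae_tendsto {f : ℕ → L2} {f₀ : L2} (h : Tendsto f atTop (𝓝 f₀)) :
    ∃ ns : ℕ → ℕ, StrictMono ns ∧
      ∀ᵐ x : ℝ, Tendsto (fun i => f (ns i) x) atTop (𝓝 (f₀ x)) :=
  (tendstoInMeasure_of_tendsto_Lp h).exists_seq_tendsto_ae

/-- The maximal operators are closed: pointwise almost everywhere along a subsequence, the
representation by a primitive passes to the limit. -/
theorem isClosed_primGraph (n r s : ℕ) : IsClosed (primGraph n r s : Set (L2 × L2 × L2)) := by
  refine IsSeqClosed.isClosed ?_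
  intro p p₀ hp hlim
  have hf : Tendsto (fun k => (p k).1) atTop (𝓝 p₀.1) := (continuous_fst.tendsto _).comp hlim
  have hu : Tendsto (fun k => (p k).2.1) atTop (𝓝 p₀.2.1) :=
    ((continuous_fst.comp continuous_snd).tendsto _).comp hlim
  have hX : Tendsto (fun k => (p k).2.2) atTop (𝓝 p₀.2.2) :=
    ((continuous_snd.comp continuous_snd).tendsto _).comp hlim
  obtain ⟨ns, hns, h1⟩ := exists_subseq_ae_tendsto hf
  obtain ⟨ms, hms, h2⟩ := exists_subseq_ae_tendsto (hX.comp hns.tendsto_atTop)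
  choose hmul c hc using hp
  have hmul' := ae_all_iff.2 hmul
  have hc' := ae_all_iff.2 hc
  refine ⟨?_, ?_⟩
  · filter_upwards [h1, h2, hmul'] with x e1 e2 e3
    refine tendsto_nhds_unique ((e1.comp hms.tendsto_atTop).const_mul ((x : ℂ) ^ n)) ?_
    refine e2.congr fun i => ?_
    simp [e3]
  · -- the constants of integration converge because the functions do so at one point `x₀ ≠ 0`
    obtain ⟨x₀, ⟨e1, e2⟩, e3⟩ := ((h1.and hc').and ae_ne_zero).exists
    have hx₀ : (x₀ : ℂ) ^ r ≠ 0 := pow_ne_zero _ (by exact_mod_cast e3)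
    have hcl : Tendsto (fun i => c (ns i)) atTop
        (𝓝 (p₀.1 x₀ / (x₀ : ℂ) ^ r - ∫ t in (0 : ℝ)..x₀, (t : ℂ) ^ s * p₀.2.1 t)) := by
      refine ((e1.div_const ((x₀ : ℂ) ^ r)).sub
        ((tendsto_primitive hu s x₀).comp hns.tendsto_atTop)).congr fun i => ?_
      simp only [Function.comp_def]
      rw [e2 (ns i), mul_div_cancel_left₀ _ hx₀]; ring
    refine ⟨p₀.1 x₀ / (x₀ : ℂ) ^ r - ∫ t in (0 : ℝ)..x₀, (t : ℂ) ^ s * p₀.2.1 t, ?_⟩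
    filter_upwards [h1, hc'] with x e4 e5
    refine tendsto_nhds_unique e4 ?_
    refine ((hcl.add ((tendsto_primitive hu s x).comp hns.tendsto_atTop)).const_mul
      ((x : ℂ) ^ r)).congr fun i => ?_
    rw [e5 (ns i)]; rfl

/-- Functions `x ^ r * p * exp (-x ^ (2 * n) / (2 * n))` with differentiable `p` lie in the maximal
domain, provided that `p'` is `√2 x ^ (2 * s)` times a function `q` of moderate growth. -/
theorem mem_primGraph_of_tame {n r s : ℕ} (h : r + s + 1 = n) {p q : ℝ → ℂ}
    (hq : Tame n q)
    (hpq : ∀ x : ℝ, HasDerivAt p ((Real.sqrt 2 : ℂ) * (x : ℂ) ^ (2 * s) * q x) x) {f u X : L2}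
    (hf : ∀ᵐ x : ℝ, f x = (x : ℂ) ^ r * p x * (wexp n x : ℂ))
    (hu : ∀ᵐ x : ℝ, u x = ((Real.sqrt 2 : ℂ) * (x : ℂ) ^ s * q x - (x : ℂ) ^ (n + r) * p x) *
      (wexp n x : ℂ))
    (hX : ∀ᵐ x : ℝ, X x = (x : ℂ) ^ (n + r) * p x * (wexp n x : ℂ)) :
    (f, u, X) ∈ primGraph n r s := by
  refine ⟨?_, p 0 * (wexp n 0 : ℂ), ?_⟩
  · filter_upwards [hf, hX] with x e1 e2
    simp only [e1, e2]; ring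
  filter_upwards [hf] with x e1
  simp only [e1]
  have hp : Continuous p := continuous_iff_continuousAt.2 fun x => (hpq x).continuousAt
  have hqc := hq.1
  have hw := continuous_wexp n
  have hpow : ∀ y : ℂ, y ^ s * y ^ (n + r) = y ^ (2 * n - 1) := fun y => by
    rw [← pow_add]; congr 1; omega
  have key : ∫ t in (0 : ℝ)..x, (t : ℂ) ^ s * u t =
      p x * (wexp n x : ℂ) - p 0 * (wexp n 0 : ℂ) := by
    have : ∫ t in (0 : ℝ)..x, (t : ℂ) ^ s * u t = ∫ t in (0 : ℝ)..x,
        ((Real.sqrt 2 : ℂ) * (t : ℂ) ^ (2 * s) * q t * (wexp n t : ℂ) +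
          p t * ((-t ^ (2 * n - 1) * wexp n t : ℝ) : ℂ)) := by
      refine intervalIntegral.integral_congr_ae ?_
      filter_upwards [hu] with t ht _
      rw [ht]; push_cast; rw [← hpow]; ring
    rw [this]
    have hcont : Continuous fun t : ℝ => (Real.sqrt 2 : ℂ) * (t : ℂ) ^ (2 * s) * q t *
        (wexp n t : ℂ) + p t * ((-t ^ (2 * n - 1) * wexp n t : ℝ) : ℂ) := by fun_prop
    exact intervalIntegral.integral_eq_sub_of_hasDerivAt
      (fun t _ => (hpq t).mul (hasDerivAt_wexp n (by omega) t).ofReal_comp)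
      (hcont.intervalIntegrable _ _)
  rw [key]; ring

/-! ### Integration by parts -/

/-- The fundamental theorem of calculus for the product of a smooth function and a primitive, which
is only absolutely continuous. -/
theorem integral_deriv_mul_primitive_real {φ φ' v : ℝ → ℝ} (hφ : ∀ x, HasDerivAt φ (φ' x) x)
    (hφ' : Continuous φ') (hv : LocallyIntegrable v volume) (c : ℝ) {R : ℝ} (hR : 0 ≤ R) :
    ∫ x in (-R)..R, (φ' x * (c + ∫ t in (0 : ℝ)..x, v t) + φ x * v x) =
      φ R * (c + ∫ t in (0 : ℝ)..R, v t) - φ (-R) * (c + ∫ t in (0 : ℝ)..(-R), v t) := by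
  have hd : deriv φ = φ' := funext fun x => (hφ x).deriv
  have h1 : AbsolutelyContinuousOnInterval φ (-R) R := by
    refine ContDiffOn.absolutelyContinuousOnInterval (ContDiff.contDiffOn ?_)
    rw [contDiff_one_iff_deriv, hd]
    exact ⟨fun x => (hφ x).differentiableAt, hφ'⟩
  have hint : IntervalIntegrable v volume (-R) R := intervalIntegrable_iff.mpr <|
    (hv.integrableOn_isCompact isCompact_uIcc).mono_set Set.uIoc_subset_uIcc
  have hc : AbsolutelyContinuousOnInterval (fun _ : ℝ => c) (-R) R :=
    ContDiffOn.absolutelyContinuousOnInterval contDiffOn_const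
  have h2 : AbsolutelyContinuousOnInterval (fun x => c + ∫ t in (0 : ℝ)..x, v t) (-R) R :=
    hc.add (hint.absolutelyContinuousOnInterval_intervalIntegral (c := 0) (by
      rw [Set.uIcc_of_le (by linarith)]; constructor <;> linarith))
  rw [← h1.integral_deriv_mul_eq_sub h2]
  refine intervalIntegral.integral_congr_ae ?_
  filter_upwards [_root_.LocallyIntegrable.ae_hasDerivAt_integral hv] with x hx _
  rw [(hφ x).deriv, ((hx 0).const_add c).deriv]

theorem integral_deriv_mul_primitive {φ φ' : ℝ → ℝ} {v : ℝ → ℂ}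
    (hφ : ∀ x, HasDerivAt φ (φ' x) x) (hφ' : Continuous φ')
    (hv : LocallyIntegrable v volume) (c : ℂ) {R : ℝ} (hR : 0 ≤ R) :
    ∫ x in (-R)..R, ((φ' x : ℂ) * (c + ∫ t in (0 : ℝ)..x, v t) + (φ x : ℂ) * v x) =
      (φ R : ℂ) * (c + ∫ t in (0 : ℝ)..R, v t) -
        (φ (-R) : ℂ) * (c + ∫ t in (0 : ℝ)..(-R), v t) := by
  have hint : ∀ a b : ℝ, IntervalIntegrable v volume a b := fun a b =>
    intervalIntegrable_iff.mpr <|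
      (hv.integrableOn_isCompact isCompact_uIcc).mono_set Set.uIoc_subset_uIcc
  have hφc : Continuous φ := continuous_iff_continuousAt.2 fun x => (hφ x).continuousAt
  have hF : Continuous fun x : ℝ => c + ∫ t in (0 : ℝ)..x, v t :=
    continuous_const.add (intervalIntegral.continuous_primitive hint 0)
  have hI : IntervalIntegrable (fun x : ℝ => (φ' x : ℂ) * (c + ∫ t in (0 : ℝ)..x, v t) +
      (φ x : ℂ) * v x) volume (-R) R := by
    refine IntervalIntegrable.add (Continuous.intervalIntegrable (by fun_prop) _ _) ?_
    exact (hint _ _).continuousOn_mul (by fun_prop)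
  -- real and imaginary part reduce the claim to the real case
  have key : ∀ L : ℂ →L[ℝ] ℝ,
      L (∫ x in (-R)..R, ((φ' x : ℂ) * (c + ∫ t in (0 : ℝ)..x, v t) + (φ x : ℂ) * v x)) =
      L ((φ R : ℂ) * (c + ∫ t in (0 : ℝ)..R, v t) -
        (φ (-R) : ℂ) * (c + ∫ t in (0 : ℝ)..(-R), v t)) := by
    intro L
    have hLm : ∀ (a : ℝ) (z : ℂ), L ((a : ℂ) * z) = a * L z := fun a z => by
      rw [← Complex.real_smul, map_smul, smul_eq_mul]
    have hLF : ∀ x : ℝ, L (c + ∫ t in (0 : ℝ)..x, v t) =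
        L c + ∫ t in (0 : ℝ)..x, L (v t) := fun x => by
      rw [map_add, L.intervalIntegral_comp_comm (hint _ _)]
    rw [← L.intervalIntegral_comp_comm hI, map_sub]
    simp only [map_add, hLm]
    simp only [← map_add, hLF]
    refine integral_deriv_mul_primitive_real hφ hφ' (v := fun t => L (v t)) ?_ (L c) hR
    exact fun x => by
      obtain ⟨s, hs, hvs⟩ := hv x
      exact ⟨s, hs, L.integrable_comp hvs⟩
  exact Complex.ext (key Complex.reCLM) (key Complex.imCLM)

theorem norm_toLp_indicator_pow_le (s : ℕ) (x : ℝ) :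
    ‖(memLp_indicator_pow s x).toLp‖ ≤ 1 + |x| ^ (2 * s + 1) := by
  have h : ‖(memLp_indicator_pow s x).toLp‖ ^ 2 ≤ |x| ^ (2 * s + 1) := by
    have h1 : ‖(memLp_indicator_pow s x).toLp‖ ^ 2 =
        RCLike.re (inner ℂ (memLp_indicator_pow s x).toLp (memLp_indicator_pow s x).toLp) :=
      (inner_self_eq_norm_sq (𝕜 := ℂ) _).symm
    rw [h1, L2.inner_def]
    have h2 : (∫ t : ℝ, inner ℂ ((MemLp.toLp _ (memLp_indicator_pow s x) : L2) t)
        ((MemLp.toLp _ (memLp_indicator_pow s x) : L2) t)) =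
        ∫ t in Set.uIoc 0 x, (((|t| ^ (2 * s) : ℝ)) : ℂ) := by
      rw [← integral_indicator measurableSet_uIoc]
      refine integral_congr_ae ?_
      filter_upwards [(memLp_indicator_pow s x).coeFn_toLp] with t ht
      rw [ht]
      by_cases h : t ∈ Set.uIoc 0 x
      · simp only [h, Set.indicator_of_mem, RCLike.inner_apply, map_pow, Complex.conj_ofReal]
        rw [(even_two_mul s).pow_abs]
        push_cast; ring
      · simp [h]
    rw [h2, integral_complex_ofReal]
    have h3 : ‖∫ t in Set.uIoc 0 x, |t| ^ (2 * s)‖ ≤ |x| ^ (2 * s) * |x| := by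
      have := norm_setIntegral_le_of_norm_le_const (μ := volume) (s := Set.uIoc 0 x)
        (f := fun t : ℝ => |t| ^ (2 * s)) (C := |x| ^ (2 * s)) (by simp [Real.volume_uIoc])
        (fun t ht => by
          rw [Real.norm_of_nonneg (by positivity)]
          refine pow_le_pow_left₀ (abs_nonneg _) ?_ _
          rcases Set.mem_uIoc.1 ht with ⟨a, b⟩ | ⟨a, b⟩
          · rw [abs_of_pos a, abs_of_pos (a.trans_le b)]; exact b
          · rw [abs_of_nonpos b, abs_of_neg (a.trans_le b)]; linarith)
      simpa [measureReal_def, Real.volume_uIoc] using this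
    calc RCLike.re ((∫ t in Set.uIoc 0 x, |t| ^ (2 * s) : ℝ) : ℂ)
        = ∫ t in Set.uIoc 0 x, |t| ^ (2 * s) := by simp
      _ ≤ _ := (Real.le_norm_self _).trans (by rw [pow_succ]; exact h3)
  have h0 := norm_nonneg (memLp_indicator_pow s x).toLp
  nlinarith [sq_nonneg (‖(memLp_indicator_pow s x).toLp‖ - 1)]

theorem tame_of_le {n : ℕ} (hn : 1 ≤ n) {F : ℝ → ℂ} (hF : Continuous F) {A B : ℝ} (hB : 0 ≤ B)
    {m : ℕ} (h : ∀ x, ‖F x‖ ≤ A + B * |x| ^ m) : Tame n F := by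
  obtain ⟨-, C, hC⟩ := (tame_pow n hn m).const_mul (B : ℂ)
  refine ⟨hF, |A| + C, fun x => (h x).trans ?_⟩
  have h1 : 1 ≤ Real.exp (x ^ (2 * n) / (4 * n)) := Real.one_le_exp (by
    have : 0 ≤ x ^ (2 * n) := (even_two_mul n).pow_nonneg x
    positivity)
  have h2 := hC x
  rw [norm_mul, norm_pow, Complex.norm_real, Complex.norm_real, Real.norm_of_nonneg hB,
    Real.norm_eq_abs] at h2
  have h3 : A ≤ |A| * Real.exp (x ^ (2 * n) / (4 * n)) :=
    (le_abs_self A).trans (le_mul_of_one_le_right (abs_nonneg _) h1)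
  rw [add_mul]; linarith

/-- By the Cauchy-Schwarz inequality, weak primitives of `L²` functions grow polynomially only. -/
theorem tame_primitive {n : ℕ} (hn : 1 ≤ n) (s : ℕ) (u : L2) (c : ℂ) :
    Tame n (fun x => c + ∫ t in (0 : ℝ)..x, (t : ℂ) ^ s * u t) := by
  refine tame_of_le hn (continuous_const.add
    (intervalIntegral.continuous_primitive (intInt u s) 0)) (A := ‖c‖ + ‖u‖) (B := ‖u‖)
    (norm_nonneg _) (m := 2 * s + 1) fun x => (norm_add_le _ _).trans ?_
  rw [add_assoc]
  gcongr
  rw [primitive_eq_inner, norm_smul]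
  have h1 : ‖(if 0 ≤ x then (1 : ℝ) else -1)‖ = 1 := by split_ifs <;> simp
  rw [h1, one_mul]
  refine (norm_inner_le_norm _ _).trans ?_
  have := mul_le_mul_of_nonneg_right (norm_toLp_indicator_pow_le s x) (norm_nonneg u)
  linarith

theorem Tame.integrable_pow {n : ℕ} (hn : 1 ≤ n) {p : ℝ → ℂ} (hp : Tame n p) (m : ℕ) :
    Integrable (fun x : ℝ => (x : ℂ) ^ m * p x * (wexp n x : ℂ)) := by
  have hn0 : (0 : ℝ) < n := by exact_mod_cast hn
  obtain ⟨hp, C, hC⟩ := hp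
  have hw := continuous_wexp n
  refine ((integrable_abs_pow_mul_exp n hn m (b := (4 * n : ℝ)⁻¹) (by positivity)).const_mul
    C).mono' (Continuous.aestronglyMeasurable (by fun_prop)) (Eventually.of_forall fun x => ?_)
  have hwx : ‖(wexp n x : ℂ)‖ = wexp n x := by
    rw [Complex.norm_real, Real.norm_of_nonneg (wexp_pos n x).le]
  rw [norm_mul, norm_mul, norm_pow, Complex.norm_real, Real.norm_eq_abs, hwx]
  calc |x| ^ m * ‖p x‖ * wexp n x
      ≤ |x| ^ m * (C * Real.exp (x ^ (2 * n) / (4 * n))) * wexp n x := by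
        have := wexp_pos n x
        gcongr
        exact hC x
    _ = C * (|x| ^ m * (Real.exp (x ^ (2 * n) / (4 * n)) * wexp n x)) := by ring
    _ = _ := by
        rw [wexp, ← Real.exp_add]
        congr 3
        field_simp
        ring

open Polynomial in
theorem Tame.integrable_polynomial {n : ℕ} (hn : 1 ≤ n) {p : ℝ → ℂ} (hp : Tame n p) (q : ℝ[X]) :
    Integrable (fun x : ℝ => ((q.eval x : ℝ) : ℂ) * p x * (wexp n x : ℂ)) := by
  induction q using Polynomial.induction_on' with
  | add a b ha hb =>
    refine (ha.add hb).congr (Eventually.of_forall fun x => ?_)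
    simp only [Pi.add_apply, eval_add]; push_cast; ring
  | monomial k a =>
    refine ((hp.integrable_pow hn k).const_mul (a : ℂ)).congr (Eventually.of_forall fun x => ?_)
    simp only [eval_monomial]; push_cast; ring

open Polynomial in
theorem hasDerivAt_polynomial_mul_wexp (n : ℕ) (hn : 1 ≤ n) (q : ℝ[X]) (x : ℝ) :
    HasDerivAt (fun x => q.eval x * wexp n x)
      ((derivative q - X ^ (2 * n - 1) * q).eval x * wexp n x) x := by
  refine ((q.hasDerivAt x).mul (hasDerivAt_wexp n hn x)).congr_deriv ?_
  simp only [eval_sub, eval_mul, eval_pow, eval_X]; ring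

open Polynomial in
/-- Integration by parts of a primitive against a polynomial times the generalized Gaussian. The
boundary terms vanish because the product is integrable and has limits at infinity. -/
theorem integral_by_parts_primitive {n : ℕ} (hn : 1 ≤ n) (q : ℝ[X]) (s : ℕ) (u : L2) (c : ℂ) :
    ∫ x : ℝ, (((derivative q - X ^ (2 * n - 1) * q).eval x * wexp n x : ℝ) : ℂ) *
        (c + ∫ t in (0 : ℝ)..x, (t : ℂ) ^ s * u t) +
      ((q.eval x * wexp n x : ℝ) : ℂ) * ((x : ℂ) ^ s * u x) = 0 := by
  set F : ℝ → ℂ := fun x => c + ∫ t in (0 : ℝ)..x, (t : ℂ) ^ s * u t with hFdef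
  have hF : Tame n F := tame_primitive hn s u c
  set q₂ := derivative q - X ^ (2 * n - 1) * q
  have hFc := hF.1
  have hw := continuous_wexp n
  have h1 : Integrable (fun x : ℝ => ((q₂.eval x * wexp n x : ℝ) : ℂ) * F x) := by
    refine (hF.integrable_polynomial hn q₂).congr (Eventually.of_forall fun x => ?_)
    push_cast; ring
  have h2 : Integrable (fun x : ℝ => ((q.eval x * wexp n x : ℝ) : ℂ) * ((x : ℂ) ^ s * u x)) := by
    have hm := (tame_polynomial n hn q).memLp hn s
    have := hm.integrable_mul (Lp.memLp u) (p := 2) (q := 2)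
    refine this.congr (Eventually.of_forall fun x => ?_)
    simp only [Pi.mul_apply]; push_cast; ring
  have h3 : Integrable (fun x : ℝ => ((q.eval x * wexp n x : ℝ) : ℂ) * F x) := by
    refine (hF.integrable_polynomial hn q).congr (Eventually.of_forall fun x => ?_)
    push_cast; ring
  have h4 := intervalIntegral_tendsto_integral (h1.add h2) tendsto_neg_atTop_atBot tendsto_id
  have h5 := h4.congr' (f₂ := fun R : ℝ => ((q.eval R * wexp n R : ℝ) : ℂ) * F R -
      ((q.eval (-R) * wexp n (-R) : ℝ) : ℂ) * F (-R)) (by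
    filter_upwards [eventually_ge_atTop (0 : ℝ)] with R hR
    exact integral_deriv_mul_primitive (hasDerivAt_polynomial_mul_wexp n hn q)
      ((q₂.continuous).mul hw) (locInt u s) c hR)
  have h6 : Integrable (fun R : ℝ => ((q.eval R * wexp n R : ℝ) : ℂ) * F R -
      ((q.eval (-R) * wexp n (-R) : ℝ) : ℂ) * F (-R)) := h3.sub h3.comp_neg
  refine (h6.integrableAtFilter atTop).eq_zero_of_tendsto (fun S hS => ?_) h5
  obtain ⟨b, hb⟩ := mem_atTop_sets.1 hS
  rw [← top_le_iff, ← Real.volume_Ici (a := b)]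
  exact measure_mono hb

/-! ### The levels and their orthonormality -/

/-- The `l`-th level of the `(r, s)` sector, as a function. -/
def levelFun (n r s l : ℕ) (x : ℝ) : ℝ := x ^ r * (lad n r s l).eval x * wexp n x

/-- The `l`-th level of the `(r, s)` sector. -/
def level (n r s l : ℕ) : L2 := toL2 (levelFun n r s l)

/-- The image of the `l`-th level of the `(r, s)` sector under the lowering operator. -/
def lowerLevel (n r s : ℕ) : ℕ → L2
  | 0 => 0
  | l + 1 => (rung n r s l : ℂ) • level n s r l

theorem coeFn_level {n : ℕ} (hn : 1 ≤ n) (r s l : ℕ) :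
    ∀ᵐ x : ℝ, level n r s l x = (x : ℂ) ^ r * ((lad n r s l).eval x : ℝ) * (wexp n x : ℂ) := by
  have h := (tame_polynomial n hn (lad n r s l)).memLp hn r
  have h' : MemLp (fun x : ℝ => (levelFun n r s l x : ℂ)) 2 volume := by
    refine h.congr_norm ?_ ?_
    · have := continuous_wexp n
      unfold levelFun
      exact Continuous.aestronglyMeasurable (by fun_prop)
    · exact Eventually.of_forall fun x => by simp [levelFun]
  rw [level, toL2, dif_pos h']
  filter_upwards [h'.coeFn_toLp] with x hx
  rw [hx, levelFun]; push_cast; ring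

theorem coeFn_lowerLevel {n : ℕ} (hn : 1 ≤ n) (r s l : ℕ) :
    ∀ᵐ x : ℝ, lowerLevel n r s l x =
      (x : ℂ) ^ s * ((lowered n r s l).eval x : ℝ) * (wexp n x : ℂ) := by
  cases l with
  | zero =>
    filter_upwards [Lp.coeFn_zero ℂ 2 (volume : Measure ℝ)] with x hx
    simp only [lowerLevel, hx]
    simp [lowered]
  | succ l =>
    filter_upwards [Lp.coeFn_smul (rung n r s l : ℂ) (level n s r l), coeFn_level hn s r l]
      with x hx hx2
    simp only [lowerLevel, hx, Pi.smul_apply, hx2, lowered, Polynomial.eval_mul,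
      Polynomial.eval_C, smul_eq_mul]
    push_cast; ring

/-- The value of the raising operator on the `l`-th level of the `(r, s)` sector. -/
def raiseLevel (n r s l : ℕ) : L2 := (rung n s r l : ℂ) • level n s r (l + 1)

theorem coeFn_raiseLevel {n r s : ℕ} (h : r + s + 1 = n) (l : ℕ) :
    ∀ᵐ x : ℝ, raiseLevel n r s l x = (Real.sqrt 2 : ℂ) * (x : ℂ) ^ (n + r) *
      ((lad n r s l).eval x : ℝ) * (wexp n x : ℂ) -
      (x : ℂ) ^ s * ((lowered n r s l).eval x : ℝ) * (wexp n x : ℂ) := by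
  have hrec := lad_recurrence n s r l (by omega)
  filter_upwards [Lp.coeFn_smul (rung n s r l : ℂ) (level n s r (l + 1)),
    coeFn_level (show 1 ≤ n by omega) s r (l + 1)] with x hx hx2
  have h1 := congrArg (fun p => (x : ℂ) ^ s * ((p.eval x : ℝ) : ℂ)) hrec
  simp only [Polynomial.eval_mul, Polynomial.eval_add, Polynomial.eval_C, Polynomial.eval_pow,
    Polynomial.eval_X] at h1
  push_cast at h1
  simp only [raiseLevel, hx, Pi.smul_apply, hx2, smul_eq_mul]
  have h2 : (x : ℂ) ^ (n + r) = (x : ℂ) ^ s * (x : ℂ) ^ (2 * r + 1) := by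
    rw [← pow_add]; congr 1; omega
  rw [h2]
  linear_combination (-(wexp n x : ℂ)) * h1

/-- The triples `(f, g, h)` in `L²(ℝ)` for which `g` and `h` are the images of `f` under the
lowering operator `(x ^ (-s) (d/dx) x ^ (-r) + x ^ n) / √2` and the raising operator
`(-x ^ (-s) (d/dx) x ^ (-r) + x ^ n) / √2`. -/
def ladderGraph (n r s : ℕ) : Submodule ℂ (L2 × L2 × L2) :=
  (primGraph n r s).comap
    ((ContinuousLinearMap.fst ℂ L2 (L2 × L2)).prod
      (((Real.sqrt 2 : ℂ)⁻¹ • (ContinuousLinearMap.fst ℂ L2 L2 - ContinuousLinearMap.snd ℂ L2 L2) ∘L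
          ContinuousLinearMap.snd ℂ L2 (L2 × L2)).prod
        ((Real.sqrt 2 : ℂ)⁻¹ • (ContinuousLinearMap.fst ℂ L2 L2 + ContinuousLinearMap.snd ℂ L2 L2) ∘L
          ContinuousLinearMap.snd ℂ L2 (L2 × L2)))).toLinearMap

theorem mem_ladderGraph {n r s : ℕ} {f g h : L2} : (f, g, h) ∈ ladderGraph n r s ↔
    (f, (Real.sqrt 2 : ℂ)⁻¹ • (g - h), (Real.sqrt 2 : ℂ)⁻¹ • (g + h)) ∈ primGraph n r s :=
  Iff.rfl

theorem isClosed_ladderGraph (n r s : ℕ) : IsClosed (ladderGraph n r s : Set (L2 × L2 × L2)) :=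
  (isClosed_primGraph n r s).preimage (ContinuousLinearMap.continuous _)

theorem sqrt_two_ne_zero : (Real.sqrt 2 : ℂ) ≠ 0 := by
  exact_mod_cast (Real.sqrt_pos.2 two_pos).ne'

theorem sqrt_two_sq : (Real.sqrt 2 : ℂ) ^ 2 = 2 := by
  exact_mod_cast Real.sq_sqrt two_pos.le

/-- The action of the lowering and raising operators on `x ^ r * p * exp (-x ^ (2 * n) / (2 * n))`:
lowering replaces `x ^ r * p` by `x ^ s * q`, and the sum of both operators is `√2 x ^ n`. It
applies to the levels, where `p` is a polynomial, and to the kernels. -/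
theorem mem_ladderGraph_of_tame {n r s : ℕ} (hn : r + s + 1 = n) {p q : ℝ → ℂ}
    (hq : Tame n q)
    (hpq : ∀ x : ℝ, HasDerivAt p ((Real.sqrt 2 : ℂ) * (x : ℂ) ^ (2 * s) * q x) x) {f g h : L2}
    (hf : ∀ᵐ x : ℝ, f x = (x : ℂ) ^ r * p x * (wexp n x : ℂ))
    (hg : ∀ᵐ x : ℝ, g x = (x : ℂ) ^ s * q x * (wexp n x : ℂ))
    (hh : ∀ᵐ x : ℝ, h x = (Real.sqrt 2 : ℂ) * (x : ℂ) ^ (n + r) * p x * (wexp n x : ℂ) -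
      (x : ℂ) ^ s * q x * (wexp n x : ℂ)) :
    (f, g, h) ∈ ladderGraph n r s := by
  have h2 := sqrt_two_ne_zero
  have h3 := sqrt_two_sq
  refine mem_ladderGraph.2 (mem_primGraph_of_tame hn hq hpq hf ?_ ?_)
  · filter_upwards [hg, hh, Lp.coeFn_smul (Real.sqrt 2 : ℂ)⁻¹ (g - h), Lp.coeFn_sub g h]
      with x e1 e2 e3 e4
    rw [e3, Pi.smul_apply, e4, Pi.sub_apply, e1, e2, smul_eq_mul]
    field_simp
    linear_combination (-(x : ℂ) ^ s * q x * (wexp n x : ℂ)) * h3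
  · filter_upwards [hg, hh, Lp.coeFn_smul (Real.sqrt 2 : ℂ)⁻¹ (g + h), Lp.coeFn_add g h]
      with x e1 e2 e3 e4
    rw [e3, Pi.smul_apply, e4, Pi.add_apply, e1, e2, smul_eq_mul]
    field_simp
    ring

theorem level_mem_ladderGraph {n r s : ℕ} (hn : r + s + 1 = n) (l : ℕ) :
    (level n r s l, lowerLevel n r s l, raiseLevel n r s l) ∈ ladderGraph n r s := by
  have hn1 : 1 ≤ n := by omega
  refine mem_ladderGraph_of_tame hn (tame_polynomial n hn1 (lowered n r s l)) (fun x => ?_)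
    (coeFn_level hn1 r s l) (coeFn_lowerLevel hn1 r s l) (coeFn_raiseLevel hn l)
  have := ((lad n r s l).hasDerivAt x).ofReal_comp
  refine this.congr_deriv ?_
  rw [derivative_lad n r s l hn]
  simp

theorem inner_level {n : ℕ} (hn : 1 ≤ n) (r s l : ℕ) (g : L2) :
    inner ℂ (level n r s l) g =
      ∫ x : ℝ, (x : ℂ) ^ r * ((lad n r s l).eval x : ℝ) * (wexp n x : ℂ) * g x := by
  rw [L2.inner_def]
  refine integral_congr_ae ?_
  filter_upwards [coeFn_level hn r s l] with x hx
  rw [hx, RCLike.inner_apply]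
  simp only [map_mul, map_pow, Complex.conj_ofReal]
  ring

theorem integrable_level_mul {n : ℕ} (hn : 1 ≤ n) (r s l : ℕ) (g : L2) :
    Integrable fun x : ℝ => (x : ℂ) ^ r * ((lad n r s l).eval x : ℝ) * (wexp n x : ℂ) * g x := by
  refine (L2.integrable_inner (𝕜 := ℂ) (level n r s l) g).congr ?_
  filter_upwards [coeFn_level hn r s l] with x hx
  rw [hx, RCLike.inner_apply]
  simp only [map_mul, map_pow, Complex.conj_ofReal]
  ring

/-- The levels lie in the domain of the adjoint of the lowering operator, which acts on them by
raising. -/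
theorem inner_level_of_mem_primGraph {n r s : ℕ} (hn : r + s + 1 = n) {f u X : L2}
    (hf : (f, u, X) ∈ primGraph n r s) (l : ℕ) :
    inner ℂ (level n s r l) (u + X) =
      (Real.sqrt 2 : ℂ) * rung n r s l * inner ℂ (level n r s (l + 1)) f := by
  have hn1 : 1 ≤ n := by omega
  obtain ⟨hX, c, hc⟩ := hf
  simp only at hX hc
  have hz := integral_by_parts_primitive hn1 (lad n s r l) s u c
  have i1 := integrable_level_mul hn1 s r l (u + X)
  have i2 := (integrable_level_mul hn1 r s (l + 1) f).const_mul
    ((Real.sqrt 2 : ℂ) * rung n r s l)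
  rw [inner_level hn1, inner_level hn1, ← integral_const_mul, ← sub_eq_zero,
    ← integral_sub i1 i2, ← hz]
  refine integral_congr_ae ?_
  filter_upwards [hX, hc, Lp.coeFn_add u X] with x e1 e2 e3
  rw [e3, Pi.add_apply, ← e1, e2]
  set F := c + ∫ t in (0 : ℝ)..x, (t : ℂ) ^ s * u t
  have hrec := lad_recurrence n r s l hn
  have h1 := congrArg (fun p => ((p.eval x : ℝ) : ℂ)) hrec
  have h2 := congrArg (fun p => ((p.eval x : ℝ) : ℂ)) (derivative_lad n s r l (by omega))
  simp only [Polynomial.eval_mul, Polynomial.eval_add, Polynomial.eval_C, Polynomial.eval_pow,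
    Polynomial.eval_X] at h1 h2
  push_cast at h1 h2
  simp only [Polynomial.eval_sub, Polynomial.eval_mul, Polynomial.eval_pow, Polynomial.eval_X]
  push_cast
  rw [h2]
  have e4 : (x : ℂ) ^ (2 * n - 1) = (x : ℂ) ^ (2 * r) * (x : ℂ) ^ (2 * s + 1) := by
    rw [← pow_add]; congr 1; omega
  have e5 : (x : ℂ) ^ n = (x : ℂ) ^ r * (x : ℂ) ^ (s + 1) := by
    rw [← pow_add]; congr 1; omega
  rw [e4, e5]
  have h3 := sqrt_two_sq
  linear_combination ((Real.sqrt 2 : ℂ) * (x : ℂ) ^ (2 * r) * (wexp n x : ℂ) * F) * h1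
    - ((x : ℂ) ^ (2 * r) * (x : ℂ) ^ (2 * s + 1) * ((lad n s r l).eval x : ℝ) * (wexp n x : ℂ) * F)
      * h3

theorem inner_level_of_mem_ladderGraph {n r s : ℕ} (hn : r + s + 1 = n) {f g h : L2}
    (hf : (f, g, h) ∈ ladderGraph n r s) (l : ℕ) :
    inner ℂ (level n s r l) g = (rung n r s l : ℂ) * inner ℂ (level n r s (l + 1)) f := by
  have h2 := sqrt_two_ne_zero
  have h1 := inner_level_of_mem_primGraph hn (mem_ladderGraph.1 hf) l
  have h3 : (Real.sqrt 2 : ℂ)⁻¹ • (g - h) + (Real.sqrt 2 : ℂ)⁻¹ • (g + h) =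
      (Real.sqrt 2 : ℂ) • g := by
    rw [← smul_add, sub_add_add_cancel, ← two_smul ℂ g, smul_smul]
    congr 1
    rw [← sqrt_two_sq]; field_simp
  rw [h3, inner_smul_right, mul_assoc] at h1
  exact mul_left_cancel₀ h2 h1

theorem integral_even_moment (n : ℕ) (hn : 1 ≤ n) (m : ℕ) :
    ∫ x : ℝ, x ^ (2 * m) * wexp n x ^ 2 =
      (n : ℝ) ^ (((2 * m + 1) / (2 * n) : ℝ) - 1) * Real.Gamma ((2 * m + 1) / (2 * n)) := by
  have hn0 : (0 : ℝ) < n := by exact_mod_cast hn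
  have hm0 : (0 : ℝ) ≤ m := Nat.cast_nonneg m
  have h := integral_comp_abs (f := fun y : ℝ => y ^ (2 * m : ℝ) *
    Real.exp (-(n : ℝ)⁻¹ * y ^ (2 * n : ℝ)))
  rw [integral_rpow_mul_exp_neg_mul_rpow (by positivity) (by linarith) (by positivity)] at h
  have h1 : ∀ x : ℝ, x ^ (2 * m) * wexp n x ^ 2 = |x| ^ (2 * m : ℝ) *
      Real.exp (-(n : ℝ)⁻¹ * |x| ^ (2 * n : ℝ)) := fun x => by
    have e1 : |x| ^ ((2 : ℝ) * m) = x ^ (2 * m) := by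
      rw [← (even_two_mul m).pow_abs, ← Real.rpow_natCast]; push_cast; rfl
    have e2 : |x| ^ ((2 : ℝ) * n) = x ^ (2 * n) := by
      rw [← (even_two_mul n).pow_abs, ← Real.rpow_natCast]; push_cast; rfl
    rw [e1, e2, wexp, ← Real.exp_nat_mul]
    congr 2
    push_cast; field_simp
  simp_rw [h1, h]
  rw [Real.inv_rpow hn0.le, ← Real.rpow_neg hn0.le, Real.rpow_sub_one hn0.ne', neg_div, neg_neg]
  field_simp

theorem gamma_arg_pos {n r : ℕ} (hn : 1 ≤ n) : (0 : ℝ) < (2 * r + 1) / (2 * n) := by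
  have hn0 : (0 : ℝ) < n := by exact_mod_cast hn
  positivity

theorem groundNorm_pos {n : ℕ} (hn : 1 ≤ n) (r : ℕ) : 0 < groundNorm n r := by
  have hn0 : (0 : ℝ) < n := by exact_mod_cast hn
  have := Real.Gamma_pos_of_pos (gamma_arg_pos (r := r) hn)
  unfold groundNorm; positivity

theorem groundNorm_sq_mul_moment {n : ℕ} (hn : 1 ≤ n) (r : ℕ) :
    groundNorm n r ^ 2 * ((n : ℝ) ^ (((2 * r + 1) / (2 * n) : ℝ) - 1) *
      Real.Gamma ((2 * r + 1) / (2 * n))) = 1 := by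
  have hn0 : (0 : ℝ) < n := by exact_mod_cast hn
  have hG := Real.Gamma_pos_of_pos (gamma_arg_pos (r := r) hn)
  rw [groundNorm, div_pow, Real.sq_sqrt hG.le, ← Real.rpow_natCast, ← Real.rpow_mul hn0.le]
  have : ∀ a b c : ℝ, c ≠ 0 → a / c * (b * c) = a * b := fun a b c hc => by field_simp
  rw [this _ _ _ hG.ne', ← Real.rpow_add hn0]
  rw [show ((1 / 2 - (2 * r + 1) / (4 * n) : ℝ) * (2 : ℕ) + ((2 * r + 1) / (2 * n) - 1)) = 0 by
    push_cast; field_simp; ring, Real.rpow_zero]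

theorem inner_level_zero_self {n : ℕ} (hn : 1 ≤ n) (r s : ℕ) :
    inner ℂ (level n r s 0) (level n r s 0) = (1 : ℂ) := by
  rw [inner_level hn]
  have h : ∫ x : ℝ, (x : ℂ) ^ r * ((lad n r s 0).eval x : ℝ) * (wexp n x : ℂ) * level n r s 0 x =
      ∫ x : ℝ, ((groundNorm n r ^ 2 * (x ^ (2 * r) * wexp n x ^ 2) : ℝ) : ℂ) := by
    refine integral_congr_ae ?_
    filter_upwards [coeFn_level hn r s 0] with x hx
    rw [hx]
    simp only [lad, Polynomial.eval_C]
    push_cast; ring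
  rw [h, integral_complex_ofReal, integral_const_mul, integral_even_moment n hn,
    groundNorm_sq_mul_moment hn]
  norm_num

/-- Both indices are decreased at once, since lowering on the right-hand side of the inner product
is raising on the left-hand side. In the remaining case one of the two vectors is a ground state,
which is annihilated by lowering. -/
theorem inner_level_level {n : ℕ} : ∀ (m l r s : ℕ), r + s + 1 = n →
    inner ℂ (level n r s m) (level n r s l) = if m = l then (1 : ℂ) else 0 := by
  have hzero : ∀ l r s : ℕ, r + s + 1 = n →
      inner ℂ (level n r s (l + 1)) (level n r s 0) = (0 : ℂ) := by
    intro l r s hn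
    have h := inner_level_of_mem_ladderGraph hn (level_mem_ladderGraph hn 0) l
    rw [lowerLevel, inner_zero_right] at h
    have h2 : (rung n r s l : ℂ) ≠ 0 := by exact_mod_cast (rung_pos n r s l hn).ne'
    exact (mul_eq_zero.1 h.symm).resolve_left h2
  intro m
  induction m with
  | zero =>
    intro l r s hn
    rcases l with _ | l
    · simpa using inner_level_zero_self (by omega) r s
    · rw [← inner_conj_symm, hzero l r s hn]; simp
  | succ m ih =>
    intro l r s hn
    rcases l with _ | l
    · rw [hzero m r s hn]; simp
    · have h := inner_level_of_mem_ladderGraph hn (level_mem_ladderGraph hn (l + 1)) m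
      rw [lowerLevel, inner_smul_right, ih l s r (by omega)] at h
      have h2 : (rung n r s m : ℂ) ≠ 0 := by exact_mod_cast (rung_pos n r s m hn).ne'
      apply mul_left_cancel₀ h2
      rw [← h]
      by_cases hml : m = l
      · simp [hml]
      · simp [hml]

theorem orthonormal_level {n r s : ℕ} (hn : r + s + 1 = n) : Orthonormal ℂ (level n r s) :=
  orthonormal_iff_ite.2 fun m l => inner_level_level m l r s hn

/-! ### Completeness of the levels -/

open ProbabilityTheory in
/-- Two finite measures with exponential moments near `0` are determined by their moments. -/
theorem map_eq_of_moments {Ω : Type*} [MeasurableSpace Ω] {μ ν : Measure Ω} [IsFiniteMeasure μ]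
    [IsFiniteMeasure ν] {X : Ω → ℝ} (hX : Measurable X) {ε : ℝ} (hε : 0 < ε)
    (hμ : ∀ t, t < ε → Integrable (fun ω => Real.exp (t * X ω)) μ)
    (hν : ∀ t, t < ε → Integrable (fun ω => Real.exp (t * X ω)) ν)
    (hmom : ∀ k : ℕ, ∫ ω, X ω ^ k ∂μ = ∫ ω, X ω ^ k ∂ν) : μ.map X = ν.map X := by
  have sub : ∀ {m : Measure Ω}, (∀ t, t < ε → Integrable (fun ω => Real.exp (t * X ω)) m) →
      ∀ z ∈ {z : ℂ | z.re < ε}, z.re ∈ interior (integrableExpSet X m) := by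
    intro m hm z hz
    exact mem_interior.2 ⟨Set.Iio ε, fun t ht => hm t ht, isOpen_Iio, hz⟩
  have hopen : IsOpen {z : ℂ | z.re < ε} := isOpen_Iio.preimage Complex.continuous_re
  have an : ∀ {m : Measure Ω}, (∀ t, t < ε → Integrable (fun ω => Real.exp (t * X ω)) m) →
      AnalyticOnNhd ℂ (complexMGF X m) {z : ℂ | z.re < ε} := fun hm z hz =>
    analyticAt_complexMGF (sub hm z hz)
  have hball : Metric.ball (0 : ℂ) ε ⊆ {z : ℂ | z.re < ε} := by
    intro z hz
    rw [mem_ball_zero_iff] at hz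
    exact (Complex.re_le_norm z).trans_lt hz
  have h0 : (0 : ℂ) ∈ {z : ℂ | z.re < ε} := by simpa using hε
  have hder : ∀ {m : Measure Ω}, (∀ t, t < ε → Integrable (fun ω => Real.exp (t * X ω)) m) →
      ∀ k, iteratedDeriv k (complexMGF X m) 0 = ((∫ ω, X ω ^ k ∂m : ℝ) : ℂ) := by
    intro m hm k
    rw [iteratedDeriv_complexMGF (sub hm 0 h0), ← integral_complex_ofReal]
    simp
  have hloc : complexMGF X μ =ᶠ[𝓝 0] complexMGF X ν := by
    filter_upwards [Metric.ball_mem_nhds (0 : ℂ) hε] with z hz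
    rw [← Complex.taylorSeries_eq_on_ball' hz ((an hμ).differentiableOn.mono hball),
      ← Complex.taylorSeries_eq_on_ball' hz ((an hν).differentiableOn.mono hball)]
    simp_rw [hder hμ, hder hν, hmom]
  have hconn : IsPreconnected {z : ℂ | z.re < ε} :=
    (convex_halfSpace_re_lt ε).isPreconnected
  have heq := (an hμ).eqOn_of_preconnected_of_eventuallyEq (an hν) hconn h0 hloc
  refine Measure.ext_of_charFun (funext fun t => ?_)
  rw [← complexMGF_mul_I hX.aemeasurable, ← complexMGF_mul_I hX.aemeasurable]
  exact heq (by simpa using hε)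

/-- The densities `φ⁺` and `φ⁻` have the same moments in the variable `x ^ (2 * n)`, so that their
images under `x ↦ x ^ (2 * n)` coincide. As `φ` is even, the two densities live on disjoint
preimages under this map, which forces `φ⁺ = 0`. -/
theorem ae_nonpos_of_moments {n : ℕ} (hn : 1 ≤ n) {φ : ℝ → ℝ} (hφ : Measurable φ)
    (heven : ∀ x, φ (-x) = φ x) {ε : ℝ} (hε : 0 < ε)
    (hint : Integrable fun x => φ x * Real.exp (ε * x ^ (2 * n)))
    (hmom : ∀ k : ℕ, ∫ x, φ x * x ^ (2 * n * k) = 0) : ∀ᵐ x, φ x ≤ 0 := by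
  set X : ℝ → ℝ := fun x => x ^ (2 * n) with hXdef
  have hX0 : ∀ x, 0 ≤ X x := fun x => (even_two_mul n).pow_nonneg x
  have hX : Measurable X := by fun_prop
  have hp : Measurable fun x => (φ x).toNNReal := hφ.real_toNNReal
  have hm : Measurable fun x => (-φ x).toNNReal := hφ.neg.real_toNNReal
  have hexp : ∀ t, t < ε → Integrable fun x => |φ x| * Real.exp (t * X x) := by
    intro t ht
    refine hint.abs.mono' (by fun_prop) (Eventually.of_forall fun x => ?_)
    rw [norm_mul, norm_abs_eq_norm, Real.norm_eq_abs, Real.norm_of_nonneg (Real.exp_nonneg _),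
      abs_mul, abs_of_pos (Real.exp_pos _)]
    gcongr
    exact hX0 x
  have habs : ∀ a : ℝ, ‖(a.toNNReal : ℝ)‖ ≤ |a| := fun a => by
    rw [Real.norm_of_nonneg (NNReal.coe_nonneg _), Real.coe_toNNReal']
    exact max_le (le_abs_self a) (abs_nonneg a)
  have gen : ∀ {ψ : ℝ → ℝ}, Measurable ψ → (∀ x, |ψ x| = |φ x|) →
      ∀ t, t < ε → Integrable (fun x => Real.exp (t * X x))
        (volume.withDensity fun x => ((ψ x).toNNReal : ENNReal)) := by
    intro ψ hψ hψφ t ht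
    rw [integrable_withDensity_iff_integrable_smul hψ.real_toNNReal]
    refine (hexp t ht).mono' ?_ (Eventually.of_forall fun x => ?_)
    · have := hψ.real_toNNReal.coe_nnreal_real
      exact (this.mul (by fun_prop)).aestronglyMeasurable
    · rw [NNReal.smul_def, smul_eq_mul, norm_mul, Real.norm_of_nonneg (Real.exp_nonneg _)]
      gcongr
      exact (habs _).trans (hψφ x).le
  set μ := volume.withDensity fun x => ((φ x).toNNReal : ENNReal)
  set ν := volume.withDensity fun x => ((-φ x).toNNReal : ENNReal)
  have iμ := gen hφ (fun _ => rfl)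
  have iν := gen hφ.neg (fun x => abs_neg _)
  have fin : ∀ {m : Measure ℝ}, (∀ t, t < ε → Integrable (fun x => Real.exp (t * X x)) m) →
      IsFiniteMeasure m := by
    intro m h
    have := h 0 hε
    simp only [zero_mul, Real.exp_zero] at this
    exact (integrable_const_iff.1 this).resolve_left one_ne_zero
  have := fin iμ
  have := fin iν
  have hpow : ∀ k : ℕ, Integrable fun x => φ x * X x ^ k := by
    intro k
    refine (hint.abs.const_mul (k.factorial / ε ^ k)).mono' (by fun_prop)
      (Eventually.of_forall fun x => ?_)
    have h1 := Real.pow_div_factorial_le_exp _ (mul_nonneg hε.le (hX0 x)) k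
    rw [mul_pow, div_le_iff₀ (by positivity)] at h1
    rw [norm_mul, Real.norm_eq_abs, Real.norm_of_nonneg (pow_nonneg (hX0 x) _), abs_mul,
      abs_of_pos (Real.exp_pos _)]
    have h2 : X x ^ k ≤ k.factorial / ε ^ k * Real.exp (ε * X x) := by
      rw [div_mul_eq_mul_div, le_div_iff₀ (by positivity)]
      linarith
    calc |φ x| * X x ^ k ≤ |φ x| * (k.factorial / ε ^ k * Real.exp (ε * X x)) := by gcongr
      _ = _ := by simp only [hXdef]; ring
  have hmap : μ.map X = ν.map X := by
    refine map_eq_of_moments hX hε iμ iν fun k => ?_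
    rw [integral_withDensity_eq_integral_smul hp, integral_withDensity_eq_integral_smul hm,
      ← sub_eq_zero]
    have part : ∀ {ψ : ℝ → ℝ}, Measurable ψ → (∀ x, |ψ x| = |φ x|) →
        Integrable fun x => (ψ x).toNNReal • X x ^ k := by
      intro ψ hψ hψφ
      refine (hpow k).abs.mono' ?_ (Eventually.of_forall fun x => ?_)
      · have := hψ.real_toNNReal.coe_nnreal_real
        exact (this.mul (by fun_prop)).aestronglyMeasurable
      · rw [NNReal.smul_def, smul_eq_mul, norm_mul, abs_mul,
          Real.norm_of_nonneg (pow_nonneg (hX0 x) _), abs_of_nonneg (pow_nonneg (hX0 x) _)]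
        exact mul_le_mul_of_nonneg_right ((habs _).trans (hψφ x).le) (pow_nonneg (hX0 x) _)
    have hsub := integral_sub (part hφ fun _ => rfl)
      (part (ψ := fun x => -φ x) hφ.neg fun x => abs_neg _)
    rw [← hsub, ← hmom k]
    refine integral_congr_ae (Eventually.of_forall fun x => ?_)
    simp only [NNReal.smul_def, smul_eq_mul, hXdef, ← sub_mul, pow_mul]
    congr 1
    rw [Real.coe_toNNReal', Real.coe_toNNReal']
    rcases le_total (φ x) 0 with h | h
    · rw [max_eq_right h, max_eq_left (by linarith)]; ring
    · rw [max_eq_left h, max_eq_right (by linarith)]; ring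
  -- as `φ` is even, its positivity set is the preimage under `X` of a Borel set
  have hset : {x | 0 < φ x} = X ⁻¹' {y | 0 < φ (y ^ ((2 * n : ℕ) : ℝ)⁻¹)} := by
    ext x
    have : φ (X x ^ ((2 * n : ℕ) : ℝ)⁻¹) = φ x := by
      rw [hXdef]
      simp only
      rw [← (even_two_mul n).pow_abs, Real.pow_rpow_inv_natCast (abs_nonneg x) (by omega)]
      rcases abs_choice x with h | h <;> rw [h]
      exact heven x
    simp only [Set.mem_ofPred_eq, Set.mem_preimage, this]
  have hB : MeasurableSet {y : ℝ | 0 < φ (y ^ ((2 * n : ℕ) : ℝ)⁻¹)} :=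
    measurableSet_lt measurable_const (hφ.comp (by fun_prop))
  have hν0 : ν {x | 0 < φ x} = 0 := by
    rw [withDensity_apply _ (measurableSet_lt measurable_const hφ)]
    rw [setLIntegral_congr_fun (g := fun _ => 0) (measurableSet_lt measurable_const hφ)]
    · simp
    · intro x hx
      have hx' : 0 < φ x := hx
      simp [Real.toNNReal_of_nonpos (show -φ x ≤ 0 by linarith)]
  have hμ0 : μ {x | 0 < φ x} = 0 := by
    rw [hset, ← Measure.map_apply hX hB, hmap, Measure.map_apply hX hB, ← hset, hν0]
  rw [withDensity_apply _ (measurableSet_lt measurable_const hφ),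
    setLIntegral_eq_zero_iff (measurableSet_lt measurable_const hφ) (by fun_prop)] at hμ0
  filter_upwards [hμ0] with x hx
  by_contra hlt
  have h1 := hx (not_le.1 hlt)
  simp only [ENNReal.coe_eq_zero, Real.toNNReal_eq_zero] at h1
  exact hlt h1

theorem ae_zero_of_moments {n : ℕ} (hn : 1 ≤ n) {φ : ℝ → ℝ} (hφ : Measurable φ)
    (heven : ∀ x, φ (-x) = φ x) {ε : ℝ} (hε : 0 < ε)
    (hint : Integrable fun x => φ x * Real.exp (ε * x ^ (2 * n)))
    (hmom : ∀ k : ℕ, ∫ x, φ x * x ^ (2 * n * k) = 0) : ∀ᵐ x, φ x = 0 := by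
  have h1 := ae_nonpos_of_moments hn hφ heven hε hint hmom
  have h2 := ae_nonpos_of_moments hn hφ.neg (fun x => by simp [heven]) hε
    (by simpa using hint.neg) (fun k => by
      simp only [Pi.neg_apply, neg_mul, integral_neg, hmom, neg_zero])
  filter_upwards [h1, h2] with x e1 e2
  have : -φ x ≤ 0 := e2
  linarith

/-- A function vanishes if its moments against the even powers `x ^ (2 * n * k)` and the odd powers
`x ^ (2 * n * k + 2 * s + 1)` vanish. -/
theorem ae_zero_of_even_odd_moments {n : ℕ} (hn : 1 ≤ n) (s : ℕ) {φ : ℝ → ℝ} (hφ : Measurable φ)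
    {ε : ℝ} (hε : 0 < ε)
    (hint : ∀ m : ℕ, Integrable fun x => φ x * x ^ m * Real.exp (ε * x ^ (2 * n)))
    (hint0 : ∀ m : ℕ, Integrable fun x => φ x * x ^ m)
    (heven : ∀ k : ℕ, ∫ x, φ x * x ^ (2 * n * k) = 0)
    (hodd : ∀ k : ℕ, ∫ x, φ x * x ^ (2 * n * k + (2 * s + 1)) = 0) : ∀ᵐ x, φ x = 0 := by
  have hE : ∀ x : ℝ, (-x) ^ (2 * n) = x ^ (2 * n) := fun x => (even_two_mul n).neg_pow x
  have hK : ∀ (k : ℕ) (x : ℝ), (-x) ^ (2 * n * k) = x ^ (2 * n * k) := fun k x =>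
    Even.neg_pow ((even_two_mul n).mul_right k) x
  have hS : ∀ x : ℝ, (-x) ^ (2 * s + 1) = -x ^ (2 * s + 1) := fun x =>
    Odd.neg_pow ⟨s, rfl⟩ x
  have h1 : ∀ᵐ x, φ x + φ (-x) = 0 := by
    refine ae_zero_of_moments hn (φ := fun x => φ x + φ (-x)) (by fun_prop)
      (fun x => by rw [neg_neg]; ring) hε ?_ fun k => ?_
    · have := hint 0
      refine (this.add this.comp_neg).congr (Eventually.of_forall fun x => ?_)
      simp only [Pi.add_apply, pow_zero, mul_one, hE]; ring
    · have i1 := hint0 (2 * n * k)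
      have : ∀ x, (φ x + φ (-x)) * x ^ (2 * n * k) =
          φ x * x ^ (2 * n * k) + φ (-x) * (-x) ^ (2 * n * k) := fun x => by rw [hK]; ring
      simp_rw [this]
      rw [integral_add i1 i1.comp_neg, integral_neg_eq_self (fun x => φ x * x ^ (2 * n * k)),
        heven, add_zero]
  have h2 : ∀ᵐ x, x ^ (2 * s + 1) * (φ x - φ (-x)) = 0 := by
    refine ae_zero_of_moments hn (φ := fun x => x ^ (2 * s + 1) * (φ x - φ (-x))) (by fun_prop)
      (fun x => by rw [neg_neg, hS]; ring) hε ?_ fun k => ?_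
    · have := hint (2 * s + 1)
      refine (this.add this.comp_neg).congr (Eventually.of_forall fun x => ?_)
      simp only [Pi.add_apply, hE, hS]; ring
    · have i1 := hint0 (2 * n * k + (2 * s + 1))
      have : ∀ x, x ^ (2 * s + 1) * (φ x - φ (-x)) * x ^ (2 * n * k) =
          φ x * x ^ (2 * n * k + (2 * s + 1)) + φ (-x) * (-x) ^ (2 * n * k + (2 * s + 1)) :=
        fun x => by rw [pow_add (-x), hK, hS, pow_add]; ring
      simp_rw [this]
      rw [integral_add i1 i1.comp_neg,
        integral_neg_eq_self (fun x => φ x * x ^ (2 * n * k + (2 * s + 1))), hodd, add_zero]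
  filter_upwards [h1, h2, ae_ne_zero] with x e1 e2 e3
  have := (mul_eq_zero.1 e2).resolve_left (pow_ne_zero _ e3)
  linarith

open Polynomial in
/-- The span of the ladder polynomials is stable under multiplication by `x ^ (2 * n)`. -/
theorem X_pow_mul_mem_span_lad {n r s : ℕ} (hn : r + s + 1 = n) {p : ℝ[X]}
    (hp : p ∈ Submodule.span ℝ (Set.range (lad n r s))) :
    X ^ (2 * n) * p ∈ Submodule.span ℝ (Set.range (lad n r s)) := by
  set W := Submodule.span ℝ (Set.range (lad n r s))
  have hl : ∀ l, lad n r s l ∈ W := fun l => Submodule.subset_span ⟨l, rfl⟩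
  have hC : ∀ (a : ℝ) (q : ℝ[X]), q ∈ W → C a * q ∈ W := fun a q hq => by
    rw [← smul_eq_C_mul]; exact W.smul_mem a hq
  have hlow : ∀ l, lowered n s r l ∈ W := fun l => by
    cases l with
    | zero => rw [lowered_zero]; exact W.zero_mem
    | succ l => rw [lowered_succ]; exact hC _ _ (hl l)
  have hq : ∀ l, C (Real.sqrt 2) * X ^ (2 * s + 1) * lad n s r l ∈ W := fun l => by
    rw [lad_recurrence n r s l hn]
    exact W.add_mem (hC _ _ (hl _)) (hlow l)
  have hq2 : ∀ l, C (Real.sqrt 2) * X ^ (2 * s + 1) * lowered n r s l ∈ W := fun l => by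
    cases l with
    | zero => rw [lowered_zero, mul_zero]; exact W.zero_mem
    | succ l =>
      rw [lowered_succ, mul_left_comm]
      exact hC _ _ (hq l)
  induction hp using Submodule.span_induction with
  | mem x hx =>
    obtain ⟨l, rfl⟩ := hx
    have h2 : (C (Real.sqrt 2) : ℝ[X]) * C (Real.sqrt 2) = C 2 := by
      rw [← C_mul, Real.mul_self_sqrt two_pos.le]
    have h3 : X ^ (2 * n) * lad n r s l = C (1 / 2 : ℝ) *
        (C (rung n s r l) * (C (Real.sqrt 2) * X ^ (2 * s + 1) * lad n s r (l + 1)) +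
          C (Real.sqrt 2) * X ^ (2 * s + 1) * lowered n r s l) := by
      have h4 : (C (1 / 2 : ℝ) : ℝ[X]) * C 2 = 1 := by rw [← C_mul]; norm_num
      have h5 : (X : ℝ[X]) ^ (2 * n) = X ^ (2 * r + 1) * X ^ (2 * s + 1) := by
        rw [← pow_add]; congr 1; omega
      have h6 := lad_recurrence n s r l (by omega)
      rw [h5]
      linear_combination (C (1 / 2 : ℝ) * C (Real.sqrt 2) * X ^ (2 * s + 1)) * h6
        - (X ^ (2 * r + 1) * X ^ (2 * s + 1) * lad n r s l) * h4
        - (C (1 / 2 : ℝ) * X ^ (2 * r + 1) * X ^ (2 * s + 1) * lad n r s l) * h2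
    rw [h3]
    exact hC _ _ (W.add_mem (hC _ _ (hq _)) (hq2 l))
  | zero => rw [mul_zero]; exact W.zero_mem
  | add x y _ _ hx hy => rw [mul_add]; exact W.add_mem hx hy
  | smul a x _ hx => rw [mul_smul_comm]; exact W.smul_mem a hx

open Polynomial in
theorem X_pow_mem_span_lad {n r s : ℕ} (hn : r + s + 1 = n) (k : ℕ) :
    X ^ (2 * n * k) ∈ Submodule.span ℝ (Set.range (lad n r s)) ∧
    X ^ (2 * n * k + (2 * s + 1)) ∈ Submodule.span ℝ (Set.range (lad n r s)) := by
  have hn1 : 1 ≤ n := by omega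
  set W := Submodule.span ℝ (Set.range (lad n r s))
  have hl : ∀ l, lad n r s l ∈ W := fun l => Submodule.subset_span ⟨l, rfl⟩
  have hC : ∀ (a : ℝ) (q : ℝ[X]), q ∈ W → C a * q ∈ W := fun a q hq => by
    rw [← smul_eq_C_mul]; exact W.smul_mem a hq
  have hiter : ∀ q ∈ W, X ^ (2 * n * k) * q ∈ W := by
    intro q hq
    induction k with
    | zero => simpa using hq
    | succ k ih =>
      have := X_pow_mul_mem_span_lad hn ih
      rwa [← mul_assoc, ← pow_add, add_comm, ← Nat.mul_succ] at this
  have h0 : (1 : ℝ[X]) ∈ W := by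
    have h : (1 : ℝ[X]) = C (groundNorm n r)⁻¹ * lad n r s 0 := by
      rw [lad, ← C_mul, inv_mul_cancel₀ (groundNorm_pos hn1 r).ne', C_1]
    rw [h]; exact hC _ _ (hl 0)
  have h1 : (X ^ (2 * s + 1) : ℝ[X]) ∈ W := by
    have hrec := lad_recurrence n r s 0 hn
    rw [lowered_zero, add_zero, lad] at hrec
    have h2 : Real.sqrt 2 * groundNorm n s ≠ 0 :=
      mul_ne_zero (Real.sqrt_pos.2 two_pos).ne' (groundNorm_pos hn1 s).ne'
    have h : (X ^ (2 * s + 1) : ℝ[X]) = C (Real.sqrt 2 * groundNorm n s)⁻¹ *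
        (C (rung n r s 0) * lad n r s (0 + 1)) := by
      have h3 : C (Real.sqrt 2 * groundNorm n s)⁻¹ *
          (C (Real.sqrt 2) * C (groundNorm n s)) = (1 : ℝ[X]) := by
        rw [← C_mul, ← C_mul, inv_mul_cancel₀ h2, C_1]
      rw [← hrec]
      linear_combination (-(X ^ (2 * s + 1) : ℝ[X])) * h3
    rw [h]; exact hC _ _ (hC _ _ (hl 1))
  refine ⟨?_, ?_⟩
  · simpa using hiter 1 h0
  · rw [pow_add]; exact hiter _ h1

theorem tame_exp (n : ℕ) : Tame n (fun x => (Real.exp (x ^ (2 * n) / (4 * n)) : ℂ)) := by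
  refine ⟨by fun_prop, 1, fun x => ?_⟩
  simp only [one_mul]
  rw [Complex.norm_real, Real.norm_of_nonneg (Real.exp_nonneg _)]

open Polynomial in
/-- The levels are complete. Real and imaginary part of `x ^ r * exp (-x ^ (2 * n) / (2 * n)) * f`
have vanishing moments against the powers of `X_pow_mem_span_lad`, and the exponential moments that
make the moment problem determinate exist because of the Gaussian factor. -/
theorem eq_zero_of_inner_level {n r s : ℕ} (hn : r + s + 1 = n) {f : L2}
    (hf : ∀ l, inner ℂ (level n r s l) f = (0 : ℂ)) : f = 0 := by
  have hn1 : 1 ≤ n := by omega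
  have hn0 : (0 : ℝ) < n := by exact_mod_cast (show 0 < n by omega)
  have hw := continuous_wexp n
  have hint : ∀ q : ℝ[X], Integrable fun x : ℝ =>
      (x : ℂ) ^ r * (q.eval x : ℝ) * (wexp n x : ℂ) * f x := fun q =>
    ((tame_polynomial n hn1 q).memLp hn1 r).integrable_mul (Lp.memLp f)
  have hspan : ∀ q ∈ Submodule.span ℝ (Set.range (lad n r s)),
      ∫ x : ℝ, (x : ℂ) ^ r * (q.eval x : ℝ) * (wexp n x : ℂ) * f x = 0 := by
    intro q hq
    induction hq using Submodule.span_induction with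
    | mem q hq =>
      obtain ⟨l, rfl⟩ := hq
      rw [← inner_level hn1, hf]
    | zero => simp
    | add p q _ _ hp hq =>
      rw [← add_zero (0 : ℂ)]
      nth_rewrite 1 [← hp]
      rw [← hq, ← integral_add (hint p) (hint q)]
      refine integral_congr_ae (Eventually.of_forall fun x => ?_)
      simp only [eval_add]; push_cast; ring
    | smul a p _ hp =>
      rw [← mul_zero (a : ℂ), ← hp, ← integral_const_mul]
      refine integral_congr_ae (Eventually.of_forall fun x => ?_)
      simp only [eval_smul, smul_eq_mul]; push_cast; ring
  have hpow : ∀ m : ℕ, Integrable fun x : ℝ => (x : ℂ) ^ r * (x : ℂ) ^ m * (wexp n x : ℂ) * f x :=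
    fun m => by simpa using hint (X ^ m)
  have hpowexp : ∀ m : ℕ, Integrable fun x : ℝ => (x : ℂ) ^ (r + m) *
      (Real.exp (x ^ (2 * n) / (4 * n)) : ℂ) * (wexp n x : ℂ) * f x := fun m =>
    ((tame_exp n).memLp hn1 (r + m)).integrable_mul (Lp.memLp f)
  have key : ∀ L : ℂ →L[ℝ] ℝ, ∀ᵐ x : ℝ, L (f x) = 0 := by
    intro L
    have hLm : ∀ (a : ℝ) (z : ℂ), L ((a : ℂ) * z) = a * L z := fun a z => by
      rw [← Complex.real_smul, map_smul, smul_eq_mul]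
    have hfm : Measurable fun x => L (f x) :=
      L.measurable.comp (Lp.stronglyMeasurable f).measurable
    have hmom : ∀ m : ℕ, ∫ x, x ^ r * wexp n x * L (f x) * x ^ m =
        L (∫ x : ℝ, (x : ℂ) ^ r * (x : ℂ) ^ m * (wexp n x : ℂ) * f x) := by
      intro m
      rw [← L.integral_comp_comm (hpow m)]
      refine integral_congr_ae (Eventually.of_forall fun x => ?_)
      have : (x : ℂ) ^ r * (x : ℂ) ^ m * (wexp n x : ℂ) * f x =
          ((x ^ r * wexp n x * x ^ m : ℝ) : ℂ) * f x := by push_cast; ring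
      simp only [this, hLm]; ring
    have h := ae_zero_of_even_odd_moments hn1 s (φ := fun x => x ^ r * wexp n x * L (f x))
      (by fun_prop) (ε := (4 * n : ℝ)⁻¹) (by positivity) (fun m => ?_) (fun m => ?_)
      (fun k => ?_) (fun k => ?_)
    · filter_upwards [h, ae_ne_zero] with x e1 e2
      exact (mul_eq_zero.1 e1).resolve_left (mul_ne_zero (pow_ne_zero _ e2) (wexp_pos n x).ne')
    · refine (L.integrable_comp (hpowexp m)).congr (Eventually.of_forall fun x => ?_)
      have : (x : ℂ) ^ (r + m) * (Real.exp (x ^ (2 * n) / (4 * n)) : ℂ) * (wexp n x : ℂ) * f x =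
          ((x ^ (r + m) * Real.exp (x ^ (2 * n) / (4 * n)) * wexp n x : ℝ) : ℂ) * f x := by
        push_cast; ring
      simp only [this, hLm]
      rw [show (4 * n : ℝ)⁻¹ * x ^ (2 * n) = x ^ (2 * n) / (4 * n) by ring]
      ring
    · refine (L.integrable_comp (hpow m)).congr (Eventually.of_forall fun x => ?_)
      have : (x : ℂ) ^ r * (x : ℂ) ^ m * (wexp n x : ℂ) * f x =
          ((x ^ r * wexp n x * x ^ m : ℝ) : ℂ) * f x := by push_cast; ring
      simp only [this, hLm]; ring
    · rw [hmom]
      have := hspan _ (X_pow_mem_span_lad hn k).1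
      simp only [eval_pow, eval_X, Complex.ofReal_pow] at this
      rw [this, map_zero]
    · rw [hmom]
      have := hspan _ (X_pow_mem_span_lad hn k).2
      simp only [eval_pow, eval_X, Complex.ofReal_pow] at this
      rw [this, map_zero]
  refine Lp.ext ?_
  filter_upwards [key Complex.reCLM, key Complex.imCLM, Lp.coeFn_zero ℂ 2 (volume : Measure ℝ)]
    with x e1 e2 e3
  rw [e3]
  exact Complex.ext e1 e2

/-- The Hilbert basis of `L²(ℝ)` consisting of the levels of the `(r, s)` sector. -/
def levelBasis {n r s : ℕ} (hn : r + s + 1 = n) : HilbertBasis ℕ ℂ L2 :=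
  HilbertBasis.mkOfOrthogonalEqBot (orthonormal_level hn) (by
    rw [eq_bot_iff]
    intro f hf
    rw [Submodule.mem_bot]
    refine eq_zero_of_inner_level hn fun l => ?_
    exact (Submodule.mem_orthogonal _ _).1 hf _ (Submodule.subset_span ⟨l, rfl⟩))

theorem levelBasis_apply {n r s : ℕ} (hn : r + s + 1 = n) (l : ℕ) :
    levelBasis hn l = level n r s l := by
  rw [levelBasis, HilbertBasis.coe_mkOfOrthogonalEqBot]

/-! ### The operators as weighted shifts -/

/-- In terms of the levels, `g` is the image of `f` under the lowering operator; `f` belongs to the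
`(r, s)` sector and `g` to the `(s, r)` sector. -/
def IsLower (n r s : ℕ) (f g : L2) : Prop :=
  ∀ l, inner ℂ (level n s r l) g = (rung n r s l : ℂ) * inner ℂ (level n r s (l + 1)) f

/-- In terms of the levels, `g` is the image of `f` under the raising operator; `f` belongs to the
`(s, r)` sector and `g` to the `(r, s)` sector. -/
def IsRaise (n r s : ℕ) (f g : L2) : Prop :=
  inner ℂ (level n r s 0) g = (0 : ℂ) ∧
    ∀ l, inner ℂ (level n r s (l + 1)) g = (rung n r s l : ℂ) * inner ℂ (level n s r l) f

theorem repr_levelBasis {n r s : ℕ} (hn : r + s + 1 = n) (f : L2) (l : ℕ) :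
    (levelBasis hn).repr f l = inner ℂ (level n r s l) f := by
  rw [HilbertBasis.repr_apply_apply, levelBasis_apply]

theorem hasSum_level {n r s : ℕ} (hn : r + s + 1 = n) (f : L2) :
    HasSum (fun l => inner ℂ (level n r s l) f • level n r s l) f := by
  have := (levelBasis hn).hasSum_repr f
  simpa only [repr_levelBasis, levelBasis_apply] using this

theorem summable_sq_inner_level {n r s : ℕ} (hn : r + s + 1 = n) (f : L2) :
    Summable fun l => ‖inner ℂ (level n r s l) f‖ ^ 2 := by
  have h := lp.memℓp ((levelBasis hn).repr f)
  rw [memℓp_gen_iff (by norm_num)] at h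
  simpa [repr_levelBasis] using h

theorem mem_of_hasSum_smul {E : Type*} [AddCommMonoid E] [Module ℂ E] [TopologicalSpace E]
    {W : Submodule ℂ E} (hW : IsClosed (W : Set E)) {a : ℕ → ℂ} {F : ℕ → E} (hF : ∀ l, F l ∈ W)
    {x : E} (h : HasSum (fun l => a l • F l) x) : x ∈ W :=
  hW.mem_of_tendsto h (Eventually.of_forall fun _ =>
    Submodule.sum_mem _ fun l _ => W.smul_mem (a l) (hF l))

/-- If the lowering relation holds in terms of coefficients, then `f` lies in the common domain of
the lowering and raising operators. The squared matrix elements of the two operators differ by a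
constant, so the coefficients of the raised function are square summable as well, and the closed
graph contains the sum of the series. -/
theorem exists_mem_ladderGraph_of_isLower {n r s : ℕ} (hn : r + s + 1 = n) {f g : L2}
    (hfg : IsLower n r s f g) : ∃ h, (f, g, h) ∈ ladderGraph n r s := by
  have hn' : s + r + 1 = n := by omega
  set a : ℕ → ℂ := fun l => inner ℂ (level n r s l) f with ha
  set c : ℕ → ℂ := fun l => match l with
    | 0 => 0
    | l + 1 => (rung n s r l : ℂ) * a l with hc
  have hcs : Summable fun l => ‖c l‖ ^ 2 := by
    rw [← summable_nat_add_iff 2]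
    have h1 := summable_sq_inner_level hn' g
    have h2 := (((summable_nat_add_iff 1).2 (summable_sq_inner_level hn f))).mul_left
      ((2 * r + 1 : ℕ) : ℝ)
    refine (h1.add h2).congr fun l => ?_
    have h3 := rung_succ_sq n s r l hn'
    simp only [hc, ha]
    rw [hfg l, norm_mul, norm_mul, mul_pow, mul_pow, Complex.norm_real, Complex.norm_real,
      Real.norm_eq_abs, Real.norm_eq_abs, sq_abs, sq_abs, h3]
    push_cast
    ring
  have hcm : Memℓp c 2 := by
    rw [memℓp_gen_iff (by norm_num)]
    simpa using hcs
  set h : L2 := (levelBasis hn').repr.symm ⟨c, hcm⟩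
  have hsum : HasSum (fun l => c l • level n s r l) h := by
    have := (levelBasis hn').hasSum_repr_symm ⟨c, hcm⟩
    simpa only [levelBasis_apply] using this
  refine ⟨h, ?_⟩
  have s1 : HasSum (fun l => a l • level n r s l) f := hasSum_level hn f
  have s2 : HasSum (fun l => a l • lowerLevel n r s l) g := by
    rw [← hasSum_nat_add_iff' 1]
    simp only [Finset.range_one, Finset.sum_singleton, lowerLevel, smul_zero, sub_zero]
    refine (hasSum_level hn' g).congr_fun ?_
    intro l
    rw [smul_smul, hfg l, mul_comm]
  have s3 : HasSum (fun l => a l • raiseLevel n r s l) h := by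
    rw [← hasSum_nat_add_iff' 1] at hsum
    simp only [Finset.range_one, Finset.sum_singleton, hc, zero_smul, sub_zero] at hsum
    refine hsum.congr_fun ?_
    intro l
    rw [raiseLevel, smul_smul, mul_comm]
  exact mem_of_hasSum_smul (isClosed_ladderGraph n r s) (level_mem_ladderGraph hn)
    (s1.prodMk (s2.prodMk s3))

/-- The lowering operator, on its maximal domain, is the weighted shift given by the matrix
elements. The operator is contained in the shift by integration by parts against the levels, and
contains it by closedness. -/
theorem isLower_iff {n r s : ℕ} (hn : r + s + 1 = n) (f g : L2) :
    IsLower n r s f g ↔ MemLp (fun x : ℝ => (x : ℂ) ^ n * f x) 2 volume ∧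
      ∃ (u : L2) (c : ℂ),
        (∀ᵐ x : ℝ, f x = (x : ℂ) ^ r * (c + ∫ t in (0 : ℝ)..x, (t : ℂ) ^ s * u t)) ∧
        (∀ᵐ x : ℝ, g x = ((Real.sqrt 2)⁻¹ : ℝ) * (u x + (x : ℂ) ^ n * f x)) := by
  constructor
  · intro hfg
    obtain ⟨h, hX, c, hc⟩ := exists_mem_ladderGraph_of_isLower hn hfg
    refine ⟨?_, (Real.sqrt 2 : ℂ)⁻¹ • (g - h), c, hc, ?_⟩
    · refine (Lp.memLp ((Real.sqrt 2 : ℂ)⁻¹ • (g + h))).ae_eq ?_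
      filter_upwards [hX] with x hx
      exact hx.symm
    · filter_upwards [hX, Lp.coeFn_smul (Real.sqrt 2 : ℂ)⁻¹ (g + h), Lp.coeFn_add g h,
        Lp.coeFn_smul (Real.sqrt 2 : ℂ)⁻¹ (g - h), Lp.coeFn_sub g h] with x e1 e2 e3 e4 e5
      have e1' : (x : ℂ) ^ n * f x = ((Real.sqrt 2 : ℂ)⁻¹ • (g + h)) x := e1
      rw [e1', e2, e4, Pi.smul_apply, Pi.smul_apply, e3, e5, Pi.add_apply, Pi.sub_apply]
      have h2 := sqrt_two_ne_zero
      have h3 := sqrt_two_sq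
      push_cast
      simp only [smul_eq_mul]
      field_simp
      rw [h3]; ring
  · rintro ⟨hX, u, c, hc, hg⟩ l
    set X : L2 := hX.toLp
    have hXe : ∀ᵐ x : ℝ, (x : ℂ) ^ n * f x = X x := by
      filter_upwards [hX.coeFn_toLp] with x hx
      exact hx.symm
    have hmem : (f, u, X) ∈ primGraph n r s := ⟨hXe, c, hc⟩
    have h1 := inner_level_of_mem_primGraph hn hmem l
    have hg' : g = (Real.sqrt 2 : ℂ)⁻¹ • (u + X) := by
      refine Lp.ext ?_
      filter_upwards [hg, hXe, Lp.coeFn_smul (Real.sqrt 2 : ℂ)⁻¹ (u + X), Lp.coeFn_add u X]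
        with x e1 e2 e3 e4
      rw [e1, e2, e3, Pi.smul_apply, e4, Pi.add_apply, smul_eq_mul]
      push_cast; ring
    rw [hg', inner_smul_right, h1]
    have h2 := sqrt_two_ne_zero
    field_simp

theorem mem_graphA_iff {n : ℕ} (hn : 1 ≤ n) (f g : L2) :
    (f, g) ∈ graphA n ↔ IsLower n 0 (n - 1) f g := by
  rw [isLower_iff (by omega)]
  simp only [pow_zero, one_mul]
  rfl

theorem mem_graphB_iff {n : ℕ} (hn : 1 ≤ n) (f g : L2) :
    (f, g) ∈ graphB n ↔ IsLower n (n - 1) 0 f g := by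
  rw [isLower_iff (by omega)]
  simp only [pow_zero, one_mul]
  rfl

theorem isLower_level {n r s : ℕ} (hn : r + s + 1 = n) (l : ℕ) :
    IsLower n r s (level n r s l) (lowerLevel n r s l) :=
  inner_level_of_mem_ladderGraph hn (level_mem_ladderGraph hn l)

theorem dense_of_level_mem {n r s : ℕ} (hn : r + s + 1 = n) (D : Submodule ℂ L2)
    (h : ∀ l, level n r s l ∈ D) : Dense (D : Set L2) := by
  have h1 := (levelBasis hn).dense_span
  rw [← Submodule.dense_iff_topologicalClosure_eq_top] at h1
  refine h1.mono (Submodule.span_le.2 ?_)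
  rintro _ ⟨l, rfl⟩
  rw [levelBasis_apply]
  exact h l

/-- The adjoint of the lowering operator is the raising operator. -/
theorem mem_adjoint_graph_iff {n r s : ℕ} (hn : r + s + 1 = n) {T : L2 →ₗ.[ℂ] L2}
    (hT : ∀ f g, (f, g) ∈ T.graph ↔ IsLower n r s f g) (f g : L2) :
    (f, g) ∈ T.adjoint.graph ↔ IsRaise n r s f g := by
  have hn' : s + r + 1 = n := by omega
  have hmem : ∀ l, (level n r s l, lowerLevel n r s l) ∈ T.graph := fun l =>
    (hT _ _).2 (isLower_level hn l)
  have hdense : Dense (T.domain : Set L2) :=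
    dense_of_level_mem hn _ fun l => LinearPMap.mem_domain_of_mem_graph (hmem l)
  rw [LinearPMap.adjoint_graph_eq_graph_adjoint hdense, Submodule.mem_adjoint_iff]
  constructor
  · -- test against the levels
    intro h
    refine ⟨?_, fun l => ?_⟩
    · have := h _ _ (hmem 0)
      simpa [lowerLevel] using this
    · have := h _ _ (hmem (l + 1))
      rw [lowerLevel, inner_smul_left, Complex.conj_ofReal] at this
      exact (sub_eq_zero.1 this).symm
  · -- expand both inner products in the levels
    rintro ⟨h0, h1⟩ a b hab
    have hab' := (hT a b).1 hab
    have s1 := (levelBasis hn').hasSum_inner_mul_inner b f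
    have s2 := (levelBasis hn).hasSum_inner_mul_inner a g
    rw [← hasSum_nat_add_iff' 1] at s2
    simp only [levelBasis_apply, Finset.range_one, Finset.sum_singleton, h0, mul_zero,
      sub_zero] at s1 s2
    rw [sub_eq_zero]
    refine s1.unique (s2.congr_fun ?_)
    intro l
    rw [h1 l, ← inner_conj_symm b, hab' l, map_mul, Complex.conj_ofReal, inner_conj_symm]
    ring

theorem mem_opA_graph_iff {n : ℕ} (hn : 1 ≤ n) (f g : L2) :
    (f, g) ∈ (opA n).graph ↔ IsLower n 0 (n - 1) f g := by
  rw [opA_graph, mem_graphA_iff hn]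

theorem mem_opB_graph_iff {n : ℕ} (hn : 1 ≤ n) (f g : L2) :
    (f, g) ∈ (opB n).graph ↔ IsLower n (n - 1) 0 f g := by
  rw [opB_graph, mem_graphB_iff hn]

theorem mem_opAstar_graph_iff {n : ℕ} (hn : 1 ≤ n) (f g : L2) :
    (f, g) ∈ (opAstar n).graph ↔ IsRaise n 0 (n - 1) f g :=
  mem_adjoint_graph_iff (by omega) (mem_opA_graph_iff hn) f g

theorem mem_opBstar_graph_iff {n : ℕ} (hn : 1 ≤ n) (f g : L2) :
    (f, g) ∈ (opBstar n).graph ↔ IsRaise n (n - 1) 0 f g :=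
  mem_adjoint_graph_iff (by omega) (mem_opB_graph_iff hn) f g

theorem isRaise_level {n r s : ℕ} (hn : r + s + 1 = n) (l : ℕ) :
    IsRaise n r s (level n s r l) ((rung n r s l : ℂ) • level n r s (l + 1)) := by
  refine ⟨?_, fun m => ?_⟩
  · rw [inner_smul_right, inner_level_level _ _ _ _ hn]; simp
  · rw [inner_smul_right, inner_level_level _ _ _ _ hn, inner_level_level _ _ _ _ (by omega)]
    by_cases h : m = l
    · simp [h]
    · simp [h]

/-! ### Identification of the vectors `ψ_l` and `ψ̃_l` -/

theorem app_eq_of_mem_graph {T : L2 →ₗ.[ℂ] L2} {f g : L2} (h : (f, g) ∈ T.graph) :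
    app T f = g := by
  obtain ⟨y, hy1, hy2⟩ := (LinearPMap.mem_graph_iff T).1 h
  simp only at hy1 hy2
  subst hy1
  rw [app, dif_pos y.2]
  exact hy2

theorem normalize_smul {f : L2} (hf : ‖f‖ = 1) {c : ℝ} (hc : 0 < c) :
    normalize ((c : ℂ) • f) = f := by
  rw [normalize, norm_smul, hf, mul_one, smul_smul, Complex.norm_real, Real.norm_of_nonneg hc.le,
    ← Complex.ofReal_mul, inv_mul_cancel₀ hc.ne', Complex.ofReal_one, one_smul]

theorem app_raise {n r s : ℕ} (hn : r + s + 1 = n) {T : L2 →ₗ.[ℂ] L2}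
    (hT : ∀ f g, (f, g) ∈ T.graph ↔ IsRaise n r s f g) (c : ℂ) (l : ℕ) :
    app T (c • level n s r l) = (c * rung n r s l) • level n r s (l + 1) := by
  refine app_eq_of_mem_graph ?_
  have h := T.graph.smul_mem c ((hT _ _).2 (isRaise_level hn l))
  rwa [Prod.smul_mk, smul_smul] at h

/-- Iterating the product of the two raising operators moves up the levels, two at a time. -/
theorem iterate_raise {n r s : ℕ} (hn : r + s + 1 = n) {S T : L2 →ₗ.[ℂ] L2}
    (hT : ∀ f g, (f, g) ∈ T.graph ↔ IsRaise n r s f g)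
    (hS : ∀ f g, (f, g) ∈ S.graph ↔ IsRaise n s r f g) {c : ℝ} (hc : 0 < c) (m k : ℕ) :
    ∃ d : ℝ, 0 < d ∧ (fun f => app T (app S f))^[k] ((c : ℂ) • level n r s m) =
      (d : ℂ) • level n r s (m + 2 * k) := by
  induction k with
  | zero => exact ⟨c, hc, rfl⟩
  | succ k ih =>
    obtain ⟨d, hd, h⟩ := ih
    refine ⟨d * rung n s r (m + 2 * k) * rung n r s (m + 2 * k + 1),
      mul_pos (mul_pos hd (rung_pos _ _ _ _ (by omega))) (rung_pos _ _ _ _ hn), ?_⟩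
    rw [Function.iterate_succ_apply', h, app_raise (by omega) hS, app_raise hn hT]
    push_cast
    rfl

theorem normalize_iterate_raise {n r s : ℕ} (hn : r + s + 1 = n) {S T : L2 →ₗ.[ℂ] L2}
    (hT : ∀ f g, (f, g) ∈ T.graph ↔ IsRaise n r s f g)
    (hS : ∀ f g, (f, g) ∈ S.graph ↔ IsRaise n s r f g) (l : ℕ) :
    normalize ((fun f => app T (app S f))^[l / 2]
      (if Even l then level n r s 0 else app T (level n s r 0))) = level n r s l := by
  rcases Nat.even_or_odd' l with ⟨k, rfl | rfl⟩
  · rw [if_pos (even_two_mul k), Nat.mul_div_cancel_left _ two_pos]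
    obtain ⟨d, hd, h⟩ := iterate_raise hn hT hS one_pos 0 k
    rw [Complex.ofReal_one, one_smul, zero_add] at h
    rw [h, normalize_smul ((orthonormal_level hn).1 _) hd]
  · have hne : ¬ Even (2 * k + 1) := by simp
    have hdiv : (2 * k + 1) / 2 = k := by omega
    rw [if_neg hne, hdiv]
    have h1 := app_raise hn hT 1 0
    rw [one_smul, one_mul] at h1
    obtain ⟨d, hd, h⟩ := iterate_raise hn hT hS (rung_pos n r s 0 hn) (0 + 1) k
    rw [h1, h, normalize_smul ((orthonormal_level hn).1 _) hd]
    congr 1; omega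

theorem toL2_psiZero (n : ℕ) : toL2 (psiZero n) = level n 0 (n - 1) 0 := by
  rw [level]
  congr 1
  funext x
  simp only [psiZero, levelFun, lad, groundNorm, wexp, Polynomial.eval_C, pow_zero, one_mul,
    Nat.cast_zero, mul_zero, zero_add]

theorem toL2_psiTildeZero {n : ℕ} (hn : 1 ≤ n) :
    toL2 (psiTildeZero n) = level n (n - 1) 0 0 := by
  have hn0 : (n : ℝ) ≠ 0 := by exact_mod_cast (show n ≠ 0 by omega)
  rw [level]
  congr 1
  funext x
  simp only [psiTildeZero, levelFun, lad, groundNorm, wexp, Polynomial.eval_C]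
  have h1 : ((2 * (n - 1 : ℕ) + 1) / (2 * n) : ℝ) = 1 - 1 / (2 * n) := by
    rw [Nat.cast_sub hn]; push_cast; field_simp; ring
  have h2 : (1 / 2 - (2 * (n - 1 : ℕ) + 1) / (4 * n) : ℝ) = 1 / (4 * n) := by
    rw [Nat.cast_sub hn]; push_cast; field_simp; ring
  rw [h1, h2]
  ring

theorem psi_eq_level {n : ℕ} (hn : 1 ≤ n) (l : ℕ) : psi n l = level n 0 (n - 1) l := by
  rw [psi, toL2_psiZero, toL2_psiTildeZero hn]
  exact normalize_iterate_raise (by omega) (mem_opAstar_graph_iff hn) (mem_opBstar_graph_iff hn) l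

theorem psiTilde_eq_level {n : ℕ} (hn : 1 ≤ n) (l : ℕ) :
    psiTilde n l = level n (n - 1) 0 l := by
  rw [psiTilde, toL2_psiZero, toL2_psiTildeZero hn]
  exact normalize_iterate_raise (by omega) (mem_opBstar_graph_iff hn) (mem_opAstar_graph_iff hn) l

/-! ### The series `∑ y ^ l / (Γ(l + a + 1) l!)` -/

/-- The coefficients of the series `∑ y ^ l / (Γ(l + a + 1) l!)`. As `Real.Gamma` takes the value
`0` at its poles, so do these coefficients there, in accordance with the entire function `1 / Γ`. -/
def gammaCoeff (a : ℝ) (l : ℕ) : ℝ := 1 / (Real.Gamma (l + a + 1) * l.factorial)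

/-- The series `∑ y ^ l / (Γ(l + a + 1) l!)`, which is common to the Bessel functions and to the
confluent hypergeometric limit functions. -/
def gammaSeries {𝕜 : Type*} [RCLike 𝕜] (a : ℝ) (y : 𝕜) : 𝕜 :=
  ∑' l : ℕ, (gammaCoeff a l : 𝕜) * y ^ l

theorem succ_mul_gammaCoeff_succ (a : ℝ) (l : ℕ) :
    ((l + 1 : ℕ) : ℝ) * gammaCoeff a (l + 1) = gammaCoeff (a + 1) l := by
  have h : ((l + 1 : ℕ) : ℝ) ≠ 0 := by positivity
  have h1 : ((l + 1 : ℕ) : ℝ) + a + 1 = l + (a + 1) + 1 := by push_cast; ring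
  rw [gammaCoeff, gammaCoeff, h1, Nat.factorial_succ, Nat.cast_mul]
  have : (l.factorial : ℝ) ≠ 0 := by positivity
  by_cases hG : Real.Gamma (l + (a + 1) + 1) = 0
  · rw [hG]; simp
  · field_simp

theorem add_mul_gammaCoeff (a : ℝ) (l : ℕ) :
    ((l : ℝ) + a) * gammaCoeff a l = gammaCoeff (a - 1) l := by
  rw [gammaCoeff, gammaCoeff, show (l : ℝ) + (a - 1) + 1 = l + a by ring]
  by_cases h : (l : ℝ) + a = 0
  · rw [h, Real.Gamma_zero]; simp
  · rw [Real.Gamma_add_one h]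
    have : (l.factorial : ℝ) ≠ 0 := by positivity
    rw [mul_one_div, mul_assoc]
    by_cases hG : Real.Gamma (l + a) = 0
    · rw [hG]; simp
    · field_simp

theorem summable_gammaCoeff (a : ℝ) {R : ℝ} (hR : 0 ≤ R) :
    Summable fun l => |gammaCoeff a l| * R ^ l := by
  refine summable_of_ratio_norm_eventually_le (r := 1 / 2) (by norm_num) ?_
  obtain ⟨N, hN⟩ := exists_nat_ge (2 * R + |a|)
  filter_upwards [eventually_ge_atTop N] with l hl
  have hl' : (N : ℝ) ≤ l := by exact_mod_cast hl
  have ha := neg_abs_le a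
  have h1 : 2 * R ≤ (l + 1 : ℕ) + a := by push_cast; linarith
  have h1' : 0 < ((l + 1 : ℕ) : ℝ) + a := by push_cast; linarith [abs_nonneg a]
  have h2 : (1 : ℝ) ≤ (l + 1 : ℕ) := by push_cast; linarith [(Nat.cast_nonneg l : (0 : ℝ) ≤ l)]
  have h3 : ((l + 1 : ℕ) + a) * (((l + 1 : ℕ) : ℝ) * gammaCoeff a (l + 1)) = gammaCoeff a l := by
    have := add_mul_gammaCoeff a (l + 1)
    have h4 := succ_mul_gammaCoeff_succ (a - 1) l
    rw [sub_add_cancel] at h4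
    rw [mul_left_comm, this, h4]
  rw [Real.norm_of_nonneg (by positivity), Real.norm_of_nonneg (by positivity), ← h3, abs_mul,
    abs_mul, abs_of_pos h1', abs_of_pos (by linarith : (0 : ℝ) < (l + 1 : ℕ)), pow_succ]
  have h5 : R ≤ 1 / 2 * (((l + 1 : ℕ) + a) * ((l + 1 : ℕ) : ℝ)) := by nlinarith
  calc |gammaCoeff a (l + 1)| * (R ^ l * R) = |gammaCoeff a (l + 1)| * R ^ l * R := by ring
    _ ≤ |gammaCoeff a (l + 1)| * R ^ l * (1 / 2 * (((l + 1 : ℕ) + a) * ((l + 1 : ℕ) : ℝ))) := by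
        gcongr
    _ = _ := by ring

section
variable {𝕜 : Type*} [RCLike 𝕜]

theorem hasSum_gammaSeries (a : ℝ) (y : 𝕜) :
    HasSum (fun l => (gammaCoeff a l : 𝕜) * y ^ l) (gammaSeries a y) := by
  refine Summable.hasSum (Summable.of_norm ?_)
  simpa using summable_gammaCoeff a (norm_nonneg y)

theorem hasSum_natCast_mul_gammaCoeff (a : ℝ) (y : 𝕜) :
    HasSum (fun l => (gammaCoeff a l : 𝕜) * ((l : 𝕜) * y ^ (l - 1))) (gammaSeries (a + 1) y) := by
  rw [← hasSum_nat_add_iff' 1]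
  simp only [Finset.range_one, Finset.sum_singleton, Nat.cast_zero, zero_mul, mul_zero, sub_zero,
    Nat.add_sub_cancel]
  refine (hasSum_gammaSeries (a + 1) y).congr_fun fun l => ?_
  rw [← succ_mul_gammaCoeff_succ]
  push_cast; ring

theorem hasDerivAt_gammaSeries (a : ℝ) (y : 𝕜) :
    HasDerivAt (gammaSeries a) (gammaSeries (a + 1) y) y := by
  rw [← (hasSum_natCast_mul_gammaCoeff a y).tsum_eq]
  set R := ‖y‖ + 1
  have hu : Summable fun l : ℕ => |gammaCoeff a l| * (l * R ^ (l - 1)) := by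
    rw [← summable_nat_add_iff 1]
    refine (summable_gammaCoeff (a + 1) (by positivity : 0 ≤ R)).congr fun l => ?_
    rw [← succ_mul_gammaCoeff_succ, Nat.add_sub_cancel, abs_mul, Nat.abs_cast]; ring
  refine hasDerivAt_tsum_of_isPreconnected (t := Metric.ball (0 : 𝕜) R) hu Metric.isOpen_ball
    (convex_ball _ _).isPreconnected (g := fun l y => (gammaCoeff a l : 𝕜) * y ^ l)
    (g' := fun l y => (gammaCoeff a l : 𝕜) * ((l : 𝕜) * y ^ (l - 1)))
    (fun l z _ => (hasDerivAt_pow l z).const_mul _) (fun l z hz => ?_) (y₀ := y) (by simp [R])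
    (hasSum_gammaSeries a y).summable (by simp [R])
  rw [mem_ball_zero_iff] at hz
  rw [norm_mul, norm_mul, norm_pow, RCLike.norm_ofReal, RCLike.norm_natCast]
  gcongr

/-- The three term recurrence of the modified Bessel functions. Together with the derivative formula
it yields the ladder relations of the kernels. -/
theorem mul_gammaSeries_add_one (a : ℝ) (y : 𝕜) :
    y * gammaSeries (a + 1) y + (a : 𝕜) * gammaSeries a y = gammaSeries (a - 1) y := by
  have h1 := ((hasSum_natCast_mul_gammaCoeff a y).mul_left y).add
    ((hasSum_gammaSeries a y).mul_left (a : 𝕜))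
  refine h1.unique ((hasSum_gammaSeries (a - 1) y).congr_fun fun l => ?_)
  rw [← add_mul_gammaCoeff]
  rcases l with _ | l
  · push_cast; ring
  · simp only [Nat.add_sub_cancel]; push_cast; ring

theorem continuous_gammaSeries (a : ℝ) : Continuous (gammaSeries a : 𝕜 → 𝕜) :=
  continuous_iff_continuousAt.2 fun y => (hasDerivAt_gammaSeries a y).continuousAt

theorem gammaSeries_zero (a : ℝ) : gammaSeries a (0 : 𝕜) = ((1 / Real.Gamma (a + 1) : ℝ) : 𝕜) := by
  rw [gammaSeries, tsum_eq_single 0 (fun l hl => by simp [hl])]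
  simp [gammaCoeff]

end

theorem hasDerivAt_rpow_mul_gammaSeries (a : ℝ) {y : ℝ} (hy : 0 < y) :
    HasDerivAt (fun y : ℝ => y ^ a * gammaSeries a y) (y ^ (a - 1) * gammaSeries (a - 1) y) y := by
  refine ((Real.hasDerivAt_rpow_const (p := a) (Or.inl hy.ne')).mul
    (hasDerivAt_gammaSeries a y)).congr_deriv ?_
  rw [← mul_gammaSeries_add_one a y]
  have : y ^ a = y ^ (a - 1) * y := by
    rw [Real.rpow_sub_one hy.ne']; field_simp
  rw [this]
  simp only [RCLike.ofReal_real_eq_id, id]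
  ring

/-! ### An integral representation of the modified Bessel function of the second kind -/

/-- The integral `∫ t ^ (c - 1) * exp (-t - y / t)` over the positive half-line. -/
def besselInt (c y : ℝ) : ℝ :=
  ∫ t in Set.Ioi (0 : ℝ), t ^ (c - 1) * Real.exp (-t - y / t)

theorem continuousOn_besselIntegrand (c y : ℝ) :
    ContinuousOn (fun t : ℝ => t ^ (c - 1) * Real.exp (-t - y / t)) (Set.Ioi 0) := by
  refine ContinuousOn.mul ?_ ?_
  · exact fun t ht => (Real.continuousAt_rpow_const _ _
      (Or.inl (ne_of_gt ht))).continuousWithinAt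
  · refine Real.continuous_exp.comp_continuousOn ?_
    refine ContinuousOn.sub continuousOn_id.neg (continuousOn_const.div continuousOn_id ?_)
    exact fun t ht => ne_of_gt ht

theorem integrableOn_besselIntegrand (c : ℝ) {y : ℝ} (hy : 0 < y) :
    IntegrableOn (fun t : ℝ => t ^ (c - 1) * Real.exp (-t - y / t)) (Set.Ioi 0) := by
  obtain ⟨m, hm⟩ := exists_nat_gt (-c)
  have h := (Real.GammaIntegral_convergent (s := m + c) (by linarith)).const_mul
    (m.factorial / y ^ m)
  refine h.mono' ((continuousOn_besselIntegrand c y).aestronglyMeasurable measurableSet_Ioi) ?_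
  filter_upwards [ae_restrict_mem measurableSet_Ioi] with t ht
  have ht : 0 < t := ht
  have h0 : Real.exp (-t - y / t) = Real.exp (-t) * Real.exp (-(y / t)) := by
    rw [← Real.exp_add, sub_eq_add_neg]
  rw [Real.norm_of_nonneg (by positivity), h0]
  have h1 := Real.pow_div_factorial_le_exp (y / t) (by positivity) m
  have h2 : Real.exp (-(y / t)) ≤ m.factorial / y ^ m * t ^ m := by
    rw [Real.exp_neg]
    have h3 : 0 < (y / t) ^ m / m.factorial := by positivity
    refine (inv_anti₀ h3 h1).trans (le_of_eq ?_)
    rw [div_pow]; field_simp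
  calc t ^ (c - 1) * (Real.exp (-t) * Real.exp (-(y / t)))
      ≤ t ^ (c - 1) * (Real.exp (-t) * (m.factorial / y ^ m * t ^ m)) := by gcongr
    _ = m.factorial / y ^ m * (Real.exp (-t) * (t ^ (m : ℝ) * t ^ (c - 1))) := by
        rw [Real.rpow_natCast]; ring
    _ = _ := by rw [← Real.rpow_add ht]; ring_nf

theorem hasDerivAt_besselInt (c : ℝ) {y : ℝ} (hy : 0 < y) :
    HasDerivAt (besselInt c) (-besselInt (c - 1) y) y := by
  have hy2 : 0 < y / 2 := by positivity
  have key := hasDerivAt_integral_of_dominated_loc_of_deriv_le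
    (μ := volume.restrict (Set.Ioi (0 : ℝ))) (x₀ := y) (s := Set.Ioi (y / 2))
    (F := fun y t => t ^ (c - 1) * Real.exp (-t - y / t))
    (F' := fun y t => -(t ^ (c - 1 - 1) * Real.exp (-t - y / t)))
    (bound := fun t => t ^ (c - 1 - 1) * Real.exp (-t - (y / 2) / t))
    (Ioi_mem_nhds (by linarith))
    (Eventually.of_forall fun z =>
      (continuousOn_besselIntegrand c z).aestronglyMeasurable measurableSet_Ioi)
    (integrableOn_besselIntegrand c hy)
    ((continuousOn_besselIntegrand (c - 1) y).aestronglyMeasurable measurableSet_Ioi).neg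
    ?_ (integrableOn_besselIntegrand (c - 1) hy2) ?_
  · have h := key.2
    rw [integral_neg] at h
    exact h
  · filter_upwards [ae_restrict_mem measurableSet_Ioi] with t ht z hz
    have ht : 0 < t := ht
    have hz : y / 2 < z := hz
    rw [norm_neg, Real.norm_of_nonneg (by positivity)]
    gcongr
  · filter_upwards [ae_restrict_mem measurableSet_Ioi] with t ht z hz
    have ht : 0 < t := ht
    have h1 : HasDerivAt (fun z : ℝ => -t - z / t) (-(1 / t)) z :=
      ((hasDerivAt_id z).div_const t).const_sub (-t)
    refine (h1.exp.const_mul (t ^ (c - 1))).congr_deriv ?_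
    rw [Real.rpow_sub_one ht.ne' (c - 1)]
    field_simp

/-- The symmetry of the integral under the substitution `t ↦ y / t`. -/
theorem rpow_mul_besselInt_neg (c : ℝ) {y : ℝ} (hy : 0 < y) :
    y ^ c * besselInt (-c) y = besselInt c y := by
  have h1 := integral_comp_rpow_Ioi (fun t : ℝ => t ^ (-c - 1) * Real.exp (-t - y / t))
    (p := -1) (by norm_num)
  have h2 := integral_comp_mul_left_Ioi
    (fun x : ℝ => x ^ (c - 1) * Real.exp (-x⁻¹ - y * x)) 0 (b := y⁻¹) (by positivity)
  have h3 : besselInt (-c) y = ∫ x in Set.Ioi (0 : ℝ), x ^ (c - 1) * Real.exp (-x⁻¹ - y * x) := by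
    rw [besselInt, ← h1]
    refine setIntegral_congr_fun measurableSet_Ioi fun x hx => ?_
    have hx : 0 < x := hx
    simp only [abs_neg, abs_one, one_mul, smul_eq_mul, Real.rpow_neg_one]
    rw [← mul_assoc, Real.inv_rpow hx.le, ← Real.rpow_neg hx.le, ← Real.rpow_add hx, div_inv_eq_mul]
    ring_nf
  rw [mul_zero, inv_inv, ← h3, smul_eq_mul] at h2
  have h4 : y ^ c * besselInt (-c) y = y ^ (c - 1) * (y * besselInt (-c) y) := by
    rw [Real.rpow_sub_one hy.ne']; field_simp
  rw [h4, ← h2, ← integral_const_mul, besselInt]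
  refine setIntegral_congr_fun measurableSet_Ioi fun x hx => ?_
  have hx : 0 < x := hx
  rw [Real.mul_rpow (by positivity) hx.le, Real.inv_rpow hy.le, ← mul_assoc, ← mul_assoc,
    mul_inv_cancel₀ (by positivity), one_mul]
  congr 2
  field_simp
  ring

theorem besselInt_nonneg (c y : ℝ) : 0 ≤ besselInt c y :=
  setIntegral_nonneg measurableSet_Ioi fun t ht => by
    have ht : 0 < t := ht
    positivity

theorem besselInt_le_Gamma {c : ℝ} (hc : 0 < c) {y : ℝ} (hy : 0 < y) :
    besselInt c y ≤ Real.Gamma c := by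
  rw [Real.Gamma_eq_integral hc]
  refine setIntegral_mono_on (integrableOn_besselIntegrand c hy)
    (Real.GammaIntegral_convergent hc) measurableSet_Ioi fun t ht => ?_
  have ht : 0 < t := ht
  rw [mul_comm]
  gcongr
  have : 0 < y / t := by positivity
  linarith

theorem tendsto_besselInt {c : ℝ} (hc : 0 < c) :
    Tendsto (besselInt c) (𝓝[>] 0) (𝓝 (Real.Gamma c)) := by
  rw [Real.Gamma_eq_integral hc]
  refine tendsto_integral_filter_of_dominated_convergence
    (fun t => Real.exp (-t) * t ^ (c - 1)) ?_ ?_ (Real.GammaIntegral_convergent hc) ?_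
  · exact Eventually.of_forall fun y =>
      (continuousOn_besselIntegrand c y).aestronglyMeasurable measurableSet_Ioi
  · filter_upwards [self_mem_nhdsWithin] with y hy
    filter_upwards [ae_restrict_mem measurableSet_Ioi] with t ht
    have ht : 0 < t := ht
    have hy : 0 < y := hy
    rw [Real.norm_of_nonneg (by positivity), mul_comm]
    gcongr
    have : 0 < y / t := by positivity
    linarith
  · filter_upwards [ae_restrict_mem measurableSet_Ioi] with t ht
    have h : Continuous fun y : ℝ => t ^ (c - 1) * Real.exp (-t - y / t) := by fun_prop
    have h2 := h.tendsto 0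
    simp only [zero_div, sub_zero] at h2
    rw [mul_comm]
    exact h2.mono_left nhdsWithin_le_nhds

/-- A bound on the derivative is a bound on the function, if both functions vanish at `0`. -/
theorem abs_le_of_abs_deriv_le {f f' B B' : ℝ → ℝ} {Y : ℝ}
    (hf : ∀ y, 0 < y → HasDerivAt f (f' y) y) (hB : ∀ y, 0 < y → HasDerivAt B (B' y) y)
    (hle : ∀ y ∈ Set.Ioc 0 Y, |f' y| ≤ B' y) (hf0 : Tendsto f (𝓝[>] 0) (𝓝 0))
    (hB0 : Tendsto B (𝓝[>] 0) (𝓝 0)) : ∀ y ∈ Set.Ioc 0 Y, |f y| ≤ B y := by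
  have aux : ∀ g g' : ℝ → ℝ, (∀ y, 0 < y → HasDerivAt g (g' y) y) →
      (∀ y ∈ Set.Ioc 0 Y, g' y ≤ B' y) → Tendsto g (𝓝[>] 0) (𝓝 0) →
      ∀ y ∈ Set.Ioc 0 Y, g y ≤ B y := by
    intro g g' hg hle hg0 y hy
    have hmono : MonotoneOn (fun y => B y - g y) (Set.Ioc 0 Y) := by
      refine monotoneOn_of_deriv_nonneg (convex_Ioc 0 Y) (fun z hz => ?_) (fun z hz => ?_)
        (fun z hz => ?_)
      · exact ((hB z hz.1).sub (hg z hz.1)).continuousAt.continuousWithinAt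
      · have hz := interior_subset hz
        exact ((hB z hz.1).sub (hg z hz.1)).differentiableAt.differentiableWithinAt
      · have hz := interior_subset hz
        have hd : deriv (fun y => B y - g y) z = B' z - g' z :=
          ((hB z hz.1).sub (hg z hz.1)).deriv
        rw [hd]
        linarith [hle z hz]
    have hlim : Tendsto (fun y => B y - g y) (𝓝[>] 0) (𝓝 0) := by
      simpa using hB0.sub hg0
    have := le_of_tendsto hlim (b := B y - g y) (by
      filter_upwards [Ioc_mem_nhdsGT hy.1] with z hz
      exact hmono ⟨hz.1, hz.2.trans hy.2⟩ hy hz.2)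
    linarith
  intro y hy
  rw [abs_le]
  constructor
  · have := aux (fun y => -f y) (fun y => -f' y) (fun z hz => (hf z hz).neg)
      (fun z hz => (neg_le_abs _).trans (hle z hz)) (by simpa using hf0.neg) y hy
    linarith
  · exact aux f f' hf (fun z hz => (le_abs_self _).trans (hle z hz)) hf0 y hy

/-- Uniqueness for the first order system equivalent to the modified Bessel equation, with zero
initial values at the singular point `0`. A bound `m` for `E` improves to `m * A ^ k * y ^ k / k!`
by integrating both equations `k` times. -/
theorem bessel_system_unique {ν : ℝ} (hν1 : ν < 1) {E H : ℝ → ℝ}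
    (hE : ∀ y, 0 < y → HasDerivAt E (y ^ (ν - 1) * H y) y)
    (hH : ∀ y, 0 < y → HasDerivAt H (y ^ (-ν) * E y) y)
    (hE0 : Tendsto E (𝓝[>] 0) (𝓝 0)) (hH0 : Tendsto H (𝓝[>] 0) (𝓝 0)) {Y m : ℝ}
    (hm : ∀ y ∈ Set.Ioc 0 Y, |E y| ≤ m) : ∀ y ∈ Set.Ioc 0 Y, E y = 0 := by
  have h1ν : 0 < 1 - ν := by linarith
  set A := (1 - ν)⁻¹
  have hA : 0 < A := by positivity
  have iter : ∀ k : ℕ, ∀ y ∈ Set.Ioc 0 Y, |E y| ≤ m * (A ^ k * (y ^ k / k.factorial)) := by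
    intro k
    induction k with
    | zero => simpa using hm
    | succ k ih =>
      intro y₀ hy₀
      have hm0 : 0 ≤ m := (abs_nonneg _).trans (hm y₀ hy₀)
      have hc : (0 : ℝ) < k + 1 - ν := by
        have : (0 : ℝ) ≤ k := Nat.cast_nonneg k
        linarith
      have hcA : 1 / (k + 1 - ν) ≤ A := by
        rw [one_div]
        refine inv_anti₀ h1ν ?_
        have : (0 : ℝ) ≤ k := Nat.cast_nonneg k
        linarith
      have stepH : ∀ y ∈ Set.Ioc 0 Y,
          |H y| ≤ m * A ^ k / k.factorial * (1 / (k + 1 - ν)) * y ^ (k + 1 - ν) := by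
        refine abs_le_of_abs_deriv_le hH
          (B' := fun y => m * A ^ k / k.factorial * (1 / (k + 1 - ν)) *
            ((k + 1 - ν) * y ^ (k + 1 - ν - 1))) (fun y hy => ?_) (fun y hy => ?_) hH0 ?_
        · exact (Real.hasDerivAt_rpow_const (Or.inl hy.ne')).const_mul _
        · have hy0 : 0 < y := hy.1
          rw [abs_mul, abs_of_pos (by positivity)]
          calc y ^ (-ν) * |E y| ≤ y ^ (-ν) * (m * (A ^ k * (y ^ k / k.factorial))) := by
                gcongr
                exact ih y hy
            _ = _ := by
                rw [show (k + 1 - ν - 1 : ℝ) = k + -ν by ring, Real.rpow_add hy0,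
                  Real.rpow_natCast]
                field_simp
        · have : Continuous fun y : ℝ => m * A ^ k / k.factorial * (1 / (k + 1 - ν)) *
              y ^ (k + 1 - ν) :=
            continuous_const.mul (Real.continuous_rpow_const hc.le)
          have h := this.tendsto 0
          rw [Real.zero_rpow hc.ne', mul_zero] at h
          exact h.mono_left nhdsWithin_le_nhds
      refine abs_le_of_abs_deriv_le hE
        (B := fun y => m * (A ^ (k + 1) * (y ^ (k + 1) / (k + 1).factorial)))
        (B' := fun y => m * (A ^ (k + 1) * (((k + 1 : ℕ) : ℝ) * y ^ k / (k + 1).factorial)))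
        (fun y hy => ?_) (fun y hy => ?_) hE0 ?_ y₀ hy₀
      · have := hasDerivAt_pow (k + 1) y
        rw [Nat.add_sub_cancel] at this
        exact ((this.div_const _).const_mul _).const_mul _
      · have hy0 : 0 < y := hy.1
        rw [abs_mul, abs_of_pos (by positivity)]
        calc y ^ (ν - 1) * |H y|
            ≤ y ^ (ν - 1) *
              (m * A ^ k / k.factorial * (1 / (k + 1 - ν)) * y ^ (k + 1 - ν)) := by
              gcongr
              exact stepH y hy
          _ = m * A ^ k / k.factorial * (1 / (k + 1 - ν)) * (y ^ (ν - 1) * y ^ (k + 1 - ν)) := by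
              ring
          _ = m * A ^ k / k.factorial * (1 / (k + 1 - ν)) * y ^ k := by
              rw [← Real.rpow_add hy0, ← Real.rpow_natCast y k]
              ring_nf
          _ ≤ m * A ^ k / k.factorial * A * y ^ k := by gcongr
          _ = _ := by
              rw [Nat.factorial_succ]
              push_cast
              field_simp
              ring
      · have : Continuous fun y : ℝ => m * (A ^ (k + 1) * (y ^ (k + 1) / (k + 1).factorial)) := by
          fun_prop
        have h := this.tendsto 0
        simp only [ne_eq, Nat.add_eq_zero_iff, one_ne_zero, and_false, not_false_eq_true, zero_pow,
          zero_div, mul_zero] at h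
        exact h.mono_left nhdsWithin_le_nhds
  intro y hy
  have hlim : Tendsto (fun k : ℕ => m * (A ^ k * (y ^ k / k.factorial))) atTop (𝓝 0) := by
    have := (FloorSemiring.tendsto_pow_div_factorial_atTop (A * y)).const_mul m
    rw [mul_zero] at this
    refine this.congr fun k => ?_
    rw [mul_pow, mul_div_assoc]
  have := ge_of_tendsto hlim (Eventually.of_forall fun k => iter k y hy)
  exact abs_nonpos_iff.1 this

/-- Both sides are first components of solutions of one first order system, the second components
being `-besselInt (1 - ν)` and its analogue for the series. The constant comes from the reflection
formula `Γ(ν) Γ(1 - ν) = π / sin (π ν)`, which makes the values at `0` agree. -/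
theorem besselInt_eq_gammaSeries {ν : ℝ} (hν0 : 0 < ν) (hν1 : ν < 1) {y : ℝ} (hy : 0 < y) :
    besselInt ν y = Real.pi / Real.sin (Real.pi * ν) *
      (gammaSeries (-ν) y - y ^ ν * gammaSeries ν y) := by
  set k := Real.pi / Real.sin (Real.pi * ν) with hk
  have hkG : k = Real.Gamma ν * Real.Gamma (1 - ν) := (Real.Gamma_mul_Gamma_one_sub ν).symm
  have hG0 : Real.Gamma ν ≠ 0 := (Real.Gamma_pos_of_pos hν0).ne'
  have hG1 : Real.Gamma (1 - ν) ≠ 0 := (Real.Gamma_pos_of_pos (by linarith)).ne'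
  set E : ℝ → ℝ := fun y => besselInt ν y - k * (gammaSeries (-ν) y - y ^ ν * gammaSeries ν y)
    with hEdef
  set H : ℝ → ℝ := fun y => -besselInt (1 - ν) y -
    k * (y ^ (1 - ν) * gammaSeries (1 - ν) y - gammaSeries (ν - 1) y) with hHdef
  have hE : ∀ y, 0 < y → HasDerivAt E (y ^ (ν - 1) * H y) y := by
    intro y hy
    refine ((hasDerivAt_besselInt ν hy).sub (((hasDerivAt_gammaSeries (-ν) y).sub
      (hasDerivAt_rpow_mul_gammaSeries ν hy)).const_mul k)).congr_deriv ?_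
    have h1 := rpow_mul_besselInt_neg (ν - 1) hy
    rw [neg_sub] at h1
    have h2 : y ^ (ν - 1) * y ^ (1 - ν) = 1 := by
      rw [← Real.rpow_add hy, show ν - 1 + (1 - ν) = 0 by ring, Real.rpow_zero]
    rw [hHdef, show -ν + 1 = 1 - ν by ring]
    linear_combination h1 + k * gammaSeries (1 - ν) y * h2
  have hH : ∀ y, 0 < y → HasDerivAt H (y ^ (-ν) * E y) y := by
    intro y hy
    have h0 := hasDerivAt_rpow_mul_gammaSeries (1 - ν) hy
    have h0' := hasDerivAt_gammaSeries (ν - 1) y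
    rw [show 1 - ν - 1 = -ν by ring] at h0
    rw [sub_add_cancel] at h0'
    refine ((hasDerivAt_besselInt (1 - ν) hy).neg.sub
      ((h0.sub h0').const_mul k)).congr_deriv ?_
    have h1 := rpow_mul_besselInt_neg (-ν) hy
    rw [neg_neg] at h1
    have h2 : y ^ (-ν) * y ^ ν = 1 := by
      rw [← Real.rpow_add hy, neg_add_cancel, Real.rpow_zero]
    rw [hEdef, show 1 - ν - 1 = -ν by ring]
    linear_combination (-1 : ℝ) * h1 + (-k) * gammaSeries ν y * h2
  have hgs : ∀ a : ℝ, Tendsto (gammaSeries a : ℝ → ℝ) (𝓝[>] 0) (𝓝 (1 / Real.Gamma (a + 1))) := by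
    intro a
    have := (continuous_gammaSeries (𝕜 := ℝ) a).tendsto 0
    rw [gammaSeries_zero] at this
    exact this.mono_left nhdsWithin_le_nhds
  have hrp : ∀ a : ℝ, 0 < a → Tendsto (fun y : ℝ => y ^ a) (𝓝[>] 0) (𝓝 0) := by
    intro a ha
    have := (Real.continuous_rpow_const ha.le).tendsto 0
    rw [Real.zero_rpow ha.ne'] at this
    exact this.mono_left nhdsWithin_le_nhds
  have hE0 : Tendsto E (𝓝[>] 0) (𝓝 0) := by
    have h := (tendsto_besselInt hν0).sub
      (((hgs (-ν)).sub ((hrp ν hν0).mul (hgs ν))).const_mul k)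
    have e : Real.Gamma ν - k * (1 / Real.Gamma (-ν + 1) - 0 * (1 / Real.Gamma (ν + 1))) = 0 := by
      rw [hkG, show -ν + 1 = 1 - ν by ring]; field_simp; ring
    rwa [e] at h
  have hH0 : Tendsto H (𝓝[>] 0) (𝓝 0) := by
    have h := (tendsto_besselInt (show 0 < 1 - ν by linarith)).neg.sub
      ((((hrp (1 - ν) (by linarith)).mul (hgs (1 - ν))).sub (hgs (ν - 1))).const_mul k)
    have e : -Real.Gamma (1 - ν) - k * (0 * (1 / Real.Gamma (1 - ν + 1)) -
        1 / Real.Gamma (ν - 1 + 1)) = 0 := by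
      rw [hkG, sub_add_cancel]; field_simp; ring
    rwa [e] at h
  obtain ⟨C, hC⟩ := (isCompact_Icc (a := (0 : ℝ)) (b := y)).exists_bound_of_continuousOn
    (f := fun y : ℝ => k * (gammaSeries (-ν) y - y ^ ν * gammaSeries ν y)) (by
      have h1 := continuous_gammaSeries (𝕜 := ℝ) ν
      have h2 := continuous_gammaSeries (𝕜 := ℝ) (-ν)
      have h3 : Continuous fun y : ℝ => y ^ ν := Real.continuous_rpow_const hν0.le
      exact Continuous.continuousOn (by fun_prop))
  have := bessel_system_unique hν1 hE hH hE0 hH0 (Y := y) (m := Real.Gamma ν + C)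
    (fun z hz => by
      refine (abs_sub _ _).trans (add_le_add ?_ (hC z ⟨hz.1.le, hz.2⟩))
      rw [abs_of_nonneg (besselInt_nonneg _ _)]
      exact besselInt_le_Gamma hν0 hz.1) y ⟨hy, le_rfl⟩
  linarith [sub_eq_zero.1 this]

theorem besselI_eq_gammaSeries (ν x : ℝ) :
    besselI ν x = (x / 2) ^ ν * gammaSeries ν ((x / 2) ^ 2) := by
  rw [besselI, gammaSeries]
  congr 2
  funext l
  rw [gammaCoeff, pow_mul]
  rfl

/-- The integral representation of the modified Bessel function of the second kind. -/
theorem besselK_eq_besselInt {ν : ℝ} (hν0 : 0 < ν) (hν1 : ν < 1) {x : ℝ} (hx : 0 < x) :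
    besselK ν x = 1 / 2 * (x / 2) ^ (-ν) * besselInt ν ((x / 2) ^ 2) := by
  have hx2 : 0 < x / 2 := by positivity
  rw [besselInt_eq_gammaSeries hν0 hν1 (by positivity), besselK, besselI_eq_gammaSeries,
    besselI_eq_gammaSeries, mul_comm ν Real.pi]
  have h1 : ((x / 2) ^ 2) ^ ν = (x / 2) ^ ν * (x / 2) ^ ν := by
    rw [← Real.mul_rpow hx2.le hx2.le, sq]
  have h2 : (x / 2) ^ (-ν) * (x / 2) ^ ν = 1 := by
    rw [← Real.rpow_add hx2, neg_add_cancel, Real.rpow_zero]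
  rw [h1]
  set S := Real.sin (Real.pi * ν)
  rw [show Real.pi / (2 * S) = 1 / 2 * (Real.pi / S) by ring]
  linear_combination (1 / 2 * (Real.pi / S) * (x / 2) ^ ν * gammaSeries ν ((x / 2) ^ 2)) * h2

/-! ### Radial moments of the weights -/

/-- A Mellin transform of `besselInt`, from the Gamma integral by Fubini's theorem. -/
theorem mellin_besselInt {ν q p A : ℝ} (hp : 0 < p) (hA : 0 < A) (hq : -1 < q)
    (hνq : 0 < ν + (q + 1) / p) :
    IntegrableOn (fun x : ℝ => x ^ q * besselInt ν (A * x ^ p)) (Set.Ioi 0) ∧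
    ∫ x in Set.Ioi (0 : ℝ), x ^ q * besselInt ν (A * x ^ p) =
      A ^ (-(q + 1) / p) * (1 / p) * Real.Gamma ((q + 1) / p) * Real.Gamma (ν + (q + 1) / p) := by
  set F : ℝ → ℝ → ℝ := fun x t => x ^ q * (t ^ (ν - 1) * Real.exp (-t - A * x ^ p / t)) with hF
  have hinner : ∀ t : ℝ, 0 < t → ∀ x : ℝ,
      F x t = t ^ (ν - 1) * Real.exp (-t) * (x ^ q * Real.exp (-(A / t) * x ^ p)) := by
    intro t _ x
    rw [hF]
    have : Real.exp (-t - A * x ^ p / t) = Real.exp (-t) * Real.exp (-(A / t) * x ^ p) := by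
      rw [← Real.exp_add]; congr 1; ring
    simp only [this]; ring
  have hint : ∀ t : ℝ, 0 < t → ∫ x in Set.Ioi (0 : ℝ), F x t =
      A ^ (-(q + 1) / p) * (1 / p) * Real.Gamma ((q + 1) / p) *
        (Real.exp (-t) * t ^ (ν + (q + 1) / p - 1)) := by
    intro t ht
    simp_rw [hinner t ht]
    rw [integral_const_mul, integral_rpow_mul_exp_neg_mul_rpow hp hq (by positivity),
      Real.div_rpow hA.le ht.le, show ν + (q + 1) / p - 1 = (ν - 1) + -(-(q + 1) / p) by ring,
      Real.rpow_add ht, Real.rpow_neg ht.le]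
    ring
  have hmeas : Measurable (Function.uncurry F) := by
    simp only [hF, Function.uncurry_def]; fun_prop
  have hnn : ∀ᵐ t ∂volume.restrict (Set.Ioi (0 : ℝ)),
      ∫ x in Set.Ioi (0 : ℝ), ‖F x t‖ = ∫ x in Set.Ioi (0 : ℝ), F x t := by
    filter_upwards [ae_restrict_mem measurableSet_Ioi] with t ht
    refine setIntegral_congr_fun measurableSet_Ioi fun x hx => ?_
    have ht : 0 < t := ht
    have hx : 0 < x := hx
    exact Real.norm_of_nonneg (by simp only [hF]; positivity)
  have hprod : Integrable (Function.uncurry F)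
      ((volume.restrict (Set.Ioi (0 : ℝ))).prod (volume.restrict (Set.Ioi (0 : ℝ)))) := by
    rw [integrable_prod_iff' hmeas.aestronglyMeasurable]
    refine ⟨?_, ?_⟩
    · filter_upwards [ae_restrict_mem measurableSet_Ioi] with t ht
      have ht : 0 < t := ht
      simp only [Function.uncurry_apply_pair, hinner t ht]
      exact (integrableOn_rpow_mul_exp_neg_mul_rpow hq hp (by positivity)).const_mul _
    · refine ((Real.GammaIntegral_convergent hνq).const_mul
        (A ^ (-(q + 1) / p) * (1 / p) * Real.Gamma ((q + 1) / p))).congr ?_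
      filter_upwards [hnn, ae_restrict_mem measurableSet_Ioi] with t h1 ht
      simp only [Function.uncurry_apply_pair]
      rw [h1, hint t ht]
  have hbes : ∀ x : ℝ, x ^ q * besselInt ν (A * x ^ p) = ∫ t in Set.Ioi (0 : ℝ), F x t := by
    intro x
    rw [besselInt, ← integral_const_mul]
  simp_rw [hbes]
  refine ⟨hprod.integral_prod_left, ?_⟩
  rw [integral_integral_swap hprod, setIntegral_congr_fun measurableSet_Ioi hint,
    integral_const_mul, ← Real.Gamma_eq_integral hνq]

theorem bessel_index_mem {n r s : ℕ} (hn : r + s + 1 = n) :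
    (0 : ℝ) < (2 * s + 1) / (2 * n) ∧ ((2 * s + 1) / (2 * n) : ℝ) < 1 := by
  have h1 : (n : ℝ) = r + s + 1 := by exact_mod_cast hn.symm
  have hr : (0 : ℝ) ≤ r := Nat.cast_nonneg r
  have hs : (0 : ℝ) ≤ s := Nat.cast_nonneg s
  have hn0 : (0 : ℝ) < n := by linarith
  refine ⟨by positivity, ?_⟩
  rw [div_lt_one (by positivity)]; linarith

theorem weight_nonneg {n r s : ℕ} (hn : r + s + 1 = n) (z : ℂ) :
    0 ≤ weight n ((2 * s + 1) / (2 * n)) z := by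
  have hn1 : 1 ≤ n := by omega
  have hn0 : (1 : ℝ) ≤ n := by exact_mod_cast hn1
  have hG : 0 < Real.Gamma (1 / (2 * n)) := Real.Gamma_pos_of_pos (by positivity)
  rw [weight]
  rcases (Complex.normSq_nonneg z).eq_or_lt with h | h
  · rw [← h, Real.zero_rpow (by linarith)]; simp
  · rw [besselK_eq_besselInt (bessel_index_mem hn).1 (bessel_index_mem hn).2 (by positivity)]
    have := besselInt_nonneg ((2 * s + 1) / (2 * n)) ((Complex.normSq z ^ n / n / 2) ^ 2)
    positivity

theorem measurable_weight (n : ℕ) (ν : ℝ) : Measurable (weight n ν) := by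
  have h := fun a : ℝ => (continuous_gammaSeries (𝕜 := ℝ) a).measurable
  have h0 : Measurable Complex.normSq := Complex.continuous_normSq.measurable
  have h1 : ∀ a : ℝ, Measurable (besselI a) := fun a => by
    have : besselI a = fun x => (x / 2) ^ a * gammaSeries a ((x / 2) ^ 2) :=
      funext (besselI_eq_gammaSeries a)
    rw [this]
    have := (h a).comp (by fun_prop : Measurable fun x : ℝ => (x / 2) ^ 2)
    exact Measurable.mul (by fun_prop) this
  have h2 : Measurable (besselK ν) := ((h1 (-ν)).sub (h1 ν)).const_mul _
  exact Measurable.mul (by fun_prop) (h2.comp (by fun_prop))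

/-- The radial moments of the weights, by polar coordinates and the Mellin transform of the Bessel
function. -/
theorem moment_weight {n r s : ℕ} (hn : r + s + 1 = n) (d : ℕ) :
    Integrable (fun z : ℂ => ‖z‖ ^ (2 * d) * weight n ((2 * s + 1) / (2 * n)) z) ∧
    ∫ z : ℂ, ‖z‖ ^ (2 * d) * weight n ((2 * s + 1) / (2 * n)) z =
      (2 * n : ℝ) ^ (d / n : ℝ) * Real.Gamma ((d + n + s + 1) / (2 * n)) *
        Real.Gamma ((d + r + 1) / (2 * n)) / Real.Gamma (1 / (2 * n)) := by
  have hr : (0 : ℝ) ≤ r := Nat.cast_nonneg r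
  have hs : (0 : ℝ) ≤ s := Nat.cast_nonneg s
  have hd : (0 : ℝ) ≤ d := Nat.cast_nonneg d
  have hnr : (n : ℝ) = r + s + 1 := by exact_mod_cast hn.symm
  have hn0 : (0 : ℝ) < n := by linarith
  set N : ℝ := 2 * n with hN
  have hN0 : 0 < N := by positivity
  set ν : ℝ := (2 * s + 1) / N with hν
  set W : ℝ := 2 / (N ^ ((1 : ℝ) / N) * Real.pi * Real.Gamma (1 / N)) with hW
  set q : ℝ := 2 * d + 2 * r + 1 with hq
  set f : ℝ → ℝ := fun x => x ^ (2 * d) * (W * (x ^ 2) ^ ((n : ℝ) - 1 / 2) *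
    besselK ν ((x ^ 2) ^ n / n)) with hf
  have hfz : (fun z : ℂ => ‖z‖ ^ (2 * d) * weight n ν z) = fun z : ℂ => f ‖z‖ := by
    funext z
    rw [hf, weight, Complex.normSq_eq_norm_sq]
  have hfx : ∀ x ∈ Set.Ioi (0 : ℝ), x ^ (Module.finrank ℝ ℂ - 1) • f x =
      W * (1 / 2 * N ^ ν) * (x ^ q * besselInt ν (N ^ (-2 : ℝ) * x ^ (2 * N))) := by
    intro x hx
    have hx : 0 < x := hx
    have hXpos : 0 < (x ^ 2) ^ n / n := by positivity
    have e1 : ((x ^ 2) ^ n / n / 2) = x ^ N / N := by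
      rw [← pow_mul, ← Real.rpow_natCast, hN]; push_cast; field_simp
    have e2 : (x ^ N / N) ^ 2 = N ^ (-2 : ℝ) * x ^ (2 * N) := by
      rw [div_pow, ← Real.rpow_natCast, ← Real.rpow_mul hx.le, Real.rpow_neg hN0.le,
        Real.rpow_two, mul_comm N]
      push_cast; field_simp
    have e3 : x * x ^ (2 * d) * (x ^ 2) ^ ((n : ℝ) - 1 / 2) * (x ^ N) ^ (-ν) = x ^ q := by
      rw [← Real.rpow_natCast x (2 * d), ← Real.rpow_natCast x 2, ← Real.rpow_mul hx.le,
        ← Real.rpow_mul hx.le]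
      nth_rewrite 1 [← Real.rpow_one x]
      rw [← Real.rpow_add hx, ← Real.rpow_add hx, ← Real.rpow_add hx]
      congr 1
      have : N * -ν = -(2 * s + 1) := by rw [hν]; field_simp
      rw [this, hq]; push_cast; rw [hnr]; ring
    rw [Complex.finrank_real_complex, smul_eq_mul, hf]
    simp only
    rw [besselK_eq_besselInt (ν := ν) (bessel_index_mem hn).1 (bessel_index_mem hn).2 hXpos, e1, e2,
      ← e3, Real.div_rpow (by positivity) hN0.le, Real.rpow_neg hN0.le, div_inv_eq_mul]
    ring
  have hκ : (q + 1) / (2 * N) = (d + r + 1) / N := by rw [hq]; field_simp; ring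
  have hνκ : ν + (d + r + 1) / N = (d + n + s + 1) / N := by
    rw [hν, ← add_div, hnr]; ring
  have hM := mellin_besselInt (ν := ν) (q := q) (p := 2 * N) (A := N ^ (-2 : ℝ)) (by positivity)
    (by positivity) (by rw [hq]; linarith) (by rw [hκ, hνκ]; positivity)
  rw [neg_div, hκ, hνκ] at hM
  rw [hfz]
  refine ⟨?_, ?_⟩
  · rw [integrable_fun_norm_addHaar volume (f := f)]
    exact IntegrableOn.congr_fun (hM.1.const_mul _) (fun x hx => (hfx x hx).symm)
      measurableSet_Ioi
  · rw [integral_fun_norm_addHaar volume f, setIntegral_congr_fun measurableSet_Ioi hfx,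
      integral_const_mul, hM.2, Complex.finrank_real_complex]
    have hvol : volume.real (Metric.ball (0 : ℂ) 1) = Real.pi := by
      rw [Measure.real, Complex.volume_ball]; simp
    rw [hvol, hW, ← Real.rpow_mul hN0.le]
    have hG : Real.Gamma (1 / N) ≠ 0 := (Real.Gamma_pos_of_pos (by positivity)).ne'
    have hpow : N ^ ν * N ^ ((-2 : ℝ) * -((d + r + 1) / N)) =
        N * N ^ ((1 : ℝ) / N) * N ^ (d / n : ℝ) := by
      have h1 : N * N ^ ((1 : ℝ) / N) * N ^ (d / n : ℝ) = N ^ (1 + 1 / N + d / n : ℝ) := by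
        rw [Real.rpow_add hN0, Real.rpow_add hN0, Real.rpow_one]
      rw [h1, ← Real.rpow_add hN0]
      congr 1
      rw [hν, hN, hnr]; field_simp; ring
    have hp1 : N ^ ((1 : ℝ) / N) ≠ 0 := by positivity
    have hpi := Real.pi_ne_zero
    rw [nsmul_eq_mul, smul_eq_mul]
    calc _ = N ^ ν * N ^ ((-2 : ℝ) * -((d + r + 1) / N)) *
          (1 / (N * N ^ ((1 : ℝ) / N)) * Real.Gamma ((d + n + s + 1) / N) *
          Real.Gamma ((d + r + 1) / N) / Real.Gamma (1 / N)) := by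
            push_cast; field_simp
      _ = _ := by rw [hpow]; field_simp

/-! ### The holomorphic basis functions -/

/-- The coefficient of the `l`-th holomorphic basis function of the `(r, s)` sector: the inverse
square root of the radial moment of `z ^ expo n r s l`. -/
def holCoef (n r s l : ℕ) : ℝ :=
  Real.sqrt (Real.Gamma (1 / (2 * n)) / ((2 * n : ℝ) ^ (expo n r s l / n : ℝ) *
    Real.Gamma ((expo n r s l + n + s + 1) / (2 * n)) *
    Real.Gamma ((expo n r s l + r + 1) / (2 * n))))

/-- The `l`-th holomorphic basis function of the `(r, s)` sector. -/
def hol (n r s l : ℕ) (z : ℂ) : ℂ := (holCoef n r s l : ℂ) * z ^ expo n r s l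

theorem holCoef_pos {n : ℕ} (hn : 1 ≤ n) (r s l : ℕ) : 0 < holCoef n r s l := by
  have hn0 : (0 : ℝ) < n := by exact_mod_cast hn
  have h1 : 0 < Real.Gamma (1 / (2 * n)) := Real.Gamma_pos_of_pos (by positivity)
  have h2 : 0 < Real.Gamma ((expo n r s l + n + s + 1) / (2 * n)) :=
    Real.Gamma_pos_of_pos (by positivity)
  have h3 : 0 < Real.Gamma ((expo n r s l + r + 1) / (2 * n)) :=
    Real.Gamma_pos_of_pos (by positivity)
  exact Real.sqrt_pos.2 (by positivity)

/-- The functional equation of the Gamma function turns the quotient of consecutive normalizations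
into the matrix element of the operators on `L²(ℝ)`. -/
theorem rung_mul_holCoef_succ {n r s : ℕ} (hn : r + s + 1 = n) (l : ℕ) :
    rung n r s l * holCoef n r s (l + 1) = holCoef n s r l := by
  have hnr : (n : ℝ) = r + s + 1 := by exact_mod_cast hn.symm
  have hn0 : (0 : ℝ) < n := by rw [hnr]; positivity
  rw [rung, holCoef, holCoef, ← Real.sqrt_mul (rungSq_pos n r s l hn).le]
  congr 1
  have hD : ((expo n r s (l + 1) : ℕ) : ℝ) = expo n s r l + n := by simp [expo]
  rw [hD, rungSq]
  set D : ℝ := ((expo n s r l : ℕ) : ℝ)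
  have hD0 : 0 ≤ D := Nat.cast_nonneg _
  have h1 : (D + n + n + s + 1) / (2 * n) = (D + s + 1) / (2 * n) + 1 := by field_simp; ring
  have h2 : ((D + n) / n : ℝ) = D / n + 1 := by field_simp
  have h3 : (D + s + 1) / (2 * n) ≠ 0 := by positivity
  have h4 : 0 < Real.Gamma ((D + s + 1) / (2 * n)) := Real.Gamma_pos_of_pos (by positivity)
  have h5 : 0 < Real.Gamma ((D + n + r + 1) / (2 * n)) := Real.Gamma_pos_of_pos (by positivity)
  have h6 : D + n - r = D + s + 1 := by rw [hnr]; ring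
  rw [h1, Real.Gamma_add_one h3, h2, Real.rpow_add (by positivity), Real.rpow_one, h6]
  field_simp

theorem pow_mul_hol {n r s : ℕ} (hn : r + s + 1 = n) (l : ℕ) (z : ℂ) :
    z ^ n * hol n s r l z = (rung n r s l : ℂ) * hol n r s (l + 1) z := by
  rw [hol, hol, ← rung_mul_holCoef_succ hn, expo, pow_add]
  push_cast; ring

theorem expo_two_mul (n r s k : ℕ) :
    expo n r s (2 * k) = 2 * n * k + r ∧ expo n r s (2 * k + 1) = 2 * n * k + s + n := by
  induction k generalizing r s with
  | zero => simp [expo]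
  | succ k ih =>
    have h1 : expo n r s (2 * (k + 1)) = 2 * n * (k + 1) + r := by
      rw [mul_add, mul_one, expo, (ih s r).2]; ring
    have h2 : expo n s r (2 * (k + 1)) = 2 * n * (k + 1) + s := by
      rw [mul_add, mul_one, expo, (ih r s).2]; ring
    exact ⟨h1, by rw [expo, h2]⟩

theorem strictMono_expo {n r s : ℕ} (hn : r + s + 1 = n) : StrictMono (expo n r s) := by
  refine strictMono_nat_of_lt_succ fun l => ?_
  rcases Nat.even_or_odd' l with ⟨k, rfl | rfl⟩
  · rw [(expo_two_mul n r s k).1, (expo_two_mul n r s k).2]; omega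
  · rw [(expo_two_mul n r s k).2, show 2 * k + 1 + 1 = 2 * (k + 1) by ring,
      (expo_two_mul n r s (k + 1)).1, mul_add]
    omega

theorem e_eq_hol {n : ℕ} (hn : 1 ≤ n) (l : ℕ) : e n l = hol n 0 (n - 1) l := by
  have hn0 : (0 : ℝ) < n := by exact_mod_cast hn
  have hN0 : (0 : ℝ) < 2 * n := by positivity
  have hs : ((n - 1 : ℕ) : ℝ) = n - 1 := by rw [Nat.cast_sub hn]; simp
  funext z
  rcases Nat.even_or_odd' l with ⟨k, rfl | rfl⟩
  · rw [e, hol, holCoef, (expo_two_mul n 0 (n - 1) k).1]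
    simp only [even_two_mul, if_true, Nat.mul_div_cancel_left _ two_pos, hs]
    have a1 : ((2 * n * k + 0 : ℕ) + n + (n - 1) + 1) / (2 * n) = (k : ℝ) + 1 := by
      push_cast; field_simp; ring
    have a2 : ((2 * n * k + 0 : ℕ) + (0 : ℕ) + 1) / (2 * n) = (k : ℝ) + 1 / (2 * n) := by
      push_cast; field_simp; ring
    have a3 : (((2 * n * k + 0 : ℕ) : ℝ) / n) = (2 * k : ℕ) := by
      push_cast; field_simp; ring
    rw [a1, a2, a3, Real.Gamma_nat_eq_factorial, Real.rpow_natCast, add_zero, mul_right_comm]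
  · have hne : ¬ Even (2 * k + 1) := by simp
    have hdiv : (2 * k + 1) / 2 = k := by omega
    rw [e, hol, holCoef, (expo_two_mul n 0 (n - 1) k).2]
    simp only [hne, if_false, hdiv, hs]
    have a0 : 2 * n * k + (n - 1) + n = 2 * n * k + 2 * n - 1 := by omega
    have a0' : ((2 * n * k + (n - 1) + n : ℕ) : ℝ) = 2 * n * k + 2 * n - 1 := by
      push_cast; rw [hs]; ring
    have a1 : ((2 * n * k + 2 * n - 1 : ℝ) + n + (n - 1) + 1) / (2 * n) =
        (k : ℝ) + 2 - 1 / (2 * n) := by field_simp; ring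
    have a2 : ((2 * n * k + 2 * n - 1 : ℝ) + (0 : ℕ) + 1) / (2 * n) = (k : ℝ) + 1 := by
      push_cast; field_simp; ring
    have a3 : (((2 * n * k + 2 * n - 1 : ℝ) : ℝ) / n) = 2 * k + 2 - 1 / n := by
      field_simp
    rw [a0', a1, a2, a3, Real.Gamma_nat_eq_factorial, a0]

theorem eTilde_eq_hol {n : ℕ} (hn : 1 ≤ n) (l : ℕ) : eTilde n l = hol n (n - 1) 0 l := by
  have hn0 : (0 : ℝ) < n := by exact_mod_cast hn
  have hN0 : (0 : ℝ) < 2 * n := by positivity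
  have hs : ((n - 1 : ℕ) : ℝ) = n - 1 := by rw [Nat.cast_sub hn]; simp
  funext z
  rcases Nat.even_or_odd' l with ⟨k, rfl | rfl⟩
  · rw [eTilde, hol, holCoef, (expo_two_mul n (n - 1) 0 k).1]
    simp only [even_two_mul, if_true, Nat.mul_div_cancel_left _ two_pos, hs]
    have a0 : 2 * n * k + (n - 1) = 2 * n * k + n - 1 := by omega
    have a0' : ((2 * n * k + (n - 1) : ℕ) : ℝ) = 2 * n * k + n - 1 := by
      push_cast; rw [hs]; ring
    have a1 : ((2 * n * k + n - 1 : ℝ) + n + (0 : ℕ) + 1) / (2 * n) = (k : ℝ) + 1 := by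
      push_cast; field_simp; ring
    have a2 : ((2 * n * k + n - 1 : ℝ) + (n - 1) + 1) / (2 * n) = (k : ℝ) + 1 - 1 / (2 * n) := by
      field_simp; ring
    have a3 : ((2 * n * k + n - 1 : ℝ) / n) = 2 * k + 1 - 1 / n := by field_simp
    rw [a0', a1, a2, a3, Real.Gamma_nat_eq_factorial, a0, mul_right_comm]
  · have hne : ¬ Even (2 * k + 1) := by simp
    have hdiv : (2 * k + 1) / 2 = k := by omega
    rw [eTilde, hol, holCoef, (expo_two_mul n (n - 1) 0 k).2]
    simp only [hne, if_false, hdiv, hs]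
    have a1 : ((2 * n * k + 0 + n : ℕ) + n + (0 : ℕ) + 1) / (2 * n) =
        (k : ℝ) + 1 + 1 / (2 * n) := by push_cast; field_simp; ring
    have a2 : ((2 * n * k + 0 + n : ℕ) + (n - 1) + 1) / (2 * n) = (k : ℝ) + 1 := by
      push_cast; field_simp; ring
    have a3 : (((2 * n * k + 0 + n : ℕ) : ℝ) / n) = (2 * k + 1 : ℕ) := by
      push_cast; field_simp; ring
    rw [a1, a2, a3, Real.Gamma_nat_eq_factorial, Real.rpow_natCast, add_zero]

/-! ### The weighted inner product of power series -/

/-- The weight of the `(r, s)` sector, `r + s + 1 = n`; the Bessel index depends on `s` only, and is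
`1 - 1 / (2 * n)` for `s = n - 1` and `1 / (2 * n)` for `s = 0`. -/
def sectorWeight (n s : ℕ) (z : ℂ) : ℝ := weight n ((2 * s + 1) / (2 * n)) z

/-- Monomials of different degrees are orthogonal for a rotation invariant weight: the rotation by
the angle `π / (a - b)` changes the sign of the integrand. -/
theorem integral_pow_mul_conj_pow_of_ne {w : ℂ → ℝ} (hw : ∀ (u : Circle) z, w (u * z) = w z)
    {a b : ℕ} (hab : a ≠ b) :
    ∫ z : ℂ, z ^ a * (starRingEnd ℂ) (z ^ b) * (w z : ℂ) = 0 := by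
  have hne : ((a : ℝ) - b) ≠ 0 := sub_ne_zero.2 (by exact_mod_cast hab)
  set u : Circle := Circle.exp (Real.pi / ((a : ℝ) - b)) with hu
  have hrot : (u : ℂ) ^ a * (starRingEnd ℂ) ((u : ℂ) ^ b) = -1 := by
    rw [← Circle.coe_pow, ← Circle.coe_pow, ← Circle.coe_inv_eq_conj, ← Circle.coe_mul, hu,
      ← Circle.exp_nsmul, ← Circle.exp_nsmul, ← Circle.exp_neg, ← Circle.exp_add,
      Circle.coe_exp]
    have : ((a • (Real.pi / ((a : ℝ) - b)) + -(b • (Real.pi / ((a : ℝ) - b))) : ℝ) : ℂ) =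
        Real.pi := by
      rw [← Complex.ofReal_inj.2 (show a • (Real.pi / ((a : ℝ) - b)) +
        -(b • (Real.pi / ((a : ℝ) - b))) = Real.pi by
          simp only [nsmul_eq_mul]; field_simp; ring)]
    rw [this, Complex.exp_pi_mul_I]
  have h := (rotation u).measurePreserving.integral_comp (rotation u).toHomeomorph.measurableEmbedding
    (fun z : ℂ => z ^ a * (starRingEnd ℂ) (z ^ b) * (w z : ℂ))
  have h2 : ∀ z : ℂ, (rotation u z) ^ a * (starRingEnd ℂ) ((rotation u z) ^ b) *
      (w (rotation u z) : ℂ) = -(z ^ a * (starRingEnd ℂ) (z ^ b) * (w z : ℂ)) := by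
    intro z
    rw [rotation_apply, hw, mul_pow, mul_pow, map_mul]
    linear_combination (z ^ a * (starRingEnd ℂ) (z ^ b) * (w z : ℂ)) * hrot
  simp_rw [h2, integral_neg] at h
  exact self_eq_neg.1 h.symm

theorem sectorWeight_rotate (n s : ℕ) (u : Circle) (z : ℂ) :
    sectorWeight n s (u * z) = sectorWeight n s z := by
  simp [sectorWeight, weight, Complex.normSq_mul]

theorem integral_hol_mul_conj {n r s : ℕ} (hn : r + s + 1 = n) (l m : ℕ) :
    ∫ z : ℂ, innerIntegrand (sectorWeight n s) (hol n r s l) (hol n r s m) z =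
      if l = m then 1 else 0 := by
  have hn1 : 1 ≤ n := by omega
  have h1 : ∀ z : ℂ, innerIntegrand (sectorWeight n s) (hol n r s l) (hol n r s m) z =
      ((holCoef n r s l * holCoef n r s m : ℝ) : ℂ) * (z ^ expo n r s l *
        (starRingEnd ℂ) (z ^ expo n r s m) * (sectorWeight n s z : ℂ)) := by
    intro z
    simp only [innerIntegrand, hol, map_mul, Complex.conj_ofReal]
    push_cast; ring
  simp_rw [h1]
  rw [integral_const_mul]
  split_ifs with hlm
  · subst hlm
    have h2 : ∀ z : ℂ, z ^ expo n r s l * (starRingEnd ℂ) (z ^ expo n r s l) *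
        (sectorWeight n s z : ℂ) =
        ((‖z‖ ^ (2 * expo n r s l) * weight n ((2 * s + 1) / (2 * n)) z : ℝ) : ℂ) := by
      intro z
      rw [Complex.mul_conj, Complex.normSq_eq_norm_sq, norm_pow, ← pow_mul, mul_comm _ 2,
        sectorWeight]
      push_cast; ring
    have hn0 : (0 : ℝ) < n := by exact_mod_cast hn1
    have g1 : 0 < Real.Gamma (1 / (2 * n)) := Real.Gamma_pos_of_pos (by positivity)
    have g2 : 0 < Real.Gamma ((expo n r s l + n + s + 1) / (2 * n)) :=
      Real.Gamma_pos_of_pos (by positivity)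
    have g3 : 0 < Real.Gamma ((expo n r s l + r + 1) / (2 * n)) :=
      Real.Gamma_pos_of_pos (by positivity)
    simp_rw [h2]
    rw [integral_complex_ofReal, (moment_weight hn _).2, ← Complex.ofReal_mul, holCoef,
      Real.mul_self_sqrt (by positivity), ← Complex.ofReal_one]
    congr 1
    field_simp
  · rw [integral_pow_mul_conj_pow_of_ne (sectorWeight_rotate n s)
      ((strictMono_expo hn).injective.ne hlm), mul_zero]

theorem memLp_sqrt_mul_hol {n r s : ℕ} (hn : r + s + 1 = n) (l : ℕ) :
    MemLp (fun z : ℂ => (Real.sqrt (sectorWeight n s z) : ℂ) * hol n r s l z) 2 volume := by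
  have hm : Measurable (fun z : ℂ => (Real.sqrt (sectorWeight n s z) : ℂ) * hol n r s l z) := by
    have h1 : Measurable (sectorWeight n s) := measurable_weight n _
    have h2 : Measurable (hol n r s l) := by
      unfold hol; fun_prop
    fun_prop
  rw [memLp_two_iff_integrable_sq_norm hm.aestronglyMeasurable]
  refine ((moment_weight hn (expo n r s l)).1.const_mul (holCoef n r s l ^ 2)).congr
    (Eventually.of_forall fun z => ?_)
  have h0 : 0 ≤ sectorWeight n s z := weight_nonneg hn z
  have h1 : weight n ((2 * s + 1) / (2 * n)) z = sectorWeight n s z := rfl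
  simp only
  rw [norm_mul, mul_pow, Complex.norm_real, Real.norm_of_nonneg (Real.sqrt_nonneg _),
    Real.sq_sqrt h0, hol, norm_mul, Complex.norm_real,
    Real.norm_of_nonneg (holCoef_pos (show 1 ≤ n by omega) r s l).le, norm_pow, h1]
  ring

/-- The holomorphic basis function, times the square root of the weight, as an element of
`L²(ℂ)`. -/
def holLp {n r s : ℕ} (hn : r + s + 1 = n) (l : ℕ) : Lp ℂ 2 (volume : Measure ℂ) :=
  (memLp_sqrt_mul_hol hn l).toLp

theorem inner_of_coeFn {n r s : ℕ} (hn : r + s + 1 = n) {F G : ℂ → ℂ}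
    {f g : Lp ℂ 2 (volume : Measure ℂ)}
    (hf : ∀ᵐ z : ℂ, f z = (Real.sqrt (sectorWeight n s z) : ℂ) * F z)
    (hg : ∀ᵐ z : ℂ, g z = (Real.sqrt (sectorWeight n s z) : ℂ) * G z) :
    Integrable (innerIntegrand (sectorWeight n s) F G) ∧
      ∫ z, innerIntegrand (sectorWeight n s) F G z = inner ℂ g f := by
  have h : (fun z => inner ℂ (g z) (f z)) =ᵐ[volume] innerIntegrand (sectorWeight n s) F G := by
    filter_upwards [hf, hg] with z e1 e2
    have h0 : 0 ≤ sectorWeight n s z := weight_nonneg hn z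
    have h1 : (Real.sqrt (sectorWeight n s z) : ℂ) * Real.sqrt (sectorWeight n s z) =
        sectorWeight n s z := by
      rw [← Complex.ofReal_mul, Real.mul_self_sqrt h0]
    rw [e1, e2, RCLike.inner_apply, innerIntegrand, map_mul, Complex.conj_ofReal]
    linear_combination (F z * (starRingEnd ℂ) (G z)) * h1
  exact ⟨(L2.integrable_inner (𝕜 := ℂ) g f).congr h, by rw [L2.inner_def, integral_congr_ae h]⟩

theorem orthonormal_holLp {n r s : ℕ} (hn : r + s + 1 = n) : Orthonormal ℂ (holLp hn) := by
  rw [orthonormal_iff_ite]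
  intro l m
  have h := (inner_of_coeFn hn (memLp_sqrt_mul_hol hn m).coeFn_toLp
    (memLp_sqrt_mul_hol hn l).coeFn_toLp).2
  rw [integral_hol_mul_conj hn] at h
  rw [holLp, holLp, ← h]
  simp only [eq_comm]

/-- Convergence in `L²` and pointwise convergence of a series yield the same function, because the
partial sums converge to the `L²` limit almost everywhere along a subsequence. -/
theorem coeFn_linearIsometry {n r s : ℕ} (hn : r + s + 1 = n) {c : lp (fun _ : ℕ => ℂ) 2}
    {F : ℂ → ℂ} (hF : ∀ z, HasSum (fun l => c l * hol n r s l z) (F z)) :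
    ∀ᵐ z : ℂ, (orthonormal_holLp hn).orthogonalFamily.linearIsometry c z =
      (Real.sqrt (sectorWeight n s z) : ℂ) * F z := by
  have h := ((orthonormal_holLp hn).orthogonalFamily.hasSum_linearIsometry c).tendsto_sum_nat
  obtain ⟨ns, hns, h1⟩ := (tendstoInMeasure_of_tendsto_Lp h).exists_seq_tendsto_ae
  have h2 : ∀ N : ℕ, ∀ᵐ z : ℂ, (∑ l ∈ Finset.range N,
      LinearIsometry.toSpanSingleton ℂ _ ((orthonormal_holLp hn).1 l) (c l) :
        Lp ℂ 2 (volume : Measure ℂ)) z =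
      (Real.sqrt (sectorWeight n s z) : ℂ) * ∑ l ∈ Finset.range N, c l * hol n r s l z := by
    intro N
    have h3 := ae_all_iff.2 fun l => Lp.coeFn_smul (c l) (holLp hn l)
    have h4 := ae_all_iff.2 fun l => (memLp_sqrt_mul_hol hn l).coeFn_toLp
    filter_upwards [Lp.coeFn_finsetSum (Finset.range N) fun l =>
      LinearIsometry.toSpanSingleton ℂ _ ((orthonormal_holLp hn).1 l) (c l), h3, h4] with z e1 e2 e3
    rw [e1, Finset.sum_apply, Finset.mul_sum]
    refine Finset.sum_congr rfl fun l _ => ?_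
    rw [LinearIsometry.toSpanSingleton_apply, e2 l, Pi.smul_apply, holLp, e3 l, smul_eq_mul]
    ring
  filter_upwards [h1, ae_all_iff.2 h2] with z e1 e2
  refine tendsto_nhds_unique e1 ?_
  simp_rw [e2]
  exact (((hF z).tendsto_sum_nat).comp hns.tendsto_atTop).const_mul _

/-- The weighted inner product of two series is the `ℓ²` inner product of their coefficients. -/
theorem inner_of_hasSum {n r s : ℕ} (hn : r + s + 1 = n) {c d : lp (fun _ : ℕ => ℂ) 2}
    {F G : ℂ → ℂ} (hF : ∀ z, HasSum (fun l => c l * hol n r s l z) (F z))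
    (hG : ∀ z, HasSum (fun l => d l * hol n r s l z) (G z)) :
    Integrable (innerIntegrand (sectorWeight n s) F G) ∧
      ∫ z, innerIntegrand (sectorWeight n s) F G z = inner ℂ d c := by
  have h := inner_of_coeFn hn (coeFn_linearIsometry hn hF) (coeFn_linearIsometry hn hG)
  rwa [LinearIsometry.inner_map_map] at h

/-! ### The kernels -/

theorem summable_inv_Gamma (a : ℝ) {R : ℝ} (hR : 0 ≤ R) :
    Summable fun k : ℕ => |1 / Real.Gamma (k + a + 1)| * R ^ k := by
  refine summable_of_ratio_norm_eventually_le (r := 1 / 2) (by norm_num) ?_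
  obtain ⟨N, hN⟩ := exists_nat_ge (2 * R + |a|)
  filter_upwards [eventually_ge_atTop N] with k hk
  have hk' : (N : ℝ) ≤ k := by exact_mod_cast hk
  have ha := neg_abs_le a
  have h1 : 2 * R ≤ k + a + 1 := by linarith
  have h1' : 0 < (k : ℝ) + a + 1 := by linarith [abs_nonneg a]
  have hG : 0 < Real.Gamma (k + a + 1) := Real.Gamma_pos_of_pos h1'
  have h2 : ((k + 1 : ℕ) : ℝ) + a + 1 = (k + a + 1) + 1 := by push_cast; ring
  rw [Real.norm_of_nonneg (by positivity), Real.norm_of_nonneg (by positivity), h2,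
    Real.Gamma_add_one h1'.ne', abs_of_pos (by positivity), abs_of_pos (by positivity), pow_succ]
  have h3 : R / (k + a + 1) ≤ 1 / 2 := by rw [div_le_iff₀ h1']; linarith
  calc 1 / ((k + a + 1) * Real.Gamma (k + a + 1)) * (R ^ k * R)
      = R / (k + a + 1) * (1 / Real.Gamma (k + a + 1) * R ^ k) := by field_simp
    _ ≤ _ := by gcongr

/-- The series `gammaSeries a` is of exponential type zero, since `1 / Γ` decays faster than any
geometric sequence. -/
theorem exists_norm_gammaSeries_le (a : ℝ) {R : ℝ} (hR : 0 < R) :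
    ∃ C : ℝ, 0 ≤ C ∧ ∀ w : ℂ, ‖gammaSeries a w‖ ≤ C * Real.exp (‖w‖ / R) := by
  have hs := summable_inv_Gamma a hR.le
  set C := ∑' k : ℕ, |1 / Real.Gamma (k + a + 1)| * R ^ k
  have hC : ∀ k : ℕ, |1 / Real.Gamma (k + a + 1)| * R ^ k ≤ C := fun k =>
    hs.le_tsum k fun j _ => by positivity
  refine ⟨C, (by positivity : (0 : ℝ) ≤ _).trans (hC 0), fun w => ?_⟩
  have hexp : HasSum (fun k : ℕ => C * ((‖w‖ / R) ^ k / k.factorial))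
      (C * Real.exp (‖w‖ / R)) := by
    rw [Real.exp_eq_exp_ℝ]
    exact (NormedSpace.expSeries_div_hasSum_exp (‖w‖ / R)).mul_left C
  rw [← (hasSum_gammaSeries a w).tsum_eq]
  refine tsum_of_norm_bounded hexp fun k => ?_
  have h1 : |gammaCoeff a k| = |1 / Real.Gamma (k + a + 1)| / k.factorial := by
    rw [gammaCoeff, ← div_div, abs_div, Nat.abs_cast]
  rw [norm_mul, norm_pow]
  have h2 : ‖((gammaCoeff a k : ℝ) : ℂ)‖ = |gammaCoeff a k| := by
    rw [Complex.norm_real, Real.norm_eq_abs]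
  have h3 : |1 / Real.Gamma (k + a + 1)| ≤ C / R ^ k := by
    rw [le_div_iff₀ (by positivity)]; exact hC k
  calc _ = |1 / Real.Gamma (k + a + 1)| / k.factorial * ‖w‖ ^ k := by
        rw [← h1, ← h2]; rfl
    _ ≤ C / R ^ k / k.factorial * ‖w‖ ^ k := by gcongr
    _ = _ := by rw [div_pow]; field_simp

/-- The argument of the series is of the order of `x ^ (2 * n)`, so that exponential type zero is
what keeps the kernel below the Gaussian for every `z`. -/
theorem tame_pow_mul_gammaSeries {n : ℕ} (hn : 1 ≤ n) (a : ℝ) (m : ℕ) (z : ℂ) :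
    Tame n (fun x : ℝ => (x : ℂ) ^ m * gammaSeries a ((z * x) ^ (2 * n) / (2 * n ^ 2))) := by
  have hn0 : (0 : ℝ) < n := by exact_mod_cast hn
  obtain ⟨-, D, hD⟩ := tame_pow n hn (2 * m)
  -- the type `1 / (8 * n * B)` leaves half of the admissible exponent to the factor `x ^ m`
  set B := ‖z‖ ^ (2 * n) / (2 * n ^ 2) + 1
  have hB : 0 < B := by positivity
  have hzB : ‖z‖ ^ (2 * n) / (2 * n ^ 2) ≤ B := by simp [B]
  obtain ⟨C, hC0, hC⟩ := exists_norm_gammaSeries_le a (R := 8 * n * B) (by positivity)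
  refine ⟨?_, Real.sqrt D * C, fun x => ?_⟩
  · have := (continuous_gammaSeries (𝕜 := ℂ) a).comp
      (by fun_prop : Continuous fun x : ℝ => (z * x) ^ (2 * n) / (2 * n ^ 2 : ℂ))
    exact Continuous.mul (by fun_prop) this
  have hx0 : 0 ≤ x ^ (2 * n) := (even_two_mul n).pow_nonneg x
  have h1 : ‖(x : ℂ) ^ m‖ ≤ Real.sqrt D * Real.exp (x ^ (2 * n) / (8 * n)) := by
    have h := Real.sqrt_le_sqrt (hD x)
    rw [norm_pow, mul_comm 2 m, pow_mul, ← norm_pow, Real.sqrt_sq (norm_nonneg _),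
      Real.sqrt_mul' _ (Real.exp_pos _).le, ← Real.exp_half] at h
    rwa [show x ^ (2 * n) / (8 * n) = x ^ (2 * n) / (4 * n) / 2 by ring]
  have h2 : ‖gammaSeries a ((z * x) ^ (2 * n) / (2 * n ^ 2 : ℂ))‖ ≤
      C * Real.exp (x ^ (2 * n) / (8 * n)) := by
    refine (hC _).trans (mul_le_mul_of_nonneg_left (Real.exp_le_exp.2 ?_) hC0)
    have e : ‖(z * x) ^ (2 * n) / (2 * n ^ 2 : ℂ)‖ =
        ‖z‖ ^ (2 * n) / (2 * n ^ 2) * x ^ (2 * n) := by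
      rw [norm_div, norm_pow, norm_mul, Complex.norm_real, Real.norm_eq_abs, mul_pow,
        (even_two_mul n).pow_abs]
      simp only [norm_mul, Complex.norm_ofNat, norm_pow, Complex.norm_natCast]; ring
    rw [e, div_le_iff₀ (by positivity)]
    calc ‖z‖ ^ (2 * n) / (2 * n ^ 2) * x ^ (2 * n) ≤ B * x ^ (2 * n) := by gcongr
      _ = _ := by field_simp
  rw [norm_mul]
  calc _ ≤ (Real.sqrt D * Real.exp (x ^ (2 * n) / (8 * n))) *
        (C * Real.exp (x ^ (2 * n) / (8 * n))) := by gcongr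
    _ = Real.sqrt D * C * (Real.exp (x ^ (2 * n) / (8 * n)) *
        Real.exp (x ^ (2 * n) / (8 * n))) := by ring
    _ = _ := by
        rw [← Real.exp_add]; congr 2; ring

/-- The constants `α` (for `r = 0`) and `β` (for `r = n - 1`) of the kernels. -/
def kerConst (n r : ℕ) : ℝ :=
  Real.sqrt (Real.Gamma (1 / (2 * n))) * (2 * n : ℝ) ^ (-(r / (2 * n)) : ℝ) *
    (n : ℝ) ^ ((1 : ℝ) / 2 - (2 * r + 1) / (4 * n))

/-- The entire function of `z x` in the kernel of the `(r, s)` sector. -/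
def kerSeries (n r s : ℕ) (y : ℂ) : ℂ :=
  (kerConst n r : ℂ) * gammaSeries ((2 * r + 1) / (2 * n) - 1) (y ^ (2 * n) / (2 * n ^ 2)) +
    (kerConst n s / (Real.sqrt 2 * n) : ℝ) * y ^ (2 * s + 1) *
      gammaSeries ((2 * s + 1) / (2 * n)) (y ^ (2 * n) / (2 * n ^ 2))

/-- The kernel of the Segal-Bargmann transform of the `(r, s)` sector. -/
def ker (n r s : ℕ) (z : ℂ) (x : ℝ) : ℂ :=
  Complex.exp (-(z ^ (2 * n) / (2 * n))) * ((z * x) ^ r * kerSeries n r s (z * x)) * (wexp n x : ℂ)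

theorem ofReal_wexp (n : ℕ) (x : ℝ) :
    (wexp n x : ℂ) = Complex.exp (-((x : ℂ) ^ (2 * n) / (2 * n))) := by
  rw [wexp]; push_cast; rfl

theorem zeroFOne_eq {b : ℝ} (hb : 0 < b) (w : ℂ) :
    zeroFOne b w = (Real.Gamma b : ℂ) * gammaSeries (b - 1) w := by
  rw [zeroFOne, gammaSeries, ← tsum_mul_left]
  congr 1
  funext k
  have hne : ∀ k : ℕ, (b : ℂ) ≠ -k := by
    intro k h
    have h2 : b = -(k : ℝ) := by exact_mod_cast h
    have : (0 : ℝ) ≤ k := Nat.cast_nonneg k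
    linarith
  rw [← Complex.Gamma_add_nat_div_Gamma_eq _ hne, gammaCoeff,
    show (k : ℝ) + (b - 1) + 1 = b + k by ring]
  have h1 : (Real.Gamma b : ℂ) ≠ 0 := by exact_mod_cast (Real.Gamma_pos_of_pos hb).ne'
  have h2 : (Real.Gamma (b + k) : ℂ) ≠ 0 := by
    exact_mod_cast (Real.Gamma_pos_of_pos (by positivity)).ne'
  have h3 : Complex.Gamma (b + k) = (Real.Gamma (b + k) : ℂ) := by
    rw [← Complex.Gamma_ofReal]; push_cast; rfl
  rw [h3, Complex.Gamma_ofReal]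
  have h4 : (k.factorial : ℂ) ≠ 0 := by exact_mod_cast k.factorial_ne_zero
  simp only [RCLike.ofReal_eq_complex_ofReal]
  push_cast at h2 ⊢
  generalize (Real.Gamma (b + k) : ℂ) = g at *
  field_simp

theorem kerConst_zero (n : ℕ) : kerConst n 0 = alpha n := by
  rw [kerConst, alpha]
  simp [mul_comm]

theorem kerConst_sub_one {n : ℕ} (hn : 1 ≤ n) : kerConst n (n - 1) = beta n := by
  have hn0 : (0 : ℝ) < n := by exact_mod_cast hn
  rw [kerConst, beta, Nat.cast_sub hn, Real.mul_rpow two_pos.le hn0.le]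
  have h1 : (-(((n : ℝ) - (1 : ℕ)) / (2 * n)) : ℝ) = -(1 : ℝ) / 2 + 1 / (2 * n) := by
    push_cast; field_simp; ring
  have h2 : (n : ℝ) ^ (-(1 : ℝ) / 2 + 3 / (4 * n)) = (n : ℝ) ^ (-(1 : ℝ) / 2 + 1 / (2 * n)) *
      (n : ℝ) ^ ((1 : ℝ) / 2 - (2 * ((n : ℝ) - (1 : ℕ)) + 1) / (4 * n)) := by
    rw [← Real.rpow_add hn0]
    congr 1
    push_cast; field_simp; ring
  rw [h1, h2]; ring

theorem index_zero (n : ℕ) : ((2 * (0 : ℕ) + 1) / (2 * n) : ℝ) = 1 / (2 * n) := by simp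

theorem index_sub_one {n : ℕ} (hn : 1 ≤ n) :
    ((2 * (n - 1 : ℕ) + 1) / (2 * n) : ℝ) = 1 - 1 / (2 * n) := by
  have hn0 : (n : ℝ) ≠ 0 := by exact_mod_cast (show n ≠ 0 by omega)
  rw [Nat.cast_sub hn]; push_cast; field_simp; ring

theorem kerA1_eq_ker {n : ℕ} (hn : 1 ≤ n) (z : ℂ) (x : ℝ) :
    kerA1 n z x = ker n 0 (n - 1) z x := by
  have hn1 : (1 : ℝ) ≤ n := by exact_mod_cast hn
  have h1 : 1 / (2 * n : ℝ) < 1 := by rw [div_lt_one (by positivity)]; linarith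
  have hp : 0 < 1 / (2 * n : ℝ) := by positivity
  have g1 : (Real.Gamma (1 / (2 * n)) : ℂ) ≠ 0 := by
    exact_mod_cast (Real.Gamma_pos_of_pos hp).ne'
  have g2 : (Real.Gamma (2 - 1 / (2 * n)) : ℂ) ≠ 0 := by
    exact Complex.ofReal_ne_zero.2 (Real.Gamma_pos_of_pos (by linarith)).ne'
  have hs : (Real.sqrt 2 : ℂ) ≠ 0 := sqrt_two_ne_zero
  have hnc : (n : ℂ) ≠ 0 := by exact_mod_cast (show n ≠ 0 by omega)
  rw [kerA1, ker, kerB1, kerSeries, index_zero, index_sub_one hn, kerConst_zero,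
    kerConst_sub_one hn, zeroFOne_eq hp, zeroFOne_eq (by linarith), ofReal_wexp,
    show 2 * (n - 1) + 1 = 2 * n - 1 by omega,
    show (2 - 1 / (2 * n) - 1 : ℝ) = 1 - 1 / (2 * n) by ring]
  push_cast
  generalize (Real.Gamma (2 - 1 / (2 * n)) : ℂ) = g at *
  field_simp

theorem kerA2_eq_ker {n : ℕ} (hn : 1 ≤ n) (z : ℂ) (x : ℝ) :
    kerA2 n z x = ker n (n - 1) 0 z x := by
  have hn1 : (1 : ℝ) ≤ n := by exact_mod_cast hn
  have h1 : 1 / (2 * n : ℝ) < 1 := by rw [div_lt_one (by positivity)]; linarith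
  have hp : 0 < 1 / (2 * n : ℝ) := by positivity
  have g1 : (Real.Gamma (1 / (2 * n)) : ℂ) ≠ 0 := by
    exact_mod_cast (Real.Gamma_pos_of_pos hp).ne'
  have g2 : (Real.Gamma (1 - 1 / (2 * n)) : ℂ) ≠ 0 := by
    exact Complex.ofReal_ne_zero.2 (Real.Gamma_pos_of_pos (by linarith)).ne'
  have hs : (Real.sqrt 2 : ℂ) ≠ 0 := sqrt_two_ne_zero
  have hs2 := sqrt_two_sq
  have hnc : (n : ℂ) ≠ 0 := by exact_mod_cast (show n ≠ 0 by omega)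
  rw [kerA2, ker, kerB2, kerSeries, index_zero, index_sub_one hn, kerConst_zero,
    kerConst_sub_one hn, zeroFOne_eq (by linarith), zeroFOne_eq (by linarith), ofReal_wexp,
    show (1 + 1 / (2 * n) - 1 : ℝ) = 1 / (2 * n) by ring, add_comm 1 (1 / (2 * n) : ℝ),
    Real.Gamma_add_one hp.ne']
  have hpow : (z * x) ^ n = (z * x) ^ (n - 1) * (z * x) := by
    rw [← pow_succ]; congr 1; omega
  rw [hpow, mul_zero, zero_add, pow_one]
  generalize gammaSeries (1 / (2 * n)) ((z * x) ^ (2 * n) / (2 * n ^ 2 : ℂ)) = G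
  generalize gammaSeries (1 - 1 / (2 * n) - 1) ((z * x) ^ (2 * n) / (2 * n ^ 2 : ℂ)) = G'
  have e1 : ((beta n / Real.Gamma (1 - 1 / (2 * n)) : ℝ) : ℂ) *
      (Real.Gamma (1 - 1 / (2 * n)) : ℂ) = beta n := by
    push_cast; exact div_mul_cancel₀ _ g2
  have e2 : ((Real.sqrt 2 * alpha n / Real.Gamma (1 / (2 * n)) : ℝ) : ℂ) *
      ((1 / (2 * n) * Real.Gamma (1 / (2 * n)) : ℝ) : ℂ) =
      ((alpha n / (Real.sqrt 2 * n) : ℝ) : ℂ) := by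
    push_cast
    field_simp
    rw [hs2, mul_comm]
  linear_combination (Complex.exp (-(z ^ (2 * n) / (2 * n))) * ((z * x) ^ (n - 1)) *
    Complex.exp (-((x : ℂ) ^ (2 * n) / (2 * n)))) * (G' * e1 + (z * x) * G * e2)

/-- The ladder relation of the kernels, as functions of `y = z * x`: differentiation exchanges the
two sectors, and the two summands. -/
theorem hasDerivAt_kerSeries {n r s : ℕ} (hn : r + s + 1 = n) (y : ℂ) :
    HasDerivAt (kerSeries n r s) ((Real.sqrt 2 : ℂ) * y ^ (2 * s) * kerSeries n s r y) y := by
  have hnc : (n : ℂ) ≠ 0 := by exact_mod_cast (show n ≠ 0 by omega)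
  have hs : (Real.sqrt 2 : ℂ) ≠ 0 := sqrt_two_ne_zero
  have hs2 := sqrt_two_sq
  have hw : HasDerivAt (fun y : ℂ => y ^ (2 * n) / (2 * n ^ 2 : ℂ)) (y ^ (2 * n - 1) / n) y := by
    refine ((hasDerivAt_pow (2 * n) y).div_const (2 * n ^ 2 : ℂ)).congr_deriv ?_
    push_cast; field_simp
  have hG : ∀ a : ℝ, HasDerivAt (fun y : ℂ => gammaSeries a (y ^ (2 * n) / (2 * n ^ 2 : ℂ)))
      (gammaSeries (a + 1) (y ^ (2 * n) / (2 * n ^ 2 : ℂ)) * (y ^ (2 * n - 1) / n)) y := fun a =>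
    (hasDerivAt_gammaSeries (𝕜 := ℂ) a _).comp y hw
  have h := ((hG ((2 * r + 1) / (2 * n) - 1)).const_mul (kerConst n r : ℂ)).add
    (((hasDerivAt_pow (2 * s + 1) y).const_mul
      ((kerConst n s / (Real.sqrt 2 * n) : ℝ) : ℂ)).mul (hG ((2 * s + 1) / (2 * n))))
  refine h.congr_deriv ?_
  have hrec := mul_gammaSeries_add_one ((2 * s + 1) / (2 * n)) (y ^ (2 * n) / (2 * n ^ 2 : ℂ))
  rw [kerSeries, sub_add_cancel, ← hrec, Nat.add_sub_cancel,
    show 2 * n - 1 = 2 * s + (2 * r + 1) by omega, pow_add y (2 * s) (2 * r + 1)]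
  have hy : y ^ (2 * s + 1) * y ^ (2 * r + 1) = y ^ (2 * n) := by
    rw [← pow_add]; congr 1; omega
  set w := y ^ (2 * n) / (2 * n ^ 2 : ℂ) with hwdef
  have hy2 : y ^ (2 * s + 1) * y ^ (2 * r + 1) = 2 * n ^ 2 * w := by
    rw [hy, hwdef]; field_simp
  simp only [RCLike.ofReal_eq_complex_ofReal]
  generalize gammaSeries ((2 * s + 1) / (2 * n) + 1) w = G1
  generalize gammaSeries ((2 * s + 1) / (2 * n)) w = G2
  generalize gammaSeries ((2 * r + 1) / (2 * n)) w = G3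
  have hy3 : y ^ (2 * s + 1) * (y ^ (2 * s) * y ^ (2 * r + 1)) = 2 * n ^ 2 * w * y ^ (2 * s) := by
    rw [← hy2]; ring
  generalize y ^ (2 * s) = Y at *
  generalize y ^ (2 * r + 1) = Z at *
  generalize y ^ (2 * s + 1) = X at *
  have hinv : ∀ c : ℝ, ((c / (Real.sqrt 2 * n) : ℝ) : ℂ) = (Real.sqrt 2 : ℂ) / 2 * c * (n : ℂ)⁻¹ := by
    intro c
    push_cast
    field_simp
    rw [hs2, mul_comm]
  have hn4 : (n : ℂ)⁻¹ * n = 1 := inv_mul_cancel₀ hnc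
  rw [hinv, hinv]
  push_cast
  linear_combination ((Real.sqrt 2 : ℂ) / 2 * kerConst n s * (n : ℂ)⁻¹ ^ 2 * G1) * hy3 +
    ((Real.sqrt 2 : ℂ) * kerConst n s * w * Y * G1 * ((n : ℂ)⁻¹ * n + 1)) * hn4 -
    (kerConst n r * G3 * Y * Z * (n : ℂ)⁻¹ / 2) * hs2

/-! ### The coefficients of the kernels in the levels -/

theorem tame_kerSeries {n : ℕ} (hn : 1 ≤ n) (r s : ℕ) (z : ℂ) :
    Tame n (fun x : ℝ => kerSeries n r s (z * x)) := by
  have h1 := (tame_pow_mul_gammaSeries hn ((2 * r + 1) / (2 * n) - 1) 0 z).const_mul (kerConst n r)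
  have h2 := (tame_pow_mul_gammaSeries hn ((2 * s + 1) / (2 * n)) (2 * s + 1) z).const_mul
    ((kerConst n s / (Real.sqrt 2 * n) : ℝ) * z ^ (2 * s + 1))
  convert h1.add h2 using 2 with x
  rw [kerSeries, mul_pow]
  ring

/-- The part of the kernel in front of `x ^ r` and the generalized Gaussian. -/
def kerTame (n r s : ℕ) (z : ℂ) (x : ℝ) : ℂ :=
  Complex.exp (-(z ^ (2 * n) / (2 * n))) * z ^ r * kerSeries n r s (z * x)

theorem tame_kerTame {n : ℕ} (hn : 1 ≤ n) (r s : ℕ) (z : ℂ) : Tame n (kerTame n r s z) :=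
  (tame_kerSeries hn r s z).const_mul _

theorem ker_eq (n r s : ℕ) (z : ℂ) (x : ℝ) :
    ker n r s z x = (x : ℂ) ^ r * kerTame n r s z x * (wexp n x : ℂ) := by
  rw [ker, kerTame, mul_pow]; ring

theorem memLp_ker {n : ℕ} (hn : 1 ≤ n) (r s : ℕ) (z : ℂ) : MemLp (ker n r s z) 2 volume := by
  have := (tame_kerTame hn r s z).memLp hn r
  simpa only [← ker_eq] using this

/-- The kernel as an element of `L²(ℝ)`. -/
def kerLp {n : ℕ} (hn : 1 ≤ n) (r s : ℕ) (z : ℂ) : L2 := (memLp_ker hn r s z).toLp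

theorem coeFn_kerLp {n : ℕ} (hn : 1 ≤ n) (r s : ℕ) (z : ℂ) :
    ∀ᵐ x : ℝ, kerLp hn r s z x = (x : ℂ) ^ r * kerTame n r s z x * (wexp n x : ℂ) := by
  filter_upwards [(memLp_ker hn r s z).coeFn_toLp] with x hx
  rw [kerLp, hx, ker_eq]

theorem hasDerivAt_kerTame {n r s : ℕ} (hn : r + s + 1 = n) (z : ℂ) (x : ℝ) :
    HasDerivAt (kerTame n r s z)
      ((Real.sqrt 2 : ℂ) * (x : ℂ) ^ (2 * s) * (z ^ n * kerTame n s r z x)) x := by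
  have h1 : HasDerivAt (fun x : ℝ => z * (x : ℂ)) z x := by
    simpa using (Complex.ofRealCLM.hasDerivAt (x := x)).const_mul z
  have h := ((hasDerivAt_kerSeries hn (z * x)).comp x h1).const_mul
    (Complex.exp (-(z ^ (2 * n) / (2 * n))) * z ^ r)
  refine h.congr_deriv ?_
  have hz : z ^ r * z * z ^ (2 * s) = z ^ n * z ^ s := by
    rw [← pow_succ, ← pow_add, ← pow_add]; congr 1; omega
  rw [kerTame, mul_pow]
  linear_combination (Complex.exp (-(z ^ (2 * n) / (2 * n))) * (Real.sqrt 2 : ℂ) *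
    (x : ℂ) ^ (2 * s) * kerSeries n s r (z * x)) * hz

/-- The lowering operator maps the kernel of one sector to `z ^ n` times that of the other. -/
theorem exists_kerLp_mem_ladderGraph {n r s : ℕ} (hn : r + s + 1 = n) (hn1 : 1 ≤ n) (z : ℂ) :
    ∃ h, (kerLp hn1 r s z, z ^ n • kerLp hn1 s r z, h) ∈ ladderGraph n r s := by
  have m1 := ((tame_kerTame hn1 r s z).memLp hn1 (n + r)).const_mul (Real.sqrt 2 : ℂ)
  have m2 := ((tame_kerTame hn1 s r z).const_mul (z ^ n)).memLp hn1 s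
  refine ⟨(m1.sub m2).toLp, mem_ladderGraph_of_tame hn ((tame_kerTame hn1 s r z).const_mul (z ^ n))
    (hasDerivAt_kerTame hn z) (coeFn_kerLp hn1 r s z) ?_ ?_⟩
  · filter_upwards [coeFn_kerLp hn1 s r z, Lp.coeFn_smul (z ^ n) (kerLp hn1 s r z)] with x h1 h2
    rw [h2, Pi.smul_apply, h1, smul_eq_mul]; ring
  · filter_upwards [(m1.sub m2).coeFn_toLp] with x h1
    rw [h1, Pi.sub_apply]; ring

theorem integrable_pow_mul_wexp_sq {n : ℕ} (hn : 1 ≤ n) {p : ℝ → ℂ} (hp : Tame n p) (m : ℕ) :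
    Integrable (fun x : ℝ => (x : ℂ) ^ m * p x * (wexp n x : ℂ) ^ 2) := by
  have hq : Tame n (fun x => p x * (wexp n x : ℂ)) := by
    have hc := hp.1
    have hw := continuous_wexp n
    obtain ⟨C, hC⟩ := hp.2
    refine ⟨by fun_prop, C, fun x => le_trans ?_ (hC x)⟩
    rw [norm_mul, Complex.norm_real, Real.norm_of_nonneg (wexp_pos n x).le]
    refine mul_le_of_le_one_right (norm_nonneg _) ?_
    rw [wexp, Real.exp_le_one_iff, neg_nonpos]
    have : 0 ≤ x ^ (2 * n) := (even_two_mul n).pow_nonneg x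
    positivity
  refine (hq.integrable_pow hn m).congr (Eventually.of_forall fun x => ?_)
  simp only; ring

/-- The even part of the kernel, integrated termwise, reproduces the exponential series. -/
theorem integral_gammaSeries {n : ℕ} (hn : 1 ≤ n) (r : ℕ) (z : ℂ) :
    ∫ x : ℝ, (x : ℂ) ^ (2 * r) * gammaSeries ((2 * r + 1) / (2 * n) - 1)
        ((z * x) ^ (2 * n) / (2 * n ^ 2)) * (wexp n x : ℂ) ^ 2 =
      ((n : ℝ) ^ ((2 * r + 1) / (2 * n) - 1 : ℝ) : ℝ) * Complex.exp (z ^ (2 * n) / (2 * n)) := by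
  have hn0 : (0 : ℝ) < n := by exact_mod_cast hn
  have hnc : (n : ℂ) ≠ 0 := by exact_mod_cast hn0.ne'
  set a : ℝ := (2 * r + 1) / (2 * n) with ha
  have ha0 : 0 < a := by positivity
  set c : ℕ → ℂ := fun k => (gammaCoeff (a - 1) k : ℂ) * (z ^ (2 * n) / (2 * n ^ 2)) ^ k with hc
  set F : ℕ → ℝ → ℂ := fun k x => c k * ((x ^ (2 * (r + n * k)) * wexp n x ^ 2 : ℝ) : ℂ) with hF
  have hmom : ∀ k : ℕ, ∫ x : ℝ, x ^ (2 * (r + n * k)) * wexp n x ^ 2 =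
      (n : ℝ) ^ (a - 1) * (n : ℝ) ^ k * Real.Gamma (k + a) := by
    intro k
    have e : ((2 * (r + n * k : ℕ) + 1) / (2 * n) : ℝ) = k + a := by
      rw [ha]; push_cast; field_simp; ring
    rw [integral_even_moment n hn, e, show (k : ℝ) + a - 1 = (a - 1) + k by ring,
      Real.rpow_add hn0, Real.rpow_natCast]
  have hmomint : ∀ k : ℕ, Integrable fun x : ℝ => x ^ (2 * (r + n * k)) * wexp n x ^ 2 := by
    intro k
    have h0 : Tame n (fun _ => (1 : ℂ)) := by simpa using tame_pow n hn 0
    refine (integrable_pow_mul_wexp_sq hn h0 (2 * (r + n * k))).re.congr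
      (Eventually.of_forall fun x => ?_)
    have : (x : ℂ) ^ (2 * (r + n * k)) * 1 * (wexp n x : ℂ) ^ 2 =
        ((x ^ (2 * (r + n * k)) * wexp n x ^ 2 : ℝ) : ℂ) := by push_cast; ring
    simp only [this]
    exact Complex.ofReal_re _
  have hcm : ∀ (k : ℕ) (y : ℂ), (gammaCoeff (a - 1) k : ℂ) * (y / (2 * n ^ 2)) ^ k *
      (((n : ℝ) ^ (a - 1) * (n : ℝ) ^ k * Real.Gamma (k + a) : ℝ) : ℂ) =
      ((n : ℝ) ^ (a - 1) : ℝ) * ((y / (2 * n)) ^ k / k.factorial) := by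
    intro k y
    have hg : (Real.Gamma (k + a) : ℂ) ≠ 0 := by
      exact Complex.ofReal_ne_zero.2 (Real.Gamma_pos_of_pos (by positivity)).ne'
    have hk : (k.factorial : ℂ) ≠ 0 := by exact_mod_cast k.factorial_ne_zero
    rw [gammaCoeff, show (k : ℝ) + (a - 1) + 1 = k + a by ring, div_pow, div_pow, mul_pow, mul_pow]
    generalize Real.Gamma (k + a) = g at *
    generalize (n : ℝ) ^ (a - 1) = m
    push_cast
    field_simp
    ring
  have hint : ∀ k, Integrable (F k) := fun k => (hmomint k).ofReal.const_mul (c k)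
  have hval : ∀ k, ∫ x, F k x =
      ((n : ℝ) ^ (a - 1) : ℝ) * ((z ^ (2 * n) / (2 * n)) ^ k / k.factorial) := by
    intro k
    rw [hF]
    simp only
    rw [integral_const_mul, integral_complex_ofReal, hmom, hc, hcm]
  have hnorm : ∀ k, ∫ x, ‖F k x‖ =
      (n : ℝ) ^ (a - 1) * ((‖z‖ ^ (2 * n) / (2 * n)) ^ k / k.factorial) := by
    intro k
    have h1 : ∀ x, ‖F k x‖ = ‖c k‖ * (x ^ (2 * (r + n * k)) * wexp n x ^ 2) := by
      intro x
      have : 0 ≤ x ^ (2 * (r + n * k)) := (even_two_mul _).pow_nonneg x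
      rw [hF, norm_mul, Complex.norm_real, Real.norm_of_nonneg (by positivity)]
    simp_rw [h1]
    rw [integral_const_mul, hmom]
    have hpos : 0 ≤ (n : ℝ) ^ (a - 1) * (n : ℝ) ^ k * Real.Gamma (k + a) := by
      have := Real.Gamma_pos_of_pos (show (0 : ℝ) < k + a by positivity)
      positivity
    have h2 := congrArg norm (hcm k (z ^ (2 * n)))
    rw [norm_mul, Complex.norm_real, Real.norm_of_nonneg hpos] at h2
    rw [hc, h2]
    simp [abs_of_pos (Real.rpow_pos_of_pos hn0 _)]
  have hsum := hasSum_integral_of_summable_integral_norm hint (by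
    simp_rw [hnorm]
    exact (Real.summable_pow_div_factorial _).mul_left _)
  have hpt : ∀ x : ℝ, ∑' k, F k x = (x : ℂ) ^ (2 * r) * gammaSeries (a - 1)
      ((z * x) ^ (2 * n) / (2 * n ^ 2)) * (wexp n x : ℂ) ^ 2 := by
    intro x
    rw [← ((hasSum_gammaSeries (a - 1) ((z * x) ^ (2 * n) / (2 * n ^ 2 : ℂ))).mul_left
      ((x : ℂ) ^ (2 * r))).mul_right ((wexp n x : ℂ) ^ 2) |>.tsum_eq]
    refine tsum_congr fun k => ?_
    rw [hF, hc]
    simp only [RCLike.ofReal_eq_complex_ofReal]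
    rw [mul_add, pow_add, ← mul_assoc 2 n k, pow_mul x (2 * n) k, mul_pow z, mul_div_right_comm,
      mul_pow]
    push_cast; ring
  simp_rw [hpt] at hsum
  refine hsum.unique ?_
  simp_rw [hval]
  rw [Complex.exp_eq_exp_ℂ]
  exact (NormedSpace.expSeries_div_hasSum_exp (z ^ (2 * n) / (2 * n) : ℂ)).mul_left _

theorem integral_kerSeries {n r s : ℕ} (hn : r + s + 1 = n) (z : ℂ) :
    ∫ x : ℝ, (x : ℂ) ^ (2 * r) * kerSeries n r s (z * x) * (wexp n x : ℂ) ^ 2 =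
      (kerConst n r * (n : ℝ) ^ ((2 * r + 1) / (2 * n) - 1 : ℝ) : ℝ) *
        Complex.exp (z ^ (2 * n) / (2 * n)) := by
  have hn1 : 1 ≤ n := by omega
  set G₁ : ℝ → ℂ := fun x => gammaSeries ((2 * r + 1) / (2 * n) - 1)
    ((z * x) ^ (2 * n) / (2 * n ^ 2 : ℂ)) with hG₁
  set G₂ : ℝ → ℂ := fun x => gammaSeries ((2 * s + 1) / (2 * n))
    ((z * x) ^ (2 * n) / (2 * n ^ 2 : ℂ)) with hG₂
  have t1 : Tame n G₁ := by simpa using tame_pow_mul_gammaSeries hn1 ((2 * r + 1) / (2 * n) - 1) 0 z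
  have t2 : Tame n G₂ := by simpa using tame_pow_mul_gammaSeries hn1 ((2 * s + 1) / (2 * n)) 0 z
  set d : ℂ := (kerConst n s / (Real.sqrt 2 * n) : ℝ) * z ^ (2 * s + 1)
  have i1 := (integrable_pow_mul_wexp_sq hn1 t1 (2 * r)).const_mul (kerConst n r : ℂ)
  have i2 := (integrable_pow_mul_wexp_sq hn1 t2 (2 * r + (2 * s + 1))).const_mul d
  have hsplit : ∀ x : ℝ, (x : ℂ) ^ (2 * r) * kerSeries n r s (z * x) * (wexp n x : ℂ) ^ 2 =
      (kerConst n r : ℂ) * ((x : ℂ) ^ (2 * r) * G₁ x * (wexp n x : ℂ) ^ 2) +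
        d * ((x : ℂ) ^ (2 * r + (2 * s + 1)) * G₂ x * (wexp n x : ℂ) ^ 2) := by
    intro x
    rw [kerSeries, mul_pow z (x : ℂ) (2 * s + 1), pow_add]
    ring
  -- the second summand of the kernel is odd
  have hodd : ∫ x : ℝ, (x : ℂ) ^ (2 * r + (2 * s + 1)) * G₂ x * (wexp n x : ℂ) ^ 2 = 0 := by
    have h := integral_neg_eq_self
      (fun x : ℝ => (x : ℂ) ^ (2 * r + (2 * s + 1)) * G₂ x * (wexp n x : ℂ) ^ 2) volume
    have ho : Odd (2 * r + (2 * s + 1)) := ⟨r + s, by ring⟩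
    have h2 : ∀ x : ℝ, ((-x : ℝ) : ℂ) ^ (2 * r + (2 * s + 1)) * G₂ (-x) * (wexp n (-x) : ℂ) ^ 2 =
        -((x : ℂ) ^ (2 * r + (2 * s + 1)) * G₂ x * (wexp n x : ℂ) ^ 2) := by
      intro x
      have e1 : wexp n (-x) = wexp n x := by rw [wexp, wexp, (even_two_mul n).neg_pow]
      have e2 : G₂ (-x) = G₂ x := by
        simp only [hG₂]
        rw [Complex.ofReal_neg, mul_neg, (even_two_mul n).neg_pow]
      rw [e1, e2, Complex.ofReal_neg, ho.neg_pow]; ring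
    simp_rw [h2, integral_neg] at h
    exact self_eq_neg.1 h.symm
  simp_rw [hsplit]
  rw [integral_add i1 i2, integral_const_mul, integral_const_mul, hodd, hG₁,
    integral_gammaSeries hn1]
  push_cast; ring

theorem kerConst_mul_groundNorm {n r s : ℕ} (hn : r + s + 1 = n) :
    groundNorm n r * (kerConst n r * (n : ℝ) ^ ((2 * r + 1) / (2 * n) - 1 : ℝ)) =
      holCoef n r s 0 := by
  have hn1 : 1 ≤ n := by omega
  have hn0 : (0 : ℝ) < n := by exact_mod_cast hn1
  have hG : 0 < Real.Gamma (1 / (2 * n)) := Real.Gamma_pos_of_pos (by positivity)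
  have hG2 : 0 < Real.Gamma ((2 * r + 1) / (2 * n)) := Real.Gamma_pos_of_pos (by positivity)
  have e1 : ((r : ℝ) + n + s + 1) / (2 * n) = 1 := by
    have : (n : ℝ) = r + s + 1 := by exact_mod_cast hn.symm
    rw [div_eq_one_iff_eq (by positivity), this]; ring
  have e2 : ((r : ℝ) + r + 1) = 2 * r + 1 := by ring
  have e3 : Real.sqrt ((2 * n : ℝ) ^ (r / n : ℝ)) = (2 * n : ℝ) ^ (r / (2 * n) : ℝ) := by
    rw [Real.sqrt_eq_rpow, ← Real.rpow_mul (by positivity)]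
    congr 1; field_simp
  have e4 : (n : ℝ) ^ ((1 : ℝ) / 2 - (2 * r + 1) / (4 * n)) *
      ((n : ℝ) ^ ((1 : ℝ) / 2 - (2 * r + 1) / (4 * n)) *
        (n : ℝ) ^ ((2 * r + 1) / (2 * n) - 1 : ℝ)) = 1 := by
    rw [← Real.rpow_add hn0, ← Real.rpow_add hn0, ← Real.rpow_zero (n : ℝ)]
    congr 1; field_simp; ring
  rw [holCoef, expo, e1, e2, Real.Gamma_one, mul_one, Real.sqrt_div hG.le,
    Real.sqrt_mul (by positivity), e3, groundNorm, kerConst, Real.rpow_neg (by positivity)]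
  have hs : 0 < Real.sqrt (Real.Gamma ((2 * r + 1) / (2 * n))) := Real.sqrt_pos.2 hG2
  have hp : 0 < (2 * n : ℝ) ^ (r / (2 * n) : ℝ) := by positivity
  generalize (2 * n : ℝ) ^ (r / (2 * n) : ℝ) = P at *
  generalize Real.sqrt (Real.Gamma ((2 * r + 1) / (2 * n))) = Q at *
  generalize (n : ℝ) ^ ((1 : ℝ) / 2 - (2 * r + 1) / (4 * n)) = X at *
  generalize (n : ℝ) ^ ((2 * r + 1) / (2 * n) - 1 : ℝ) = Y at *
  rw [div_mul_eq_mul_div, div_eq_div_iff hs.ne' (by positivity)]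
  calc _ = X * (X * Y) * Real.sqrt (Real.Gamma (1 / (2 * n))) * Q * (P⁻¹ * P) := by ring
    _ = _ := by rw [e4, inv_mul_cancel₀ hp.ne']; ring

/-- The ground state coefficient of the kernel. The prefactor `exp (-z ^ (2 * n) / (2 * n))` cancels
the exponential of `integral_kerSeries`. -/
theorem inner_level_zero_kerLp {n r s : ℕ} (hn : r + s + 1 = n) (hn1 : 1 ≤ n) (z : ℂ) :
    inner ℂ (level n r s 0) (kerLp hn1 r s z) = hol n r s 0 z := by
  rw [inner_level hn1]
  have h : ∀ᵐ x : ℝ, (x : ℂ) ^ r * ((lad n r s 0).eval x : ℝ) * (wexp n x : ℂ) *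
      kerLp hn1 r s z x = (groundNorm n r : ℂ) * Complex.exp (-(z ^ (2 * n) / (2 * n))) * z ^ r *
        ((x : ℂ) ^ (2 * r) * kerSeries n r s (z * x) * (wexp n x : ℂ) ^ 2) := by
    filter_upwards [coeFn_kerLp hn1 r s z] with x hx
    rw [hx, kerTame]
    simp only [lad, Polynomial.eval_C]
    ring
  rw [integral_congr_ae h, integral_const_mul, integral_kerSeries hn, hol,
    ← kerConst_mul_groundNorm hn, expo]
  have hexp : Complex.exp (-(z ^ (2 * n) / (2 * n))) * Complex.exp (z ^ (2 * n) / (2 * n)) = 1 := by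
    rw [← Complex.exp_add, neg_add_cancel, Complex.exp_zero]
  push_cast
  linear_combination ((groundNorm n r : ℂ) * z ^ r * (kerConst n r *
    (((n : ℝ) ^ ((2 * r + 1) / (2 * n) - 1 : ℝ) : ℝ) : ℂ))) * hexp

/-- The kernel is the generating function of the levels: its coefficients are the holomorphic
basis functions. -/
theorem inner_level_kerLp {n : ℕ} (hn1 : 1 ≤ n) (l : ℕ) : ∀ (r s : ℕ), r + s + 1 = n → ∀ z : ℂ,
    inner ℂ (level n r s l) (kerLp hn1 r s z) = hol n r s l z := by
  induction l with
  | zero => exact fun r s hn z => inner_level_zero_kerLp hn hn1 z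
  | succ l ih =>
    intro r s hn z
    obtain ⟨h, hh⟩ := exists_kerLp_mem_ladderGraph hn hn1 z
    have h1 := inner_level_of_mem_ladderGraph hn hh l
    rw [inner_smul_right, ih s r (by omega), pow_mul_hol hn] at h1
    have h2 : (rung n r s l : ℂ) ≠ 0 := by exact_mod_cast (rung_pos n r s l hn).ne'
    exact (mul_left_cancel₀ h2 h1).symm

/-- The Segal-Bargmann transform of the `(r, s)` sector. -/
def segalBargmann (n r s : ℕ) (f : L2) (z : ℂ) : ℂ := ∫ x : ℝ, ker n r s z x * f x

/-- In terms of the levels and the holomorphic basis functions, the transform is the identity on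
coefficients. -/
theorem hasSum_segalBargmann {n r s : ℕ} (hn : r + s + 1 = n) (f : L2) (z : ℂ) :
    HasSum (fun l => inner ℂ (level n r s l) f * hol n r s l z) (segalBargmann n r s f z) := by
  have hn1 : 1 ≤ n := by omega
  have hK := (memLp_ker hn1 r s z).star
  have h1 : ∀ g : L2, inner ℂ hK.toLp g = ∫ x : ℝ, ker n r s z x * g x := by
    intro g
    rw [L2.inner_def]
    refine integral_congr_ae ?_
    filter_upwards [hK.coeFn_toLp] with x hx
    rw [hx, RCLike.inner_apply, Pi.star_apply, RCLike.star_def, Complex.conj_conj, mul_comm]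
  have h2 : ∀ l, inner ℂ hK.toLp (level n r s l) = hol n r s l z := by
    intro l
    rw [h1, ← inner_level_kerLp hn1 l r s hn z, inner_level hn1]
    refine integral_congr_ae ?_
    filter_upwards [coeFn_level hn1 r s l, (memLp_ker hn1 r s z).coeFn_toLp] with x e1 e2
    rw [e1, kerLp, e2, mul_comm]
  have h3 := (levelBasis hn).hasSum_inner_mul_inner hK.toLp f
  rw [h1] at h3
  simp only [levelBasis_apply, h2] at h3
  exact h3.congr_fun fun l => mul_comm _ _

/-! ### Lacunary power series -/

/-- The coefficients of a convergent lacunary power series are determined by its values away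
from `0`. -/
theorem eq_zero_of_hasSum_zero {a : ℕ → ℂ} {m : ℕ → ℕ} (hm : Function.Injective m)
    (h : ∀ z : ℂ, z ≠ 0 → HasSum (fun l => a l * z ^ m l) 0) (l : ℕ) : a l = 0 := by
  -- after multiplication by `z` the value of the series at `z = 0` is known as well
  set m' : ℕ → ℕ := fun l => m l + 1
  have hm' : Function.Injective m' := fun i j hij => hm (Nat.succ_injective hij)
  set d : ℕ → ℂ := Function.extend m' a 0
  have hd : ∀ z : ℂ, HasSum (fun k => z ^ k • d k) 0 := by
    intro z
    have h1 : HasSum (fun l => a l * z ^ m' l) 0 := by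
      by_cases hz : z = 0
      · simp [m', hz, hasSum_zero]
      · simpa [m', pow_succ, mul_assoc] using (h z hz).mul_right z
    refine (hm'.hasSum_iff fun k hk => ?_).1 (h1.congr_fun fun l => ?_)
    · simp [d, Function.extend_apply' a (0 : ℕ → ℂ) k hk]
    · simp [d, hm'.extend_apply, mul_comm]
  have hp : HasFPowerSeriesAt (0 : ℂ → ℂ) (FormalMultilinearSeries.ofScalars ℂ d) 0 := by
    rw [hasFPowerSeriesAt_iff]
    refine Eventually.of_forall fun z => ?_
    simpa only [FormalMultilinearSeries.coeff_ofScalars] using! hd z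
  have h0 := congrArg (fun p => p.coeff (m' l)) hp.eq_zero
  simp only [FormalMultilinearSeries.coeff_ofScalars] at h0
  simpa [d, hm'.extend_apply] using! h0

/-- Termwise differentiation of a lacunary power series that converges everywhere. -/
theorem hasDerivAt_lacunary {a : ℕ → ℂ} {m : ℕ → ℕ}
    (h : ∀ R : ℝ, 0 < R → Summable fun l => ‖a l‖ * R ^ m l) (z : ℂ) :
    HasDerivAt (fun z => ∑' l, a l * z ^ m l) (∑' l, a l * (m l * z ^ (m l - 1))) z ∧
      Summable fun l => a l * (m l * z ^ (m l - 1)) := by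
  set R := ‖z‖ + 1
  have hR : 0 < R := by positivity
  have hz : ‖z‖ < R := by simp [R]
  have hu : Summable fun l => ‖a l‖ * (m l * R ^ (m l - 1)) := by
    refine Summable.of_nonneg_of_le (fun l => by positivity) (fun l => ?_)
      ((h (2 * R) (by positivity)).mul_right R⁻¹)
    have h2 : (m l : ℝ) ≤ 2 ^ m l := by exact_mod_cast Nat.lt_two_pow_self.le
    rw [mul_assoc]
    refine mul_le_mul_of_nonneg_left ?_ (norm_nonneg _)
    rcases Nat.eq_zero_or_pos (m l) with h0 | h0
    · rw [h0, Nat.cast_zero, zero_mul]; positivity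
    · have h3 : R ^ m l = R ^ (m l - 1) * R := by rw [← pow_succ]; congr 1; omega
      rw [mul_pow, h3, mul_assoc, mul_assoc, mul_inv_cancel₀ hR.ne', mul_one]
      gcongr
  have hb : ∀ (l : ℕ) (y : ℂ), ‖y‖ ≤ R →
      ‖a l * (m l * y ^ (m l - 1))‖ ≤ ‖a l‖ * (m l * R ^ (m l - 1)) := by
    intro l y hy
    rw [norm_mul, norm_mul, norm_pow, Complex.norm_natCast]
    gcongr
  have hs : Summable fun l => a l * z ^ m l := by
    refine Summable.of_norm_bounded (h R hR) fun l => ?_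
    rw [norm_mul, norm_pow]
    gcongr
  refine ⟨hasDerivAt_tsum_of_isPreconnected (t := Metric.ball (0 : ℂ) R) hu Metric.isOpen_ball
    (convex_ball _ _).isPreconnected (g := fun l y => a l * y ^ m l)
    (g' := fun l y => a l * (m l * y ^ (m l - 1)))
    (fun l y _ => (hasDerivAt_pow (m l) y).const_mul _) (fun l y hy => hb l y ?_) (y₀ := z)
    (by simpa using hz) hs (by simpa using hz), Summable.of_norm_bounded hu fun l => hb l z hz.le⟩
  exact (mem_ball_zero_iff.1 hy).le

/-! ### The intertwining relations on the holomorphic side -/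

/-- The coefficients of a series in the holomorphic basis functions are determined by its values
away from `0`, where the operators `𝔞` and `𝔟` are defined. -/
theorem hol_coef_unique {n r s : ℕ} (hn : r + s + 1 = n) {a b : ℕ → ℂ} {F : ℂ → ℂ}
    (ha : ∀ z : ℂ, z ≠ 0 → HasSum (fun l => a l * hol n r s l z) (F z))
    (hb : ∀ z : ℂ, z ≠ 0 → HasSum (fun l => b l * hol n r s l z) (F z)) (l : ℕ) : a l = b l := by
  have h := eq_zero_of_hasSum_zero (a := fun l => (a l - b l) * holCoef n r s l)
    (strictMono_expo hn).injective (fun z hz => by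
      have := (ha z hz).sub (hb z hz)
      rw [sub_self] at this
      exact this.congr_fun fun l => by simp only [hol]; ring) l
  have hc : (holCoef n r s l : ℂ) ≠ 0 := by
    exact_mod_cast (holCoef_pos (show 1 ≤ n by omega) r s l).ne'
  exact sub_eq_zero.1 ((mul_eq_zero.1 h).resolve_right hc)

/-- `G = z ^ (-s) (d/dz) (z ^ (-r) F)` away from `0`, for `F` differentiable there. -/
def IsHol (r s : ℕ) (F G : ℂ → ℂ) : Prop :=
  ∀ z, z ≠ 0 → DifferentiableAt ℂ F z ∧
    G z = 1 / z ^ s * deriv (fun w => 1 / w ^ r * F w) z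

theorem isHolA_iff (n : ℕ) (F G : ℂ → ℂ) : IsHolA n F G ↔ IsHol 0 (n - 1) F G := by
  simp [IsHolA, IsHol]

theorem isHolB_iff (n : ℕ) (F G : ℂ → ℂ) : IsHolB n F G ↔ IsHol (n - 1) 0 F G := by
  simp [IsHolB, IsHol]

/-- The holomorphic lowering operator acts on series as the weighted shift with the same matrix
elements as the lowering operator on `L²(ℝ)`. -/
theorem hasSum_lower {n r s : ℕ} (hn : r + s + 1 = n) {a : ℕ → ℂ} {F : ℂ → ℂ}
    (hF : ∀ z, HasSum (fun l => a l * hol n r s l z) (F z)) {z : ℂ} (hz : z ≠ 0) :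
    DifferentiableAt ℂ F z ∧ HasSum (fun l => (rung n r s l * a (l + 1)) * hol n s r l z)
      (1 / z ^ s * deriv (fun w => 1 / w ^ r * F w) z) := by
  -- `F = z ^ r Q` with an entire function `Q`, so that the operator is `z ^ (-s) (d/dz) Q`
  set b : ℕ → ℂ := fun l => a l * holCoef n r s l with hb
  set m : ℕ → ℕ := fun l => expo n r s l - r with hm
  have hmr : ∀ l, expo n r s l = m l + r := fun l => by
    have := le_expo n r s l hn
    simp only [hm]; omega
  have hsum : ∀ R : ℝ, 0 < R → Summable fun l => ‖b l‖ * R ^ m l := by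
    intro R hR
    have h1 := ((hF R).summable.norm).mul_right (R ^ r)⁻¹
    refine h1.congr fun l => ?_
    rw [hol, norm_mul, norm_mul, norm_pow, Complex.norm_real R, Real.norm_of_nonneg hR.le, hmr,
      pow_add, hb, norm_mul]
    field_simp
  set Q : ℂ → ℂ := fun z => ∑' l, b l * z ^ m l with hQ
  have hFQ : ∀ w, F w = w ^ r * Q w := by
    intro w
    rw [← (hF w).tsum_eq, hQ, ← tsum_mul_left]
    refine tsum_congr fun l => ?_
    rw [hol, hmr, pow_add, hb]; ring
  obtain ⟨hd, hs⟩ := hasDerivAt_lacunary hsum z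
  have hQ' : (fun w => 1 / w ^ r * F w) =ᶠ[𝓝 z] Q := by
    filter_upwards [isOpen_ne.mem_nhds hz] with w hw
    have : w ^ r ≠ 0 := pow_ne_zero _ hw
    rw [hFQ]; field_simp
  refine ⟨?_, ?_⟩
  · have : F = fun w => w ^ r * Q w := funext hFQ
    rw [this]
    exact ((differentiableAt_id).pow r).mul hd.differentiableAt
  · rw [hQ'.deriv_eq, hd.deriv]
    have h1 := hs.hasSum.mul_left (1 / z ^ s)
    rw [← hasSum_nat_add_iff' 1] at h1
    have hm0 : m 0 = 0 := by simp [hm, expo]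
    simp only [Finset.range_one, Finset.sum_singleton, hm0, Nat.cast_zero, zero_mul, mul_zero,
      sub_zero] at h1
    refine h1.congr_fun fun l => ?_
    have hm1 : m (l + 1) = expo n s r l + s + 1 := by simp only [hm, expo]; omega
    have hm2 : ((m (l + 1) : ℕ) : ℂ) = (rung n r s l : ℂ) * rung n r s l := by
      have hnr : (n : ℂ) = r + s + 1 := by exact_mod_cast hn.symm
      rw [← Complex.ofReal_mul, ← sq, rung_sq n r s l hn, rungSq, hm1]
      push_cast
      rw [hnr]; ring
    have hzs : z ^ s ≠ 0 := pow_ne_zero _ hz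
    rw [hm2, hm1, Nat.add_sub_cancel, pow_add, hb, hol, ← rung_mul_holCoef_succ hn]
    push_cast
    field_simp

/-- The coefficients of the image of a series under multiplication by `z ^ n`. -/
def raiseCoef (n r s : ℕ) (a : ℕ → ℂ) : ℕ → ℂ
  | 0 => 0
  | l + 1 => rung n r s l * a l

/-- Multiplication by `z ^ n` acts on series as the weighted shift with the same matrix elements as
the raising operator on `L²(ℝ)`. -/
theorem hasSum_raise {n r s : ℕ} (hn : r + s + 1 = n) {a : ℕ → ℂ} {F : ℂ → ℂ} {z : ℂ}
    (hF : HasSum (fun l => a l * hol n s r l z) (F z)) :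
    HasSum (fun l => raiseCoef n r s a l * hol n r s l z)
      (z ^ n * F z) := by
  rw [← hasSum_nat_add_iff' 1]
  simp only [Finset.range_one, Finset.sum_singleton, raiseCoef, zero_mul, sub_zero]
  refine (hF.mul_left (z ^ n)).congr_fun fun l => ?_
  rw [mul_left_comm, pow_mul_hol hn]
  ring

theorem isHol_segalBargmann_iff {n r s : ℕ} (hn : r + s + 1 = n) (f g : L2) :
    IsHol r s (segalBargmann n r s f) (segalBargmann n s r g) ↔ IsLower n r s f g := by
  have hn' : s + r + 1 = n := by omega
  have h := fun (z : ℂ) (hz : z ≠ 0) => hasSum_lower hn (hasSum_segalBargmann hn f) hz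
  constructor
  · intro hFG l
    exact hol_coef_unique hn' (F := segalBargmann n s r g)
      (fun z _ => hasSum_segalBargmann hn' g z)
      (fun z hz => by rw [(hFG z hz).2]; exact (h z hz).2) l
  · intro hfg z hz
    refine ⟨(h z hz).1, (hasSum_segalBargmann hn' g z).unique ((h z hz).2.congr_fun fun l => ?_)⟩
    rw [hfg l]

theorem isMulPow_segalBargmann_iff {n r s : ℕ} (hn : r + s + 1 = n) (f g : L2) :
    IsMulPow n (segalBargmann n s r f) (segalBargmann n r s g) ↔ IsRaise n r s f g := by
  have hn' : s + r + 1 = n := by omega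
  have h := fun z : ℂ => hasSum_raise hn (hasSum_segalBargmann hn' f z)
  constructor
  · intro hFG
    have hu := hol_coef_unique hn (F := segalBargmann n r s g)
      (fun z _ => hasSum_segalBargmann hn g z) (fun z _ => by rw [hFG z]; exact h z)
    exact ⟨hu 0, fun l => hu (l + 1)⟩
  · intro hfg z
    refine (hasSum_segalBargmann hn g z).unique ((h z).congr_fun fun l => ?_)
    rcases l with _ | l
    · rw [hfg.1, raiseCoef]
    · rw [hfg.2 l, raiseCoef]

/-! ### The Segal-Bargmann transform as a unitary map -/

theorem segalBargmann_level {n r s : ℕ} (hn : r + s + 1 = n) (l : ℕ) :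
    segalBargmann n r s (level n r s l) = hol n r s l := by
  funext z
  refine (hasSum_segalBargmann hn (level n r s l) z).unique ?_
  convert! hasSum_ite_eq l (hol n r s l z) using 2 with m
  rw [inner_level_level _ _ _ _ hn]
  split_ifs with h
  · rw [h, one_mul]
  · rw [zero_mul]

/-- The transform of the `(r, s)` sector as a linear map into the space of series; `φ` is the
sequence of holomorphic basis functions. -/
def transformMap {n r s : ℕ} (hn : r + s + 1 = n) {φ : ℕ → ℂ → ℂ} (hφ : φ = hol n r s) :
    L2 →ₗ[ℂ] seriesSpace φ where
  toFun f := ⟨segalBargmann n r s f, (levelBasis hn).repr f, fun z => by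
    simpa only [hφ, repr_levelBasis] using hasSum_segalBargmann hn f z⟩
  map_add' f g := by
    refine Subtype.ext (funext fun z => (hasSum_segalBargmann hn (f + g) z).unique ?_)
    refine ((hasSum_segalBargmann hn f z).add (hasSum_segalBargmann hn g z)).congr_fun
      fun l => ?_
    rw [inner_add_right, add_mul]
  map_smul' c f := by
    refine Subtype.ext (funext fun z => (hasSum_segalBargmann hn (c • f) z).unique ?_)
    refine ((hasSum_segalBargmann hn f z).mul_left c).congr_fun fun l => ?_
    rw [inner_smul_right, mul_assoc]

theorem bijective_transformMap {n r s : ℕ} (hn : r + s + 1 = n) {φ : ℕ → ℂ → ℂ}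
    (hφ : φ = hol n r s) : Function.Bijective (transformMap hn hφ) := by
  constructor
  · intro f g hfg
    have h1 : segalBargmann n r s f = segalBargmann n r s g := congrArg Subtype.val hfg
    have h2 := hol_coef_unique hn (fun z _ => hasSum_segalBargmann hn f z)
      (fun z _ => h1 ▸ hasSum_segalBargmann hn g z)
    refine (levelBasis hn).repr.injective (lp.ext (funext fun l => ?_))
    rw [repr_levelBasis, repr_levelBasis, h2 l]
  · rintro ⟨F, c, hc⟩
    obtain ⟨f, rfl⟩ := (levelBasis hn).repr.surjective c
    refine ⟨f, Subtype.ext (funext fun z => (hasSum_segalBargmann hn f z).unique ?_)⟩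
    simpa only [hφ, repr_levelBasis] using hc z

/-- The transform of the `(r, s)` sector as a linear bijection onto the space of series. -/
def transform {n r s : ℕ} (hn : r + s + 1 = n) {φ : ℕ → ℂ → ℂ} (hφ : φ = hol n r s) :
    L2 ≃ₗ[ℂ] seriesSpace φ :=
  LinearEquiv.ofBijective (transformMap hn hφ) (bijective_transformMap hn hφ)

theorem coe_transform {n r s : ℕ} (hn : r + s + 1 = n) {φ : ℕ → ℂ → ℂ} (hφ : φ = hol n r s)
    (f : L2) : (transform hn hφ f : ℂ → ℂ) = segalBargmann n r s f := rfl

theorem inner_transform {n r s : ℕ} (hn : r + s + 1 = n) {φ : ℕ → ℂ → ℂ} (hφ : φ = hol n r s)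
    (f g : L2) :
    Integrable (innerIntegrand (sectorWeight n s) (transform hn hφ f) (transform hn hφ g)) ∧
      ∫ z, innerIntegrand (sectorWeight n s) (transform hn hφ f) (transform hn hφ g) z =
        inner ℂ g f := by
  have h : ∀ f : L2, ∀ z, HasSum (fun l => (levelBasis hn).repr f l * hol n r s l z)
      ((transform hn hφ f : ℂ → ℂ) z) := fun f z => by
    simpa only [repr_levelBasis, coe_transform] using hasSum_segalBargmann hn f z
  have := inner_of_hasSum hn (h f) (h g)
  rwa [LinearIsometryEquiv.inner_map_map] at this

theorem normSqOn_transform {n r s : ℕ} (hn : r + s + 1 = n) {φ : ℕ → ℂ → ℂ} (hφ : φ = hol n r s)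
    (f : L2) : normSqOn (sectorWeight n s) (transform hn hφ f) = ‖f‖ ^ 2 := by
  have h := (inner_transform hn hφ f f).2
  have h1 : ∀ z, innerIntegrand (sectorWeight n s) (transform hn hφ f) (transform hn hφ f) z =
      ((‖(transform hn hφ f : ℂ → ℂ) z‖ ^ 2 * sectorWeight n s z : ℝ) : ℂ) := by
    intro z
    rw [innerIntegrand, Complex.mul_conj, Complex.normSq_eq_norm_sq]
    push_cast; ring
  simp_rw [h1] at h
  rw [integral_complex_ofReal, inner_self_eq_norm_sq_to_K] at h
  exact Complex.ofReal_injective (by rw [normSqOn, h]; push_cast; rfl)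

/-- A bounded linear map into the space of series that sends the levels to the holomorphic basis
functions is the transform: composed with the inverse of the transform it is a bounded operator that
fixes a Hilbert basis. -/
theorem eq_transform {n r s : ℕ} (hn : r + s + 1 = n) {φ : ℕ → ℂ → ℂ} (hφ : φ = hol n r s)
    (T : L2 →ₗ[ℂ] seriesSpace φ) {C : ℝ}
    (hC : ∀ f, normSqOn (sectorWeight n s) (T f) ≤ C * ‖f‖ ^ 2)
    (hT : ∀ l, (T (level n r s l) : ℂ → ℂ) = hol n r s l) : T = transform hn hφ := by
  set U := transform hn hφ
  set S : L2 →ₗ[ℂ] L2 := U.symm.toLinearMap ∘ₗ T with hS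
  have hUS : ∀ f, U (S f) = T f := fun f => U.apply_symm_apply (T f)
  have hbound : ∀ f, ‖S f‖ ≤ Real.sqrt C * ‖f‖ := by
    intro f
    have h1 := hC f
    rw [← hUS, normSqOn_transform] at h1
    have h2 := Real.sqrt_le_sqrt h1
    rwa [Real.sqrt_sq (norm_nonneg _), Real.sqrt_mul' _ (by positivity),
      Real.sqrt_sq (norm_nonneg _)] at h2
  have hSl : ∀ l, S (level n r s l) = level n r s l := by
    intro l
    refine U.injective ((hUS _).trans (Subtype.ext ?_))
    rw [hT, coe_transform, segalBargmann_level hn]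
  have hSid : ∀ f, S f = f := by
    intro f
    have h1 := (hasSum_level hn f).mapL (S.mkContinuous (Real.sqrt C) hbound)
    simp only [map_smul, LinearMap.mkContinuous_apply, hSl] at h1
    exact h1.unique (hasSum_level hn f)
  refine LinearMap.ext fun f => ?_
  rw [← hUS f, hSid f]
  rfl

/-- The commutative diagram for a raising operator determines the value of an intertwining map on
a level from the value of its partner on the level below. -/
theorem eq_hol_succ {n r s : ℕ} (hn : r + s + 1 = n) {φ φ' : ℕ → ℂ → ℂ}
    (T : L2 →ₗ[ℂ] seriesSpace φ) (T' : L2 →ₗ[ℂ] seriesSpace φ') (l : ℕ)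
    (h : IsMulPow n (T' (level n s r l)) (T ((rung n r s l : ℂ) • level n r s (l + 1))))
    (hT' : (T' (level n s r l) : ℂ → ℂ) = hol n s r l) :
    (T (level n r s (l + 1)) : ℂ → ℂ) = hol n r s (l + 1) := by
  funext z
  have h1 := h z
  rw [map_smul, hT', pow_mul_hol hn] at h1
  have h2 : (rung n r s l : ℂ) ≠ 0 := by exact_mod_cast (rung_pos n r s l hn).ne'
  exact mul_left_cancel₀ h2 h1

end

end CoupledSUSY

theorem mainTheorem2 (n : ℕ) (hn : 1 ≤ n) :
    (∀ z : ℂ, MemLp (CoupledSUSY.kerA1 n z) 2 volume ∧ MemLp (CoupledSUSY.kerA2 n z) 2 volume) ∧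
    ∃ (U₁ : CoupledSUSY.L2 ≃ₗ[ℂ] CoupledSUSY.F1 n) (U₂ : CoupledSUSY.L2 ≃ₗ[ℂ] CoupledSUSY.F2 n),
      -- `U₁`, `U₂` are the integral transforms with kernels `A₁`, `A₂`
      (∀ f, (U₁ f : ℂ → ℂ) = CoupledSUSY.SB1 n f) ∧
      (∀ f, (U₂ f : ℂ → ℂ) = CoupledSUSY.SB2 n f) ∧
      -- they preserve the inner products
      (∀ f g, Integrable (CoupledSUSY.innerIntegrand (CoupledSUSY.rho1 n) (U₁ f) (U₁ g)) volume ∧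
        ∫ z, CoupledSUSY.innerIntegrand (CoupledSUSY.rho1 n) (U₁ f) (U₁ g) z = inner ℂ g f) ∧
      (∀ f g, Integrable (CoupledSUSY.innerIntegrand (CoupledSUSY.rho2 n) (U₂ f) (U₂ g)) volume ∧
        ∫ z, CoupledSUSY.innerIntegrand (CoupledSUSY.rho2 n) (U₂ f) (U₂ g) z = inner ℂ g f) ∧
      -- they carry the operators `a`, `b`, `a*`, `b*`, with their domains, to `𝔞`, `𝔟`, `z^n`, `z^n`
      (∀ f g, (f, g) ∈ (CoupledSUSY.opA n).graph ↔ CoupledSUSY.IsHolA n (U₁ f) (U₂ g)) ∧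
      (∀ f g, (f, g) ∈ (CoupledSUSY.opB n).graph ↔ CoupledSUSY.IsHolB n (U₂ f) (U₁ g)) ∧
      (∀ f g, (f, g) ∈ (CoupledSUSY.opAstar n).graph ↔ CoupledSUSY.IsMulPow n (U₂ f) (U₁ g)) ∧
      (∀ f g, (f, g) ∈ (CoupledSUSY.opBstar n).graph ↔ CoupledSUSY.IsMulPow n (U₁ f) (U₂ g)) ∧
      -- `ψ_l` and `ψ̃_l` are orthonormal bases, sent to `e_l` and `ẽ_l`
      Orthonormal ℂ (CoupledSUSY.psi n) ∧
      (Submodule.span ℂ (Set.range (CoupledSUSY.psi n))).topologicalClosure = ⊤ ∧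
      Orthonormal ℂ (CoupledSUSY.psiTilde n) ∧
      (Submodule.span ℂ (Set.range (CoupledSUSY.psiTilde n))).topologicalClosure = ⊤ ∧
      (∀ l, (U₁ (CoupledSUSY.psi n l) : ℂ → ℂ) = CoupledSUSY.e n l) ∧
      (∀ l, (U₂ (CoupledSUSY.psiTilde n l) : ℂ → ℂ) = CoupledSUSY.eTilde n l) ∧
      -- they are the only bounded maps with these intertwining relations and normalization
      (∀ (T₁ : CoupledSUSY.L2 →ₗ[ℂ] CoupledSUSY.F1 n) (T₂ : CoupledSUSY.L2 →ₗ[ℂ] CoupledSUSY.F2 n),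
        (∃ C, ∀ f, CoupledSUSY.normSqOn (CoupledSUSY.rho1 n) (T₁ f) ≤ C * ‖f‖ ^ 2) →
        (∃ C, ∀ f, CoupledSUSY.normSqOn (CoupledSUSY.rho2 n) (T₂ f) ≤ C * ‖f‖ ^ 2) →
        CoupledSUSY.DiagramsCommute n T₁ T₂ →
        (T₁ (CoupledSUSY.psi n 0) : ℂ → ℂ) = CoupledSUSY.e n 0 →
        (T₂ (CoupledSUSY.psiTilde n 0) : ℂ → ℂ) = CoupledSUSY.eTilde n 0 →
        T₁ = U₁ ∧ T₂ = U₂) := by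
  have h₁ : 0 + (n - 1) + 1 = n := by omega
  have h₂ : (n - 1) + 0 + 1 = n := by omega
  have hφ₁ : CoupledSUSY.e n = CoupledSUSY.hol n 0 (n - 1) :=
    funext (CoupledSUSY.e_eq_hol hn)
  have hφ₂ : CoupledSUSY.eTilde n = CoupledSUSY.hol n (n - 1) 0 :=
    funext (CoupledSUSY.eTilde_eq_hol hn)
  have hρ₁ : CoupledSUSY.rho1 n = CoupledSUSY.sectorWeight n (n - 1) := by
    funext z
    rw [CoupledSUSY.rho1, CoupledSUSY.sectorWeight, CoupledSUSY.index_sub_one hn]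
  have hρ₂ : CoupledSUSY.rho2 n = CoupledSUSY.sectorWeight n 0 := by
    funext z
    rw [CoupledSUSY.rho2, CoupledSUSY.sectorWeight, CoupledSUSY.index_zero]
  have hψ₁ : CoupledSUSY.psi n = CoupledSUSY.level n 0 (n - 1) :=
    funext (CoupledSUSY.psi_eq_level hn)
  have hψ₂ : CoupledSUSY.psiTilde n = CoupledSUSY.level n (n - 1) 0 :=
    funext (CoupledSUSY.psiTilde_eq_level hn)
  have hA₁ : CoupledSUSY.kerA1 n = CoupledSUSY.ker n 0 (n - 1) :=
    funext₂ (CoupledSUSY.kerA1_eq_ker hn)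
  have hA₂ : CoupledSUSY.kerA2 n = CoupledSUSY.ker n (n - 1) 0 :=
    funext₂ (CoupledSUSY.kerA2_eq_ker hn)
  have hlev₁ : ⇑(CoupledSUSY.levelBasis h₁) = CoupledSUSY.level n 0 (n - 1) :=
    funext (CoupledSUSY.levelBasis_apply h₁)
  have hlev₂ : ⇑(CoupledSUSY.levelBasis h₂) = CoupledSUSY.level n (n - 1) 0 :=
    funext (CoupledSUSY.levelBasis_apply h₂)
  refine ⟨fun z => ?_, CoupledSUSY.transform h₁ hφ₁, CoupledSUSY.transform h₂ hφ₂,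
    fun f => ?_, fun f => ?_, ?_, ?_, fun f g => ?_, fun f g => ?_, fun f g => ?_, fun f g => ?_,
    ?_, ?_, ?_, ?_, fun l => ?_, fun l => ?_, ?_⟩
  · rw [hA₁, hA₂]
    exact ⟨CoupledSUSY.memLp_ker hn _ _ z, CoupledSUSY.memLp_ker hn _ _ z⟩
  · funext z
    change CoupledSUSY.segalBargmann n 0 (n - 1) f z = _
    rw [CoupledSUSY.SB1, hA₁, CoupledSUSY.segalBargmann]
  · funext z
    change CoupledSUSY.segalBargmann n (n - 1) 0 f z = _
    rw [CoupledSUSY.SB2, hA₂, CoupledSUSY.segalBargmann]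
  · rw [hρ₁]
    exact CoupledSUSY.inner_transform h₁ hφ₁
  · rw [hρ₂]
    exact CoupledSUSY.inner_transform h₂ hφ₂
  · rw [CoupledSUSY.mem_opA_graph_iff hn, CoupledSUSY.isHolA_iff]
    exact (CoupledSUSY.isHol_segalBargmann_iff h₁ f g).symm
  · rw [CoupledSUSY.mem_opB_graph_iff hn, CoupledSUSY.isHolB_iff]
    exact (CoupledSUSY.isHol_segalBargmann_iff h₂ f g).symm
  · rw [CoupledSUSY.mem_opAstar_graph_iff hn]
    exact (CoupledSUSY.isMulPow_segalBargmann_iff h₁ f g).symm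
  · rw [CoupledSUSY.mem_opBstar_graph_iff hn]
    exact (CoupledSUSY.isMulPow_segalBargmann_iff h₂ f g).symm
  · rw [hψ₁]
    exact CoupledSUSY.orthonormal_level h₁
  · rw [hψ₁, ← hlev₁]
    exact (CoupledSUSY.levelBasis h₁).dense_span
  · rw [hψ₂]
    exact CoupledSUSY.orthonormal_level h₂
  · rw [hψ₂, ← hlev₂]
    exact (CoupledSUSY.levelBasis h₂).dense_span
  · rw [hψ₁]
    exact (CoupledSUSY.segalBargmann_level h₁ l).trans (congrFun hφ₁ l).symm
  · rw [hψ₂]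
    exact (CoupledSUSY.segalBargmann_level h₂ l).trans (congrFun hφ₂ l).symm
  · rintro T₁ T₂ ⟨C₁, hC₁⟩ ⟨C₂, hC₂⟩ ⟨-, -, hastar, hbstar⟩ hT₁ hT₂
    rw [hψ₁, hφ₁] at hT₁
    rw [hψ₂, hφ₂] at hT₂
    rw [hρ₁] at hC₁
    rw [hρ₂] at hC₂
    -- each raising operator exchanges `T₁` and `T₂`, so both are determined level by level
    have hT : ∀ l, (T₁ (CoupledSUSY.level n 0 (n - 1) l) : ℂ → ℂ) =
          CoupledSUSY.hol n 0 (n - 1) l ∧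
        (T₂ (CoupledSUSY.level n (n - 1) 0 l) : ℂ → ℂ) = CoupledSUSY.hol n (n - 1) 0 l := by
      intro l
      induction l with
      | zero => exact ⟨hT₁, hT₂⟩
      | succ l ih =>
        exact ⟨CoupledSUSY.eq_hol_succ h₁ T₁ T₂ l (hastar _ _
            ((CoupledSUSY.mem_opAstar_graph_iff hn _ _).2 (CoupledSUSY.isRaise_level h₁ l))) ih.2,
          CoupledSUSY.eq_hol_succ h₂ T₂ T₁ l (hbstar _ _
            ((CoupledSUSY.mem_opBstar_graph_iff hn _ _).2 (CoupledSUSY.isRaise_level h₂ l))) ih.1⟩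
    exact ⟨CoupledSUSY.eq_transform h₁ hφ₁ T₁ hC₁ fun l => (hT l).1,
      CoupledSUSY.eq_transform h₂ hφ₂ T₂ hC₂ fun l => (hT l).2⟩
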